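/- Notation. $\mathbb D$ is the open unit disk in $\mathbb C$, $z^*$ is the complex conjugate of $z\in\mathbb C$, and $\mathbb B=\{z_1+jz_2: z_1,z_2\in\mathbb C\}$ with $j^2=-1$ is the commutative algebra of bicomplex numbers. Put $p^\pm=\tfrac12(1\pm ji)$; every $w\in\mathbb B$ is uniquely $w=p^+w^++p^-w^-$ with $w^\pm=z_1\mp iz_2\in\mathbb C$, and $\|w\|_{\mathbb B}=\sqrt{(|w^+|^2+|w^-|^2)/2}$. For functions of $z=x+iy$, $\bar\partial=\tfrac12(\partial_x+j\partial_y)$ (bicomplex) and $\frac{\partial}{\partial z^*}=\tfrac12(\partial_x+i\partial_y)$ (complex). Derivatives in $\mathbb D$ are taken in the sense of distributions, all the iterated derivatives of order $0,\dots,n$ being locally integrable functions; solutions are identified when they agree almost everywhere. A boundary condition $u=\gamma$ on $\partial\mathbb D$ means $$\lim_{\varepsilon\to0^+}\frac1\varepsilon\iint_{1-\varepsilon<|z|<1}\bigl\|u(z)-\gamma(z/|z|)\bigr\|\,dx\,dy=0$$ (which is $u|_{\partial\mathbb D}=\gamma$ if $u$ extends continuously to $\overline{\mathbb D}$). Theorem.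 Let $n$ be a positive integer, $f\in L^1(\mathbb D,\mathbb B)$ and $\gamma_k\in C(\partial\mathbb D,\mathbb B)$, $0\le k\le n-1$. Consider the conditions $(\mathrm{I}^{+})$ and $(\mathrm I^-)$, where $(\mathrm I^+)$ is: for all $z\in\mathbb D$ and $0\le k\le n-1$, $$\sum_{\ell=k}^{n-1}\frac{z^*}{2\pi i}\int_{|\zeta|=1}(-1)^{\ell-k}\frac{(\gamma_\ell^+)^*(\zeta)}{1-z^*\zeta}\frac{[(\zeta-z)^*]^{\ell-k}}{(\ell-k)!}\,d\zeta+\frac{(-1)^{n-k}z^*}{\pi}\iint_{|\zeta|<1}\frac{(f^+)^*(\zeta)}{1-z^*\zeta}\frac{[(\zeta-z)^*]^{n-1-k}}{(n-1-k)!}\,d\xi\,d\eta=0,\qquad \zeta=\xi+i\eta,$$ and $(\mathrm I^-)$ is the same with $\gamma_\ell^-$, $f^-$ in place of $(\gamma_\ell^+)^*$, $(f^+)^*$. Let $$\Phi(z)=p^+\Bigl(\sum_{k=0}^{n-1}\tfrac{(-1)^k}{2\pi i}\int_{|\zeta|=1}\tfrac{(\gamma_k^+)^*(\zeta)}{k!}\tfrac{[(\zeta-z)^*]^k}{\zeta-z}\,d\zeta+\tfrac{(-1)^n}{\pi}\iint_{|\zeta|<1}\tfrac{(f^+)^*(\zeta)}{(n-1)!}\tfrac{[(\zeta-z)^*]^{n-1}}{\zeta-z}\,d\xi\,d\eta\Bigr)^*$$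 $$\qquad+\,p^-\Bigl(\sum_{k=0}^{n-1}\tfrac{(-1)^k}{2\pi i}\int_{|\zeta|=1}\tfrac{\gamma_k^-(\zeta)}{k!}\tfrac{[(\zeta-z)^*]^k}{\zeta-z}\,d\zeta+\tfrac{(-1)^n}{\pi}\iint_{|\zeta|<1}\tfrac{f^-(\zeta)}{(n-1)!}\tfrac{[(\zeta-z)^*]^{n-1}}{\zeta-z}\,d\xi\,d\eta\Bigr);$$ the area integrals converge absolutely for almost every $z\in\mathbb D$. (a) For a function $w=p^+w^++p^-w^-:\mathbb D\to\mathbb B$ the following are equivalent: (1) $w$ solves $\bar\partial^nw=f$ in $\mathbb D$, $\bar\partial^kw=\gamma_k$ on $\partial\mathbb D$, $0\le k\le n-1$; (2) $(w^+)^*$ solves $\frac{\partial^n(w^+)^*}{\partial(z^*)^n}=(f^+)^*$ in $\mathbb D$, $\frac{\partial^k(w^+)^*}{\partial(z^*)^k}=(\gamma_k^+)^*$ on $\partial\mathbb D$, and $w^-$ solves $\frac{\partial^nw^-}{\partial(z^*)^n}=f^-$ in $\mathbb D$, $\frac{\partial^kw^-}{\partial(z^*)^k}=\gamma_k^-$ on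 $\partial\mathbb D$, $0\le k\le n-1$; (3) $(\mathrm I^+)$ and $(\mathrm I^-)$ hold, and $w=\Phi$ almost everywhere in $\mathbb D$. (b) The bicomplex Dirichlet problem in (1) is solvable if and only if both complex Dirichlet problems in (2), with data $(f^+)^*,(\gamma_k^+)^*$ and $f^-,\gamma_k^-$, are solvable, and if and only if $(\mathrm I^+)$ and $(\mathrm I^-)$ hold. (c) When it exists, the solution $w$ of the bicomplex problem is unique and $w=\Phi$ almost everywhere in $\mathbb D$. -/

import Mathlib

open MeasureTheory Set Filter Topology
open scoped ComplexConjugate ContDiff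

/-- The bicomplex numbers `z₁ + j z₂` with `z₁ z₂ : ℂ` and `j ^ 2 = -1`
(`re` is the scalar part `z₁`, `im` is the vector part `z₂`). -/
abbrev Bicomplex : Type := QuadraticAlgebra ℂ (-1) 0

namespace Bicomplex

/-- The bicomplex unit `j`. -/
def j : Bicomplex := ⟨0, 1⟩

/-- The idempotent component `w⁺ = Sc w - i Vec w`. -/
def plus (w : Bicomplex) : ℂ := w.re - Complex.I * w.im

/-- The idempotent component `w⁻ = Sc w + i Vec w`. -/
def minus (w : Bicomplex) : ℂ := w.re + Complex.I * w.im

/-- The idempotent `p⁺ = (1 + j i) / 2`. -/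
noncomputable def pPlus : Bicomplex := (1 / 2 : ℂ) • (1 + Complex.I • j)

/-- The idempotent `p⁻ = (1 - j i) / 2`. -/
noncomputable def pMinus : Bicomplex := (1 / 2 : ℂ) • (1 - Complex.I • j)

theorem mul_def (z w : Bicomplex) :
    z * w = ⟨z.re * w.re - z.im * w.im, z.re * w.im + z.im * w.re⟩ := by
  ext
  · simp; ring
  · simp

/-- The idempotent representation `w = p⁺ w⁺ + p⁻ w⁻`, with uniqueness of the components. -/
theorem eq_idempotent_iff (w : Bicomplex) (a b : ℂ) :
    w = a • pPlus + b • pMinus ↔ a = w.plus ∧ b = w.minus := by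
  have hI : Complex.I * Complex.I = -1 := Complex.I_mul_I
  constructor
  · rintro rfl
    constructor
    · simp [plus, pPlus, pMinus, j, QuadraticAlgebra.re_one, QuadraticAlgebra.im_one]
      linear_combination (a / 2 - b / 2) * hI
    · simp [minus, pPlus, pMinus, j, QuadraticAlgebra.re_one, QuadraticAlgebra.im_one]
      linear_combination (-a / 2 + b / 2) * hI
  · rintro ⟨rfl, rfl⟩
    ext
    · simp [plus, minus, pPlus, pMinus, j, QuadraticAlgebra.re_one,
        QuadraticAlgebra.im_one]; ring
    · simp [plus, minus, pPlus, pMinus, j, QuadraticAlgebra.re_one,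
        QuadraticAlgebra.im_one]
      linear_combination w.im * hI

/-- The bicomplex norm. -/
noncomputable instance : Norm Bicomplex :=
  ⟨fun w => Real.sqrt ((‖w.plus‖ ^ 2 + ‖w.minus‖ ^ 2) / 2)⟩

theorem norm_def (w : Bicomplex) : ‖w‖ = Real.sqrt ((‖w.plus‖ ^ 2 + ‖w.minus‖ ^ 2) / 2) := rfl

/-- The bicomplex norm is a multiple of the Euclidean norm of the pair of components. -/
theorem norm_eq_euclidean (w : Bicomplex) :
    ‖w‖ = ‖(!₂[w.plus, w.minus] : EuclideanSpace ℂ (Fin 2))‖ / Real.sqrt 2 := by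
  rw [norm_def, EuclideanSpace.norm_eq, Real.sqrt_div (by positivity)]
  simp [Fin.sum_univ_two]

noncomputable instance : NormedAddCommGroup Bicomplex :=
  AddGroupNorm.toNormedAddCommGroup
    { toFun := fun w => ‖w‖
      map_zero' := by simp [norm_def, plus, minus]
      add_le' := by
        intro x y
        rw [norm_eq_euclidean, norm_eq_euclidean, norm_eq_euclidean, ← add_div]
        have h : (!₂[(x + y).plus, (x + y).minus] : EuclideanSpace ℂ (Fin 2))
            = !₂[x.plus, x.minus] + !₂[y.plus, y.minus] := by
          ext i; fin_cases i
          · simp [plus]; ring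
          · simp [minus]; ring
        rw [h]
        gcongr
        exact norm_add_le _ _
      neg' := by
        intro x
        have h1 : (-x).plus = -x.plus := by simp [plus]; ring
        have h2 : (-x).minus = -x.minus := by simp [minus]; ring
        simp [norm_def, h1, h2]
      eq_zero_of_map_eq_zero' := by
        intro x hx
        have h0 : (‖x.plus‖ ^ 2 + ‖x.minus‖ ^ 2) / 2 = 0 :=
          (Real.sqrt_eq_zero (by positivity)).1 hx
        have h1 : x.plus = 0 := by
          have : ‖x.plus‖ ^ 2 = 0 := by nlinarith [sq_nonneg ‖x.plus‖, sq_nonneg ‖x.minus‖]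
          simpa using this
        have h2 : x.minus = 0 := by
          have : ‖x.minus‖ ^ 2 = 0 := by nlinarith [sq_nonneg ‖x.plus‖, sq_nonneg ‖x.minus‖]
          simpa using this
        rw [(eq_idempotent_iff x 0 0).2 ⟨h1.symm, h2.symm⟩]
        simp }

noncomputable instance : NormedSpace ℝ Bicomplex where
  norm_smul_le := by
    intro r x
    have h1 : (r • x).plus = r * x.plus := by simp [plus]; ring
    have h2 : (r • x).minus = r * x.minus := by simp [minus]; ring
    have h3 : ((‖(r • x).plus‖ ^ 2 + ‖(r • x).minus‖ ^ 2) / 2)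
        = ‖r‖ ^ 2 * ((‖x.plus‖ ^ 2 + ‖x.minus‖ ^ 2) / 2) := by
      rw [h1, h2]; simp only [norm_mul, Complex.norm_real]; ring
    rw [norm_def, h3, Real.sqrt_mul (by positivity), Real.sqrt_sq (norm_nonneg r), norm_def]

instance : FiniteDimensional ℝ Bicomplex :=
  Module.Finite.trans ℂ Bicomplex

instance : CompleteSpace Bicomplex := FiniteDimensional.complete ℝ Bicomplex

end Bicomplex

namespace PolyDirichlet

/-- The open unit disk of the complex plane. -/
abbrev disk : Set ℂ := Metric.ball (0 : ℂ) 1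

/-- The unit circle. -/
abbrev circle : Set ℂ := Metric.sphere (0 : ℂ) 1

section Equation

variable {E : Type*} [NormedAddCommGroup E] [NormedSpace ℝ E]

/-- `½ (∂/∂x + J ∂/∂y) u = v` in the unit disk in the sense of distributions, for locally
integrable `u` and `v`. For `E = ℂ` and `J` the multiplication by `i`, the operator is `∂/∂z*`;
for bicomplex-valued functions and `J` the multiplication by `j`, it is the bicomplex `∂̄`. -/
def IsWeakDbar (J : E → E) (u v : ℂ → E) : Prop :=
  LocallyIntegrableOn u disk ∧ LocallyIntegrableOn v disk ∧
    ∀ φ : ℂ → ℝ, ContDiff ℝ ∞ φ → HasCompactSupport φ → tsupport φ ⊆ disk →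
      ∫ z in disk, (1 / 2 : ℝ) • (fderiv ℝ φ z 1 • u z + fderiv ℝ φ z Complex.I • J (u z))
        = -∫ z in disk, φ z • v z

/-- `v` is (a.e. in the disk) the `k`-fold iterate of the weak operator `½ (∂/∂x + J ∂/∂y)`
applied to `w`. -/
def IsWeakDbarIter (J : E → E) : ℕ → (ℂ → E) → (ℂ → E) → Prop
  | 0, w, v => LocallyIntegrableOn w disk ∧ w =ᵐ[volume.restrict disk] v
  | k + 1, w, v => ∃ u, IsWeakDbarIter J k w u ∧ IsWeakDbar J u v

/-- `u = g` on the unit circle, in the `L¹`-mean sense: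
`(1/ε) ∬_{1-ε<|z|<1} ‖u(z) - g(z/|z|)‖ dx dy → 0` as `ε → 0+`. The integral is the lower Lebesgue
integral, so that it is `∞` when the integrand is not integrable. -/
def HasBoundaryValue (u g : ℂ → E) : Prop :=
  Tendsto (fun ε : ℝ => ENNReal.ofReal ε⁻¹ *
      ∫⁻ z in {z : ℂ | 1 - ε < ‖z‖ ∧ ‖z‖ < 1}, ‖u z - g (z / (‖z‖ : ℂ))‖ₑ)
    (𝓝[>] 0) (𝓝 0)

/-- `w` solves the polyanalytic Dirichlet problem `D ^ n w = f` in the disk,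
`D ^ k w = γ k` on the circle for `0 ≤ k ≤ n - 1`, where `D = ½ (∂/∂x + J ∂/∂y)`. -/
def SolvesDirichlet (J : E → E) (n : ℕ) (f : ℂ → E) (γ : ℕ → ℂ → E) (w : ℂ → E) : Prop :=
  IsWeakDbarIter J n w f ∧
    ∀ k < n, ∃ v, IsWeakDbarIter J k w v ∧ HasBoundaryValue v (γ k)

end Equation

/-- The complex problem: `∂ⁿw/∂(z*)ⁿ = f` in the disk, `∂ᵏw/∂(z*)ᵏ = γ k` on the circle. -/
def SolvesComplex (n : ℕ) (f : ℂ → ℂ) (γ : ℕ → ℂ → ℂ) (w : ℂ → ℂ) : Prop :=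
  SolvesDirichlet (fun c => Complex.I * c) n f γ w

/-- The bicomplex problem: `∂̄ⁿ w = f` in the disk, `∂̄ᵏ w = γ k` on the circle. -/
def SolvesBicomplex (n : ℕ) (f : ℂ → Bicomplex) (γ : ℕ → ℂ → Bicomplex) (w : ℂ → Bicomplex) :
    Prop :=
  SolvesDirichlet (fun b => Bicomplex.j * b) n f γ w

/-- The boundary and area integral conditions on the data of a complex problem. -/
def IntegralConditions (n : ℕ) (f : ℂ → ℂ) (γ : ℕ → ℂ → ℂ) : Prop :=
  ∀ z ∈ disk, ∀ k < n,
    ∑ l ∈ Finset.Ico k n, conj z / (2 * Real.pi * Complex.I) *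
        (∮ ζ in C(0, 1), (-1) ^ (l - k) * (γ l ζ / (1 - conj z * ζ)) *
          (conj (ζ - z) ^ (l - k) / ((l - k).factorial : ℂ)))
      + (-1) ^ (n - k) * conj z / Real.pi *
        (∫ ζ in disk, f ζ / (1 - conj z * ζ) *
          (conj (ζ - z) ^ (n - 1 - k) / ((n - 1 - k).factorial : ℂ))) = 0

/-- The integrand of the area integral in the Cauchy–Pompeiu-type formula. -/
noncomputable def areaIntegrand (n : ℕ) (f : ℂ → ℂ) (z ζ : ℂ) : ℂ :=
  f ζ / ((n - 1).factorial : ℂ) * (conj (ζ - z) ^ (n - 1) / (ζ - z))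

/-- The Cauchy–Pompeiu-type formula built from the data of a complex problem. -/
noncomputable def cauchyPompeiu (n : ℕ) (f : ℂ → ℂ) (γ : ℕ → ℂ → ℂ) (z : ℂ) : ℂ :=
  ∑ k ∈ Finset.range n, (-1) ^ k / (2 * Real.pi * Complex.I) *
      (∮ ζ in C(0, 1), γ k ζ / (k.factorial : ℂ) * (conj (ζ - z) ^ k / (ζ - z)))
    + (-1) ^ n / Real.pi * ∫ ζ in disk, areaIntegrand n f z ζ

/-- The function `z ↦ (w⁺(z))*`. -/
noncomputable def plusConj (w : ℂ → Bicomplex) : ℂ → ℂ := fun z => conj (w z).plus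

/-- The function `z ↦ w⁻(z)`. -/
noncomputable def minusPart (w : ℂ → Bicomplex) : ℂ → ℂ := fun z => (w z).minus

/-- The bicomplex Cauchy–Pompeiu-type formula. -/
noncomputable def bicomplexCauchyPompeiu (n : ℕ) (f : ℂ → Bicomplex) (γ : ℕ → ℂ → Bicomplex)
    (z : ℂ) : Bicomplex :=
  conj (cauchyPompeiu n (plusConj f) (fun k => plusConj (γ k)) z) • Bicomplex.pPlus
    + cauchyPompeiu n (minusPart f) (fun k => minusPart (γ k)) z • Bicomplex.pMinus

end PolyDirichlet

open PolyDirichlet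

/-! The idempotent components decouple the problem. Multiplication by `j` acts as multiplication by
`i` on `w⁻` and by `-i` on `w⁺`, so after conjugating `w⁺` the bicomplex operator becomes `∂/∂z*` on
both parts. Equation, iterates and boundary values all split along these two real-linear maps
(`solvesBicomplex_iff_parts`). What remains is the complex problem, `solvesComplex_iff`.

Necessity rests on a Green formula for weak solutions with boundary values in the mean
(`IsWeakDbar.green`). The weak equation is tested with a smooth function times a radial cut-off, and
the derivative of the cut-off is a density that concentrates on the circle. Iterating along a
sequence with `∂Φₖ₊₁/∂z* = Φₖ` expresses `∫ Φ₀ w` through the data alone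
(`SolvesComplex.iterated_green`). Two sequences are used. A test function followed by its Cauchy
potentials gives, by Fubini, the pairing of the test function with the Cauchy–Pompeiu formula, so
every solution equals that formula; this is also uniqueness. The sequence `0`, then `[(ζ - z)*]ᵐ /
(m! (1 - z*ζ))`, has vanishing left side, and applied to the `k`-th derivative of `w` it gives the
`k`-th integral condition.

Sufficiency is an induction on the order (`exists_solvesComplex`). The conditions with `k ≥ 1`
produce `u` solving the problem with data `f, γ₁, …`. Green's formula for `u` turns the condition `k
= 0` into the condition of order one for the data `u, γ₀`, and the formula of order one then gives
`w`. It satisfies `∂w/∂z* = u` by the Cauchy–Pompeiu formula for test functions.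

The delicate point is the boundary value when the density is only integrable. Adding the condition
replaces the Cauchy kernel by `(1 - |z|²) / ((ζ - z)(1 - z*ζ))`. On the circle this is the Poisson
kernel, so the contour term converges uniformly to `γ₀`. In the disk its modulus has means over thin
annuli that are bounded uniformly in the pole `ζ` and tend to `0` for each fixed `ζ`
(`lintegral_reflectedKernel_annulus_le` and its primed variant); dominated convergence makes the
area term vanish in the mean. -/

namespace PolyDirichlet

/-! ### The operator `∂/∂z*` on differentiable functions -/

/-- The classical operator `∂/∂z* = ½ (∂/∂x + i ∂/∂y)`. -/
noncomputable def dbar (φ : ℂ → ℂ) (z : ℂ) : ℂ :=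
  (1 / 2) * (fderiv ℝ φ z 1 + Complex.I * fderiv ℝ φ z Complex.I)

theorem dbar_mul {φ ψ : ℂ → ℂ} {z : ℂ} (hφ : DifferentiableAt ℝ φ z)
    (hψ : DifferentiableAt ℝ ψ z) :
    dbar (fun ζ => φ ζ * ψ ζ) z = dbar φ z * ψ z + φ z * dbar ψ z := by
  simp only [dbar, fderiv_fun_mul hφ hψ, add_apply, smul_apply, smul_eq_mul]
  ring

theorem dbar_eq_of_hasFDerivAt {φ : ℂ → ℂ} {L : ℂ →L[ℝ] ℂ} {z : ℂ} (h : HasFDerivAt φ L z) :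
    dbar φ z = (1 / 2) * (L 1 + Complex.I * L Complex.I) := by
  rw [dbar, h.fderiv]

theorem dbar_eq_zero {φ : ℂ → ℂ} {z : ℂ} (h : DifferentiableAt ℂ φ z) : dbar φ z = 0 := by
  rw [dbar_eq_of_hasFDerivAt (h.hasFDerivAt.restrictScalars ℝ)]
  have := (fderiv ℂ φ z).map_smul Complex.I 1
  simp only [smul_eq_mul, mul_one] at this
  simp only [ContinuousLinearMap.coe_restrictScalars', this]
  linear_combination (1 / 2 : ℂ) * (fderiv ℂ φ z 1) * Complex.I_mul_I

theorem dbar_ofReal (φ : ℂ → ℝ) {z : ℂ} (h : DifferentiableAt ℝ φ z) :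
    dbar (fun ζ => (φ ζ : ℂ)) z
      = (1 / 2) * (fderiv ℝ φ z 1 + Complex.I * fderiv ℝ φ z Complex.I) := by
  rw [dbar_eq_of_hasFDerivAt (φ := fun ζ => (φ ζ : ℂ))
    (Complex.ofRealCLM.hasFDerivAt.comp z h.hasFDerivAt)]
  simp

theorem contDiff_conj_sub_pow (z : ℂ) (m : ℕ) :
    ContDiff ℝ ∞ (fun ζ : ℂ => conj (ζ - z) ^ m / (m.factorial : ℂ)) := by
  have h : ContDiff ℝ ∞ (fun ζ : ℂ => conj (ζ - z)) :=
    Complex.conjCLE.contDiff.comp (contDiff_id.sub contDiff_const)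
  exact (h.pow m).div_const _

/-- Conjugation plays the role of the variable for `∂/∂z*`, so the factorial normalization makes
these powers a chain of successive primitives. -/
theorem dbar_conj_sub_pow (z ζ : ℂ) (m : ℕ) :
    dbar (fun ζ : ℂ => conj (ζ - z) ^ (m + 1) / ((m + 1).factorial : ℂ)) ζ
      = conj (ζ - z) ^ m / (m.factorial : ℂ) := by
  have h : HasFDerivAt (fun ζ : ℂ => conj (ζ - z))
      (Complex.conjCLE : ℂ →L[ℝ] ℂ) ζ :=
    Complex.conjCLE.toContinuousLinearMap.hasFDerivAt.comp ζ
      ((hasFDerivAt_id ζ).sub_const z)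
  have h2 := ((h.pow (m + 1)).mul_const (((m + 1).factorial : ℂ)⁻¹))
  simp only [← div_eq_mul_inv] at h2
  rw [dbar_eq_of_hasFDerivAt h2]
  have h3 : ((m + 1 : ℕ) : ℂ) ≠ 0 := by exact_mod_cast Nat.succ_ne_zero m
  have h4 : ((m.factorial : ℕ) : ℂ) ≠ 0 := by exact_mod_cast m.factorial_ne_zero
  have h5 : ((m : ℂ) + 1) ≠ 0 := by exact_mod_cast h3
  simp [Nat.factorial_succ]
  field_simp
  linear_combination -(conj ζ - conj z) ^ m * Complex.I_sq

/-- The partial derivatives of a smooth function are smooth. -/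
theorem continuous_dbar {φ : ℂ → ℂ} (h : ContDiff ℝ ∞ φ) : Continuous (dbar φ) := by
  have h1 : Continuous (fderiv ℝ φ) := h.continuous_fderiv (by simp)
  unfold dbar
  fun_prop

theorem support_dbar_subset (φ : ℂ → ℂ) : Function.support (dbar φ) ⊆ tsupport φ := by
  intro z hz
  by_contra h
  apply hz
  have : fderiv ℝ φ z = 0 := by
    have h1 := fderiv_of_notMem_tsupport (𝕜 := ℝ) h
    exact h1
  simp [dbar, this]

/-! ### Integrability -/

theorem integrableOn_mul_of_continuousOn {K : ℂ → ℂ} {u : ℂ → ℂ} (hu : IntegrableOn u disk)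
    (hK : ContinuousOn K (Metric.closedBall 0 1)) : IntegrableOn (fun z => K z * u z) disk := by
  obtain ⟨C, hC⟩ := (isCompact_closedBall (0 : ℂ) 1).exists_bound_of_continuousOn hK
  refine hu.bdd_mul (c := C)
    ((hK.mono Metric.ball_subset_closedBall).aestronglyMeasurable measurableSet_ball) ?_
  filter_upwards [ae_restrict_mem measurableSet_ball] with z hz
  exact hC z (Metric.ball_subset_closedBall hz)

/-- A locally integrable function on the disk is integrable against continuous functions with
compact support in the disk. -/
theorem integrable_smul_of_hasCompactSupport {E : Type*} [NormedAddCommGroup E] [NormedSpace ℝ E]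
    {K : ℂ → ℝ} {S : Set ℂ} {u : ℂ → E} (hu : LocallyIntegrableOn u disk)
    (hK : Continuous K) (hS : IsCompact S) (hKS : Function.support K ⊆ S) (hSD : S ⊆ disk) :
    IntegrableOn (fun z => K z • u z) disk := by
  have h1 : IntegrableOn (fun z => K z • u z) S :=
    (hu.integrableOn_compact_subset hSD hS).continuousOn_smul hK.continuousOn hS
  have h2 : Function.support (fun z => K z • u z) ⊆ S := fun z hz => hKS (by
    intro h0; apply hz; simp [h0])
  rw [integrableOn_iff_integrable_of_support_subset h2] at h1
  exact h1.integrableOn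

theorem integrable_mul_of_hasCompactSupport {K : ℂ → ℂ} {S : Set ℂ} {u : ℂ → ℂ}
    (hu : LocallyIntegrableOn u disk)
    (hK : Continuous K) (hS : IsCompact S) (hKS : Function.support K ⊆ S) (hSD : S ⊆ disk) :
    IntegrableOn (fun z => K z * u z) disk := by
  have h1 : IntegrableOn (fun z => K z * u z) S :=
    (hu.integrableOn_compact_subset hSD hS).continuousOn_mul hK.continuousOn hS
  have h2 : Function.support (fun z => K z * u z) ⊆ S := fun z hz => hKS (by
    intro h0; apply hz; simp [h0])
  rw [integrableOn_iff_integrable_of_support_subset h2] at h1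
  exact h1.integrableOn

/-- The weak equation tested against complex-valued test functions. -/
theorem IsWeakDbar.integral_dbar_mul {u v : ℂ → ℂ}
    (h : IsWeakDbar (fun c => Complex.I * c) u v) {φ : ℂ → ℂ} (hφ : ContDiff ℝ ∞ φ)
    (hc : HasCompactSupport φ) (hs : tsupport φ ⊆ disk) :
    ∫ z in disk, dbar φ z * u z = -∫ z in disk, φ z * v z := by
  obtain ⟨hu, hv, h⟩ := h
  -- The weak equation allows real test functions only; it is applied to the real and imaginary
  -- parts. Integrability is carried along because recombining the two identities splits integrals
  -- of sums.
  have key : ∀ (ψ : ℂ → ℝ), ContDiff ℝ ∞ ψ → tsupport ψ ⊆ tsupport φ →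
      (IntegrableOn (fun z => dbar (fun ζ => (ψ ζ : ℂ)) z * u z) disk ∧
        IntegrableOn (fun z => (ψ z : ℂ) * v z) disk) ∧
      ∫ z in disk, dbar (fun ζ => (ψ ζ : ℂ)) z * u z = -∫ z in disk, (ψ z : ℂ) * v z := by
    intro ψ hψ hψs
    have hψC : ContDiff ℝ ∞ (fun ζ => (ψ ζ : ℂ)) := Complex.ofRealCLM.contDiff.comp hψ
    have hsupp : tsupport (fun ζ => (ψ ζ : ℂ)) ⊆ tsupport φ := by
      refine subset_trans (closure_mono ?_) hψs
      intro z hz; simpa using hz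
    refine ⟨⟨?_, ?_⟩, ?_⟩
    · exact integrable_mul_of_hasCompactSupport hu (continuous_dbar hψC) hc
        ((support_dbar_subset _).trans hsupp) hs
    · exact integrable_mul_of_hasCompactSupport hv hψC.continuous hc
        (subset_closure.trans hsupp) hs
    · have := h ψ hψ (hc.of_isClosed_subset (isClosed_tsupport _) hψs) (hψs.trans hs)
      simp only [Complex.real_smul] at this
      rw [← this]
      refine integral_congr_ae (Eventually.of_forall fun z => ?_)
      simp only [dbar_ofReal ψ (hψ.differentiable (by simp) z)]
      push_cast
      ring
  have hre : ContDiff ℝ ∞ (fun z => (φ z).re) := Complex.reCLM.contDiff.comp hφ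
  have him : ContDiff ℝ ∞ (fun z => (φ z).im) := Complex.imCLM.contDiff.comp hφ
  have hsre : tsupport (fun z => (φ z).re) ⊆ tsupport φ := closure_mono fun z hz => by
    intro h0; apply hz; simp [h0]
  have hsim : tsupport (fun z => (φ z).im) ⊆ tsupport φ := closure_mono fun z hz => by
    intro h0; apply hz; simp [h0]
  obtain ⟨⟨i1, i2⟩, e1⟩ := key _ hre hsre
  obtain ⟨⟨i3, i4⟩, e2⟩ := key _ him hsim
  have hd : ∀ z, dbar φ z = dbar (fun ζ => ((φ ζ).re : ℂ)) z
      + Complex.I * dbar (fun ζ => ((φ ζ).im : ℂ)) z := by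
    intro z
    have d1 := hφ.differentiable (by simp) z
    rw [dbar_eq_of_hasFDerivAt d1.hasFDerivAt,
      dbar_eq_of_hasFDerivAt (φ := fun ζ => ((φ ζ).re : ℂ)) (Complex.ofRealCLM.hasFDerivAt.comp z
        (Complex.reCLM.hasFDerivAt.comp z d1.hasFDerivAt)),
      dbar_eq_of_hasFDerivAt (φ := fun ζ => ((φ ζ).im : ℂ)) (Complex.ofRealCLM.hasFDerivAt.comp z
        (Complex.imCLM.hasFDerivAt.comp z d1.hasFDerivAt))]
    simp only [ContinuousLinearMap.comp_apply, Complex.ofRealCLM_apply, Complex.reCLM_apply,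
      Complex.imCLM_apply]
    have r1 := Complex.re_add_im (fderiv ℝ φ z 1)
    have r2 := Complex.re_add_im (fderiv ℝ φ z Complex.I)
    linear_combination -(1 / 2 : ℂ) * r1 - Complex.I / 2 * r2
  have l1 : ∫ z in disk, dbar φ z * u z = ∫ z in disk, (dbar (fun ζ => ((φ ζ).re : ℂ)) z * u z
      + Complex.I * (dbar (fun ζ => ((φ ζ).im : ℂ)) z * u z)) := by
    congr 1; ext z; rw [hd]; ring
  have l2 : ∫ z in disk, φ z * v z = ∫ z in disk, (((φ z).re : ℂ) * v z
      + Complex.I * (((φ z).im : ℂ) * v z)) := by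
    congr 1; ext z; linear_combination -(v z) * Complex.re_add_im (φ z)
  rw [l1, l2, integral_add i1 (i3.const_mul _), integral_add i2 (i4.const_mul _),
    integral_const_mul, integral_const_mul, e1, e2]
  ring

/-! ### Boundary values in the mean -/

/-- The annulus `1 - ε < |z| < 1`. -/
def annulus (ε : ℝ) : Set ℂ := {z : ℂ | 1 - ε < ‖z‖ ∧ ‖z‖ < 1}

theorem measurableSet_annulus (ε : ℝ) : MeasurableSet (annulus ε) :=
  (measurableSet_lt measurable_const measurable_norm).inter
    (measurableSet_lt measurable_norm measurable_const)

theorem annulus_subset_disk (ε : ℝ) : annulus ε ⊆ disk := fun z hz => by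
  simpa using hz.2

/-- The area is `π (2ε - ε²)`. After division by `ε` a constant error therefore costs at most `2π`
times its size. -/
theorem volume_annulus_le {ε : ℝ} (h0 : 0 < ε) (h1 : ε < 1) :
    volume (annulus ε) ≤ ENNReal.ofReal (2 * Real.pi * ε) := by
  have hsub : annulus ε ⊆ Metric.ball 0 1 \ Metric.ball 0 (1 - ε) := fun z hz => by
    have h3 := hz.1
    have h4 := hz.2
    simp only [Set.mem_sdiff, Metric.mem_ball, dist_zero_right]
    exact ⟨h4, by linarith⟩
  refine (measure_mono hsub).trans ?_
  rw [measure_sdiff (Metric.ball_subset_ball (by linarith)) measurableSet_ball.nullMeasurableSet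
    measure_ball_lt_top.ne, Complex.volume_ball, Complex.volume_ball, tsub_le_iff_right]
  have hpi : ((NNReal.pi : NNReal) : ENNReal) = ENNReal.ofReal Real.pi := by
    rw [← NNReal.coe_real_pi, ENNReal.ofReal_coe_nnreal]
  rw [hpi, ← ENNReal.ofReal_pow (by norm_num), ← ENNReal.ofReal_pow (by linarith),
    ← ENNReal.ofReal_mul (by norm_num), ← ENNReal.ofReal_mul (by nlinarith),
    ← ENNReal.ofReal_add (by positivity) (by positivity)]
  apply ENNReal.ofReal_le_ofReal
  nlinarith [Real.pi_pos, mul_pos Real.pi_pos (mul_pos h0 h0)]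

section Mean

variable {E F : Type*} [NormedAddCommGroup E] [NormedAddCommGroup F]

/-- Comparison of boundary values in the mean, up to uniformly small errors. -/
theorem HasBoundaryValue.of_le {u g : ℂ → E} {U G : ℂ → F} (h : HasBoundaryValue u g)
    (C : NNReal) (hb : ∀ δ : NNReal, 0 < δ → ∃ r < (1 : ℝ), ∀ z : ℂ, r < ‖z‖ → ‖z‖ < 1 →
      ‖U z - G (z / (‖z‖ : ℂ))‖ₑ ≤ C * ‖u z - g (z / (‖z‖ : ℂ))‖ₑ + δ) :
    HasBoundaryValue U G := by
  unfold HasBoundaryValue at h ⊢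
  rw [ENNReal.tendsto_nhds_zero] at h ⊢
  intro η hη
  rcases eq_or_ne η ⊤ with rfl | hηt
  · exact Eventually.of_forall fun _ => le_top
  lift η to NNReal using hηt
  have hη' : 0 < η := by exact_mod_cast hη
  -- Half of `η` pays for the uniform error, whose mean over the annulus carries the factor `2π`;
  -- the other half pays for `C` times the given mean. Dividing by `C + 1` below also covers `C =
  -- 0`.
  obtain ⟨r, hr, hrb⟩ := hb (η / 2 / (2 * NNReal.pi)) (by
    have := NNReal.pi_pos; positivity)
  have h1 := h ((η / 2 / (C + 1) : NNReal) : ENNReal) (by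
    have : 0 < η / 2 / (C + 1) := by positivity
    exact_mod_cast this)
  have h2 : ∀ᶠ ε : ℝ in 𝓝[>] 0, ε < 1 - r :=
    nhdsWithin_le_nhds (Iio_mem_nhds (by linarith))
  have h3 : ∀ᶠ ε : ℝ in 𝓝[>] 0, ε < 1 := nhdsWithin_le_nhds (Iio_mem_nhds (by norm_num))
  filter_upwards [h1, h2, h3, self_mem_nhdsWithin] with ε h1 h2 h3 h0
  have h0 : 0 < ε := h0
  have hvol := volume_annulus_le h0 h3
  change ENNReal.ofReal ε⁻¹ * ∫⁻ z in annulus ε, _ ≤ _ at h1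
  change ENNReal.ofReal ε⁻¹ * ∫⁻ z in annulus ε, _ ≤ _
  calc ENNReal.ofReal ε⁻¹ * ∫⁻ z in annulus ε, ‖U z - G (z / (‖z‖ : ℂ))‖ₑ
      ≤ ENNReal.ofReal ε⁻¹ * ∫⁻ z in annulus ε, (C * ‖u z - g (z / (‖z‖ : ℂ))‖ₑ
          + ((η / 2 / (2 * NNReal.pi) : NNReal) : ENNReal)) := by
        refine mul_le_mul_right (setLIntegral_mono' (measurableSet_annulus ε) fun z hz =>
          hrb z (by have := hz.1; linarith) hz.2) _
    _ = C * (ENNReal.ofReal ε⁻¹ * ∫⁻ z in annulus ε, ‖u z - g (z / (‖z‖ : ℂ))‖ₑ)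
        + ((η / 2 / (2 * NNReal.pi) : NNReal) : ENNReal)
          * (ENNReal.ofReal ε⁻¹ * volume (annulus ε)) := by
        rw [lintegral_add_right _ measurable_const, lintegral_const,
          Measure.restrict_apply_univ, lintegral_const_mul' _ _ ENNReal.coe_ne_top]
        ring
    _ ≤ (C + 1) * ((η / 2 / (C + 1) : NNReal) : ENNReal)
        + ((η / 2 / (2 * NNReal.pi) : NNReal) : ENNReal) * ((2 * NNReal.pi : NNReal) : ENNReal) := by
        gcongr
        · exact le_self_add
        · calc ENNReal.ofReal ε⁻¹ * volume (annulus ε)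
              ≤ ENNReal.ofReal ε⁻¹ * ENNReal.ofReal (2 * Real.pi * ε) := by gcongr
            _ = ENNReal.ofReal (2 * Real.pi) := by
              rw [← ENNReal.ofReal_mul (by positivity)]
              congr 1
              field_simp
            _ = ((2 * NNReal.pi : NNReal) : ENNReal) := by
              rw [← ENNReal.ofReal_coe_nnreal]
              simp
            _ ≤ _ := le_rfl
    _ = (η : ENNReal) := by
        have hpi := NNReal.pi_pos.ne'
        have : (C + 1) * (η / 2 / (C + 1)) + (η / 2 / (2 * NNReal.pi)) * (2 * NNReal.pi) = η := by
          rw [mul_div_cancel₀ _ (by positivity), div_mul_cancel₀ _ (by positivity)]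
          exact add_halves η
        exact_mod_cast this

theorem HasBoundaryValue.congr_ae {u v g : ℂ → E} (h : HasBoundaryValue u g)
    (huv : u =ᵐ[volume.restrict disk] v) : HasBoundaryValue v g := by
  unfold HasBoundaryValue at h ⊢
  convert h using 3 with ε
  refine lintegral_congr_ae ?_
  have := ae_restrict_of_ae_restrict_of_subset (annulus_subset_disk ε) huv
  filter_upwards [this] with z hz
  rw [hz]

/-- A locally integrable function with bounded boundary values in the mean is integrable. -/
theorem HasBoundaryValue.integrableOn {u g : ℂ → E} (h : HasBoundaryValue u g)
    (hu : LocallyIntegrableOn u disk) (hg : ContinuousOn g circle) : IntegrableOn u disk := by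
  obtain ⟨M, hM⟩ := (isCompact_sphere (0 : ℂ) 1).exists_bound_of_continuousOn hg
  have h1 : ∀ᶠ ε : ℝ in 𝓝[>] 0, ENNReal.ofReal ε⁻¹ *
      ∫⁻ z in annulus ε, ‖u z - g (z / (‖z‖ : ℂ))‖ₑ < 1 :=
    h (Iio_mem_nhds one_pos)
  have h3 : ∀ᶠ ε : ℝ in 𝓝[>] 0, ε < 1 := nhdsWithin_le_nhds (Iio_mem_nhds (by norm_num))
  -- A single `ε` with finite mean suffices: the rest of the disk lies in a compact subset, where
  -- local integrability applies.
  obtain ⟨ε, h1, h3, h0⟩ := (h1.and (h3.and self_mem_nhdsWithin)).exists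
  have h0 : 0 < ε := h0
  have hsplit : disk ⊆ Metric.closedBall 0 (1 - ε) ∪ annulus ε := fun z hz => by
    simp only [Metric.mem_ball, dist_zero_right] at hz
    rcases le_or_gt ‖z‖ (1 - ε) with h | h
    · left; simpa using h
    · right; exact ⟨h, hz⟩
  refine IntegrableOn.mono_set (IntegrableOn.union ?_ ?_) hsplit
  · refine hu.integrableOn_compact_subset ?_ (isCompact_closedBall _ _)
    exact Metric.closedBall_subset_ball (by linarith)
  · refine ⟨(hu.aestronglyMeasurable).mono_measure
      (Measure.restrict_mono (annulus_subset_disk ε) le_rfl), ?_⟩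
    have hlt : ∫⁻ z in annulus ε, ‖u z - g (z / (‖z‖ : ℂ))‖ₑ < ⊤ := by
      by_contra htop
      rw [not_lt, top_le_iff] at htop
      rw [htop, ENNReal.mul_top (by simp [h0])] at h1
      exact absurd h1 (by simp)
    have hvol : volume (annulus ε) < ⊤ :=
      (volume_annulus_le h0 h3).trans_lt ENNReal.ofReal_lt_top
    calc ∫⁻ z in annulus ε, ‖u z‖ₑ
        ≤ ∫⁻ z in annulus ε, (‖u z - g (z / (‖z‖ : ℂ))‖ₑ + ENNReal.ofReal M) := by
          refine setLIntegral_mono' (measurableSet_annulus ε) fun z hz => ?_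
          have hz0 : ‖z‖ ≠ 0 := by have := hz.1; intro h; linarith
          have hmem : z / (‖z‖ : ℂ) ∈ circle := by simp [hz0]
          calc ‖u z‖ₑ = ‖(u z - g (z / (‖z‖ : ℂ))) + g (z / (‖z‖ : ℂ))‖ₑ := by simp
            _ ≤ ‖u z - g (z / (‖z‖ : ℂ))‖ₑ + ‖g (z / (‖z‖ : ℂ))‖ₑ := enorm_add_le _ _
            _ ≤ _ := by
              gcongr
              rw [← ofReal_norm]
              exact ENNReal.ofReal_le_ofReal (hM _ hmem)
      _ < ⊤ := by
          rw [lintegral_add_right _ measurable_const, lintegral_const,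
            Measure.restrict_apply_univ]
          exact ENNReal.add_lt_top.2 ⟨hlt, ENNReal.mul_lt_top ENNReal.ofReal_lt_top hvol⟩

end Mean

/-- Multiplication by a function that is continuous on the closed disk preserves boundary
values in the mean. -/
theorem HasBoundaryValue.mul_left {u g K : ℂ → ℂ} (h : HasBoundaryValue u g)
    (hg : ContinuousOn g circle) (hK : ContinuousOn K (Metric.closedBall 0 1)) :
    HasBoundaryValue (fun z => K z * u z) (fun z => K z * g z) := by
  obtain ⟨M, hM⟩ := (isCompact_sphere (0 : ℂ) 1).exists_bound_of_continuousOn hg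
  obtain ⟨C, hC⟩ := (isCompact_closedBall (0 : ℂ) 1).exists_bound_of_continuousOn hK
  have hM0 : 0 ≤ M := (norm_nonneg _).trans (hM 1 (by simp))
  have hC0 : 0 ≤ C := (norm_nonneg _).trans (hC 0 (by simp))
  refine h.of_le ⟨C, hC0⟩ fun δ hδ => ?_
  have huc := (isCompact_closedBall (0 : ℂ) 1).uniformContinuousOn_of_continuous hK
  rw [Metric.uniformContinuousOn_iff] at huc
  obtain ⟨η, hη, hη'⟩ := huc (δ / (M + 1)) (by have : (0 : ℝ) < δ := hδ; positivity)
  refine ⟨max (1 - η) 0, by simp [hη], fun z hz1 hz2 => ?_⟩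
  rw [max_lt_iff] at hz1
  set a := z / (‖z‖ : ℂ) with ha
  have hz0 : ‖z‖ ≠ 0 := hz1.2.ne'
  have hmem : a ∈ circle := by simp [ha, hz0]
  have hza : dist z a < η := by
    -- The point lies on the ray through `a`, at distance `1 - |z|` from it.
    have h1 : z = (‖z‖ : ℂ) * a := by
      rw [ha, mul_div_cancel₀]; exact_mod_cast hz0
    have h2 : z - a = ((‖z‖ - 1 : ℝ) : ℂ) * a := by
      push_cast; linear_combination h1
    have h3 : ‖a‖ = 1 := by simpa using hmem
    rw [dist_eq_norm, h2, norm_mul, h3, mul_one, Complex.norm_real, Real.norm_eq_abs,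
      abs_of_nonpos (by linarith)]
    linarith [hz1.1]
  have hzb : z ∈ Metric.closedBall (0 : ℂ) 1 := by simpa using hz2.le
  have hKd := hη' z hzb a (Metric.sphere_subset_closedBall hmem) hza
  rw [dist_eq_norm] at hKd
  have key : ‖K z * u z - K a * g a‖ ≤ C * ‖u z - g a‖ + δ := by
    calc ‖K z * u z - K a * g a‖ = ‖K z * (u z - g a) + (K z - K a) * g a‖ := by ring_nf
      _ ≤ ‖K z‖ * ‖u z - g a‖ + ‖K z - K a‖ * ‖g a‖ := by
        refine (norm_add_le _ _).trans ?_
        rw [norm_mul, norm_mul]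
      _ ≤ C * ‖u z - g a‖ + δ / (M + 1) * M := by
        gcongr
        · exact hC z hzb
        · exact hM a hmem
      _ ≤ C * ‖u z - g a‖ + δ := by
        gcongr
        rw [div_mul_eq_mul_div, div_le_iff₀ (by positivity)]
        have : (0 : ℝ) ≤ δ := δ.2
        nlinarith
  have := ENNReal.ofReal_le_ofReal key
  rw [ofReal_norm, ENNReal.ofReal_add (by positivity) (by positivity), ENNReal.ofReal_mul hC0,
    ofReal_norm] at this
  convert this using 2
  · congr 1
    rw [ENNReal.ofReal]
    congr 1
    rw [Real.toNNReal_of_nonneg hC0]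
    rfl
  · simp

/-! ### Radial cut-off functions -/

/-- The function is constant on each open half-line; the endpoints follow because the zero set of
the continuous derivative is closed. -/
theorem deriv_smoothTransition_eq_zero {x : ℝ} (h : x ≤ 0 ∨ 1 ≤ x) :
    deriv Real.smoothTransition x = 0 := by
  have hc : Continuous (deriv Real.smoothTransition) :=
    (Real.smoothTransition.contDiff (n := 1)).continuous_deriv le_rfl
  have hcl : IsClosed {x | deriv Real.smoothTransition x = 0} := isClosed_eq hc continuous_const
  rcases h with h | h
  · have h1 : Iio (0 : ℝ) ⊆ {x | deriv Real.smoothTransition x = 0} := fun y hy => by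
      have : Real.smoothTransition =ᶠ[𝓝 y] fun _ => 0 := by
        filter_upwards [Iio_mem_nhds hy] with t ht
        exact Real.smoothTransition.zero_of_nonpos (le_of_lt ht)
      change deriv _ y = 0
      rw [this.deriv_eq, deriv_const]
    have h2 := closure_minimal h1 hcl
    rw [closure_Iio] at h2
    exact h2 h
  · have h1 : Ioi (1 : ℝ) ⊆ {x | deriv Real.smoothTransition x = 0} := fun y hy => by
      have : Real.smoothTransition =ᶠ[𝓝 y] fun _ => 1 := by
        filter_upwards [Ioi_mem_nhds hy] with t ht
        exact Real.smoothTransition.one_of_one_le (le_of_lt ht)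
      change deriv _ y = 0
      rw [this.deriv_eq, deriv_const]
    have h2 := closure_minimal h1 hcl
    rw [closure_Ioi] at h2
    exact h2 h

theorem exists_bound_deriv_smoothTransition :
    ∃ M : ℝ, 0 ≤ M ∧ ∀ x, |deriv Real.smoothTransition x| ≤ M := by
  have hc : Continuous (deriv Real.smoothTransition) :=
    (Real.smoothTransition.contDiff (n := 1)).continuous_deriv le_rfl
  obtain ⟨M, hM⟩ := (isCompact_Icc (a := (0 : ℝ)) (b := 1)).exists_bound_of_continuousOn
    hc.continuousOn
  have hM0 : 0 ≤ M := (norm_nonneg _).trans (hM 0 (by simp))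
  refine ⟨M, hM0, fun x => ?_⟩
  by_cases hx : x ∈ Icc (0 : ℝ) 1
  · exact hM x hx
  · rw [deriv_smoothTransition_eq_zero, abs_zero]
    · exact hM0
    · by_contra! h
      exact hx ⟨h.1.le, h.2.le⟩

/-- A smooth radial function, equal to `1` where `2 ε ≤ 1 - |z|²` and to `0` where
`1 - |z|² ≤ ε`. -/
noncomputable def cutoff (ε : ℝ) (z : ℂ) : ℝ := Real.smoothTransition ((1 - ‖z‖ ^ 2) / ε - 1)

/-- The radial density with `∂/∂z* (cutoff ε) = - cutoffDensity ε z * z`. -/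
noncomputable def cutoffDensity (ε : ℝ) (z : ℂ) : ℝ :=
  deriv Real.smoothTransition ((1 - ‖z‖ ^ 2) / ε - 1) / ε

theorem contDiff_cutoff (ε : ℝ) : ContDiff ℝ ∞ (cutoff ε) :=
  Real.smoothTransition.contDiff.comp
    (((contDiff_const.sub (contDiff_norm_sq ℝ)).div_const ε).sub contDiff_const)

theorem continuous_cutoffDensity (ε : ℝ) : Continuous (cutoffDensity ε) := by
  have hc : Continuous (deriv Real.smoothTransition) :=
    (Real.smoothTransition.contDiff (n := 1)).continuous_deriv le_rfl
  unfold cutoffDensity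
  exact (hc.comp (by fun_prop)).div_const _

theorem support_cutoff_subset {ε : ℝ} (h0 : 0 < ε) :
    Function.support (cutoff ε) ⊆ {z : ℂ | ‖z‖ ^ 2 ≤ 1 - ε} := by
  intro z hz
  by_contra h
  apply hz
  simp only [mem_ofPred_eq, not_le] at h
  apply Real.smoothTransition.zero_of_nonpos
  rw [sub_nonpos, div_le_one h0]
  linarith

theorem isCompact_sq_norm_le (ε : ℝ) : IsCompact {z : ℂ | ‖z‖ ^ 2 ≤ 1 - ε} := by
  refine Metric.isCompact_of_isClosed_isBounded
    (isClosed_le (by fun_prop) continuous_const) ?_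
  refine (Metric.isBounded_closedBall (x := (0 : ℂ)) (r := 1 + |1 - ε|)).subset fun z hz => ?_
  simp only [mem_ofPred_eq] at hz
  simp only [Metric.mem_closedBall, dist_zero_right]
  nlinarith [le_abs_self (1 - ε), abs_nonneg (1 - ε), norm_nonneg z]

theorem sq_norm_le_subset_disk {ε : ℝ} (h0 : 0 < ε) : {z : ℂ | ‖z‖ ^ 2 ≤ 1 - ε} ⊆ disk := by
  intro z hz
  simp only [mem_ofPred_eq] at hz
  simp only [Metric.mem_ball, dist_zero_right]
  nlinarith [norm_nonneg z]

/-- Chain rule with `∂|z|²/∂z* = z`. -/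
theorem dbar_cutoff (ε : ℝ) (z : ℂ) :
    dbar (fun ζ => (cutoff ε ζ : ℂ)) z = -(cutoffDensity ε z * z) := by
  have h1 : HasFDerivAt (fun z : ℂ => ‖z‖ ^ 2) (2 • (innerSL ℝ z)) z :=
    (hasStrictFDerivAt_norm_sq z).hasFDerivAt
  have h2 := ((h1.const_sub 1).mul_const ε⁻¹).sub_const 1
  have h3 : HasDerivAt Real.smoothTransition
      (deriv Real.smoothTransition ((1 - ‖z‖ ^ 2) * ε⁻¹ - 1)) ((1 - ‖z‖ ^ 2) * ε⁻¹ - 1) :=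
    ((Real.smoothTransition.contDiff (n := 1)).differentiable one_ne_zero _).hasDerivAt
  have h4 := h3.comp_hasFDerivAt z h2
  rw [dbar_ofReal _ ((contDiff_cutoff ε).differentiable (by simp) z)]
  have h5 : fderiv ℝ (cutoff ε) z = _ := h4.fderiv
  rw [h5]
  simp only [cutoffDensity, div_eq_mul_inv]
  simp
  have := Complex.re_add_im z
  linear_combination (-((deriv Real.smoothTransition ((1 - ‖z‖ ^ 2) * ε⁻¹ - 1) : ℝ) : ℂ) * (ε : ℂ)⁻¹) * this

/-- The derivative lives where `ε < 1 - |z|² < 2ε`, and `1 - |z| ≤ 1 - |z|²` in the disk; the factor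
`3` leaves room. -/
theorem cutoffDensity_eq_zero {ε : ℝ} (h0 : 0 < ε) (h1 : ε < 1 / 3) {z : ℂ}
    (hz : z ∉ annulus (3 * ε)) : cutoffDensity ε z = 0 := by
  unfold cutoffDensity
  rw [deriv_smoothTransition_eq_zero, zero_div]
  by_contra! h
  apply hz
  rw [sub_pos, lt_div_iff₀ h0, sub_lt_iff_lt_add, div_lt_iff₀ h0] at h
  have := norm_nonneg z
  constructor
  · nlinarith
  · nlinarith

/-- Polar coordinates for the product of the radial density with a function of the angle. -/
theorem integral_cutoffDensity_mul {ε : ℝ} (h0 : 0 < ε) (h1 : ε ≤ 1 / 2) (G : ℂ → ℂ) :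
    ∫ z, (cutoffDensity ε z : ℂ) * G (z / (‖z‖ : ℂ))
      = (1 / 2) * ∫ θ in (0)..(2 * Real.pi), G (circleMap 0 1 θ) := by
  rw [← Complex.integral_comp_polarCoord_symm]
  have e1 : ∫ p in polarCoord.target, p.1 • ((cutoffDensity ε (Complex.polarCoord.symm p) : ℂ)
      * G (Complex.polarCoord.symm p / (‖Complex.polarCoord.symm p‖ : ℂ)))
      = ∫ p in Ioi (0 : ℝ) ×ˢ Ioo (-Real.pi) Real.pi,
        ((p.1 * (deriv Real.smoothTransition ((1 - p.1 ^ 2) / ε - 1) / ε) : ℝ) : ℂ)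
          * G (circleMap 0 1 p.2) := by
    refine setIntegral_congr_fun (measurableSet_Ioi.prod measurableSet_Ioo) fun p hp => ?_
    have hp1 : 0 < p.1 := hp.1
    have hp1' : (p.1 : ℂ) ≠ 0 := by exact_mod_cast hp1.ne'
    have hn : ‖Complex.polarCoord.symm p‖ = p.1 := by
      rw [Complex.norm_polarCoord_symm, abs_of_pos hp1]
    simp only [hn, cutoffDensity, Complex.real_smul]
    rw [Complex.polarCoord_symm_apply, mul_div_cancel_left₀ _ hp1']
    rw [circleMap, Complex.exp_mul_I]
    push_cast
    simp only [zero_add, one_mul]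
    ring
  rw [e1]
  have e2 := setIntegral_prod_mul (μ := volume) (ν := volume) (L := ℂ)
    (fun r : ℝ => ((r * (deriv Real.smoothTransition ((1 - r ^ 2) / ε - 1) / ε) : ℝ) : ℂ))
    (fun θ : ℝ => G (circleMap 0 1 θ)) (Ioi 0) (Ioo (-Real.pi) Real.pi)
  rw [Measure.volume_eq_prod, e2]
  congr 1
  · rw [integral_complex_ofReal]
    have hz : ∀ r ∈ Ioi (0 : ℝ) \ Ioc 0 1,
        r * (deriv Real.smoothTransition ((1 - r ^ 2) / ε - 1) / ε) = 0 := by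
      intro r hr
      have hr0 : 0 < r := hr.1
      have hr1 : 1 < r := by
        by_contra! h
        exact hr.2 ⟨hr0, h⟩
      rw [deriv_smoothTransition_eq_zero]
      · simp
      · left
        have : (1 - r ^ 2) / ε ≤ 0 := div_nonpos_of_nonpos_of_nonneg (by nlinarith) h0.le
        linarith
    rw [setIntegral_eq_of_subset_of_forall_sdiff_eq_zero measurableSet_Ioi
      (fun r hr => hr.1) hz, ← intervalIntegral.integral_of_le zero_le_one]
    have hc : Continuous (deriv Real.smoothTransition) :=
      (Real.smoothTransition.contDiff (n := 1)).continuous_deriv le_rfl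
    -- In polar coordinates the radial factor is an exact derivative, so its mass is `1/2` for each
    -- admissible `ε`, not only in the limit. The bound `ε ≤ 1/2` makes the transition equal to `1`
    -- at `r = 0`.
    have hd : ∀ r ∈ uIcc (0 : ℝ) 1, HasDerivAt
        (fun r => -(1 / 2) * Real.smoothTransition ((1 - r ^ 2) / ε - 1))
        (r * (deriv Real.smoothTransition ((1 - r ^ 2) / ε - 1) / ε)) r := by
      intro r _
      have a1 : HasDerivAt (fun r : ℝ => (1 - r ^ 2) / ε - 1) (-(2 * r) / ε) r := by
        have := (((hasDerivAt_pow 2 r).const_sub 1).div_const ε).sub_const 1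
        simpa using this
      have a2 := ((Real.smoothTransition.contDiff (n := 1)).differentiable one_ne_zero
        ((1 - r ^ 2) / ε - 1)).hasDerivAt
      have := (a2.comp r a1).const_mul (-(1 / 2))
      refine this.congr_deriv ?_
      ring
    rw [intervalIntegral.integral_eq_sub_of_hasDerivAt hd
      (Continuous.intervalIntegrable
        (continuous_id.mul ((hc.comp (by fun_prop)).div_const _)) _ _)]
    rw [Real.smoothTransition.zero_of_nonpos (by norm_num),
      Real.smoothTransition.one_of_one_le]
    · norm_num
    · have : 2 ≤ 1 / ε := by rw [le_div_iff₀ h0]; linarith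
      simp only [ne_eq, OfNat.ofNat_ne_zero, not_false_eq_true, zero_pow, sub_zero]
      linarith
  · rw [← integral_Ioc_eq_integral_Ioo, ← intervalIntegral.integral_of_le (by linarith [Real.pi_pos])]
    have hper : Function.Periodic (fun θ : ℝ => G (circleMap 0 1 θ)) (2 * Real.pi) := fun θ => by
      simp only [periodic_circleMap 0 1 θ]
    have := hper.intervalIntegral_add_eq (-Real.pi) 0
    rw [zero_add] at this
    rw [← this]
    congr 1
    ring

/-- Radial projection is continuous off the origin, which is a null set; nothing is known about `g`
away from the circle. -/
theorem aestronglyMeasurable_comp_div_norm {g : ℂ → ℂ} (hg : ContinuousOn g circle) :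
    AEStronglyMeasurable (fun z : ℂ => g (z / (‖z‖ : ℂ))) (volume.restrict disk) := by
  have h1 : ContinuousOn (fun z : ℂ => g (z / (‖z‖ : ℂ))) {0}ᶜ := by
    refine hg.comp (ContinuousOn.div continuousOn_id (by fun_prop) ?_) ?_
    · intro z hz; simpa using hz
    · intro z hz
      have : ‖z‖ ≠ 0 := by simpa using hz
      simp [this]
  have h2 := h1.aestronglyMeasurable (μ := volume) (measurableSet_singleton (0 : ℂ)).compl
  have h3 : (volume : Measure ℂ).restrict {0}ᶜ = volume :=
    Measure.restrict_eq_self_of_ae_mem (by simp [ae_iff])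
  rw [h3] at h2
  exact h2.restrict

/-- The radial densities concentrate on the boundary values. -/
theorem HasBoundaryValue.tendsto_integral_cutoffDensity {W G : ℂ → ℂ} (h : HasBoundaryValue W G)
    (hW : IntegrableOn W disk) (hG : ContinuousOn G circle) :
    Tendsto (fun ε : ℝ => ∫ z in disk, (cutoffDensity ε z : ℂ) * W z) (𝓝[>] 0)
      (𝓝 ((1 / 2) * ∫ θ in (0)..(2 * Real.pi), G (circleMap 0 1 θ))) := by
  obtain ⟨M, hM0, hM⟩ := exists_bound_deriv_smoothTransition
  obtain ⟨B, hB⟩ := (isCompact_sphere (0 : ℂ) 1).exists_bound_of_continuousOn hG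
  have hsmall : ∀ᶠ ε : ℝ in 𝓝[>] 0, 0 < ε ∧ ε < 1 / 3 := by
    filter_upwards [self_mem_nhdsWithin,
      nhdsWithin_le_nhds (Iio_mem_nhds (show (0 : ℝ) < 1 / 3 by norm_num))] with ε h1 h2
    exact ⟨h1, h2⟩
  have hbound : ∀ ε : ℝ, 0 < ε → ∀ z, ‖(cutoffDensity ε z : ℂ)‖ ≤ M / ε := by
    intro ε h0 z
    rw [Complex.norm_real, cutoffDensity, norm_div, Real.norm_eq_abs, Real.norm_eq_abs,
      abs_of_pos h0]
    gcongr
    exact hM _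
  have hcont : ∀ ε, Continuous fun z => (cutoffDensity ε z : ℂ) := fun ε =>
    Complex.continuous_ofReal.comp (continuous_cutoffDensity ε)
  have iW : ∀ ε : ℝ, 0 < ε → IntegrableOn (fun z => (cutoffDensity ε z : ℂ) * W z) disk :=
    fun ε h0 => hW.bdd_mul (c := M / ε) (hcont ε).aestronglyMeasurable.restrict
      (Eventually.of_forall (hbound ε h0))
  -- At `z = 0` the quotient is `0` by convention, so the bound has to include `‖G 0‖`.
  have iG0 : IntegrableOn (fun z : ℂ => G (z / (‖z‖ : ℂ))) disk := by
    refine IntegrableOn.of_bound measure_ball_lt_top (aestronglyMeasurable_comp_div_norm hG)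
      (max B ‖G 0‖) (Eventually.of_forall fun z => ?_)
    by_cases hz : ‖z‖ = 0
    · simp [hz]
    · exact (hB _ (by simp [hz])).trans (le_max_left _ _)
  have iG : ∀ ε : ℝ, 0 < ε →
      IntegrableOn (fun z => (cutoffDensity ε z : ℂ) * G (z / (‖z‖ : ℂ))) disk :=
    fun ε h0 => iG0.bdd_mul (c := M / ε) (hcont ε).aestronglyMeasurable.restrict
      (Eventually.of_forall (hbound ε h0))
  have hconst : ∀ᶠ ε : ℝ in 𝓝[>] 0, ∫ z in disk, (cutoffDensity ε z : ℂ) * G (z / (‖z‖ : ℂ))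
      = (1 / 2) * ∫ θ in (0)..(2 * Real.pi), G (circleMap 0 1 θ) := by
    filter_upwards [hsmall] with ε hε
    rw [← integral_cutoffDensity_mul hε.1 (by linarith [hε.2])]
    refine setIntegral_eq_integral_of_forall_compl_eq_zero fun z hz => ?_
    rw [cutoffDensity_eq_zero hε.1 hε.2 fun h => hz (annulus_subset_disk _ h)]
    simp
  -- The density is at most `M / ε` and vanishes off the annulus of width `3ε`, so the difference is
  -- at most `3M` times the mean deviation at width `3ε`.
  have hdiff : Tendsto (fun ε : ℝ => (∫ z in disk, (cutoffDensity ε z : ℂ) * W z)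
      - ∫ z in disk, (cutoffDensity ε z : ℂ) * G (z / (‖z‖ : ℂ))) (𝓝[>] 0) (𝓝 0) := by
    rw [tendsto_zero_iff_enorm_tendsto_zero]
    have h3 : Tendsto (fun ε : ℝ => 3 * ε) (𝓝[>] 0) (𝓝[>] 0) := by
      refine tendsto_nhdsWithin_iff.2 ⟨?_, ?_⟩
      · have : Tendsto (fun ε : ℝ => 3 * ε) (𝓝 0) (𝓝 (3 * 0)) := by
          exact (continuous_const.mul continuous_id).tendsto 0
        rw [mul_zero] at this
        exact this.mono_left nhdsWithin_le_nhds
      · filter_upwards [self_mem_nhdsWithin] with ε hε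
        have : (0 : ℝ) < ε := hε
        change (0 : ℝ) < 3 * ε
        linarith
    have h4 := ENNReal.Tendsto.const_mul (a := ENNReal.ofReal (3 * M)) (h.comp h3)
      (Or.inr ENNReal.ofReal_ne_top)
    rw [mul_zero] at h4
    refine tendsto_of_tendsto_of_tendsto_of_le_of_le' tendsto_const_nhds h4
      (Eventually.of_forall fun _ => zero_le) ?_
    filter_upwards [hsmall] with ε hε
    have h0 := hε.1
    rw [← integral_sub (iW ε h0) (iG ε h0)]
    refine (enorm_integral_le_lintegral_enorm _).trans ?_
    have hle : ∀ z, ‖(cutoffDensity ε z : ℂ) * W z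
        - (cutoffDensity ε z : ℂ) * G (z / (‖z‖ : ℂ))‖ₑ
        ≤ (annulus (3 * ε)).indicator
          (fun z => ENNReal.ofReal (M / ε) * ‖W z - G (z / (‖z‖ : ℂ))‖ₑ) z := by
      intro z
      rw [← mul_sub, enorm_mul]
      by_cases hz : z ∈ annulus (3 * ε)
      · rw [indicator_of_mem hz]
        gcongr
        rw [← ofReal_norm]
        exact ENNReal.ofReal_le_ofReal (hbound ε h0 z)
      · rw [cutoffDensity_eq_zero hε.1 hε.2 hz]
        simp
    refine (lintegral_mono hle).trans ?_
    rw [lintegral_indicator (measurableSet_annulus _), Measure.restrict_restrict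
      (measurableSet_annulus _), inter_eq_left.2 (annulus_subset_disk _),
      lintegral_const_mul' _ _ ENNReal.ofReal_ne_top]
    simp only [Function.comp]
    rw [← mul_assoc, ← ENNReal.ofReal_mul (by positivity)]
    have : 3 * M * (3 * ε)⁻¹ = M / ε := by field_simp
    rw [this]
    rfl
  have := hdiff.add (tendsto_const_nhds (x := (1 / 2) * ∫ θ in (0)..(2 * Real.pi),
    G (circleMap 0 1 θ)))
  rw [zero_add] at this
  refine this.congr' ?_
  filter_upwards [hconst] with ε hε
  rw [hε]
  ring

/-! ### Green's formula -/

/-- Green's formula for weak solutions with boundary values in the mean. -/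
theorem IsWeakDbar.green {u v g Φ Ψ : ℂ → ℂ} (h : IsWeakDbar (fun c => Complex.I * c) u v)
    (hv : IntegrableOn v disk) (hb : HasBoundaryValue u g) (hg : ContinuousOn g circle)
    (hΦ : ContDiffOn ℝ ∞ Φ disk) (hΦc : ContinuousOn Φ (Metric.closedBall 0 1))
    (hΨc : ContinuousOn Ψ (Metric.closedBall 0 1)) (hΨ : ∀ z ∈ disk, dbar Φ z = Ψ z) :
    ∫ z in disk, Ψ z * u z
      = 1 / (2 * Complex.I) * (∮ ζ in C(0, 1), Φ ζ * g ζ) - ∫ z in disk, Φ z * v z := by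
  have hu : IntegrableOn u disk := hb.integrableOn h.1 hg
  have iΨ : IntegrableOn (fun z => Ψ z * u z) disk := integrableOn_mul_of_continuousOn hu hΨc
  have iΦ : IntegrableOn (fun z => Φ z * v z) disk := integrableOn_mul_of_continuousOn hv hΦc
  -- The factor `z` comes from the derivative of the cut-off; on the circle it is the `ζ` in `dζ =
  -- iζ dθ`.
  have hzΦ : ContinuousOn (fun z => z * Φ z) (Metric.closedBall 0 1) := continuousOn_id.mul hΦc
  have izΦ : IntegrableOn (fun z => (z * Φ z) * u z) disk :=
    integrableOn_mul_of_continuousOn hu hzΦ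
  have hlim := (hb.mul_left hg hzΦ).tendsto_integral_cutoffDensity izΦ
    ((hzΦ.mono Metric.sphere_subset_closedBall).mul hg)
  have hcut1 : ∀ ε z, ‖(cutoff ε z : ℂ)‖ ≤ 1 := fun ε z => by
    rw [Complex.norm_real, Real.norm_eq_abs, cutoff, abs_of_nonneg (Real.smoothTransition.nonneg _)]
    exact Real.smoothTransition.le_one _
  have hcc : ∀ ε, Continuous fun z => (cutoff ε z : ℂ) := fun ε =>
    Complex.continuous_ofReal.comp (contDiff_cutoff ε).continuous
  have hdom : ∀ F : ℂ → ℂ, IntegrableOn F disk →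
      Tendsto (fun ε : ℝ => ∫ z in disk, (cutoff ε z : ℂ) * F z) (𝓝[>] 0)
        (𝓝 (∫ z in disk, F z)) := by
    intro F hF
    refine tendsto_integral_filter_of_dominated_convergence (fun z => ‖F z‖) ?_ ?_ hF.norm ?_
    · exact Eventually.of_forall fun ε =>
        (hcc ε).aestronglyMeasurable.restrict.mul hF.aestronglyMeasurable
    · refine Eventually.of_forall fun ε => Eventually.of_forall fun z => ?_
      rw [norm_mul]
      exact mul_le_of_le_one_left (norm_nonneg _) (hcut1 ε z)
    · filter_upwards [ae_restrict_mem measurableSet_ball] with z hz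
      have hz' : ‖z‖ < 1 := by simpa using hz
      refine tendsto_const_nhds.congr' ?_
      have hpos : 0 < (1 - ‖z‖ ^ 2) / 2 := by nlinarith [norm_nonneg z]
      filter_upwards [self_mem_nhdsWithin, nhdsWithin_le_nhds (Iio_mem_nhds hpos)] with ε h1 h2
      have h1 : 0 < ε := h1
      have h2 : ε < (1 - ‖z‖ ^ 2) / 2 := h2
      have : cutoff ε z = 1 := by
        apply Real.smoothTransition.one_of_one_le
        have : 2 ≤ (1 - ‖z‖ ^ 2) / ε := by rw [le_div_iff₀ h1]; linarith
        linarith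
      simp [this]
  have hid : ∀ᶠ ε : ℝ in 𝓝[>] 0, (∫ z in disk, (cutoff ε z : ℂ) * (Ψ z * u z))
      - (∫ z in disk, (cutoffDensity ε z : ℂ) * ((z * Φ z) * u z))
      = -∫ z in disk, (cutoff ε z : ℂ) * (Φ z * v z) := by
    filter_upwards [self_mem_nhdsWithin] with ε h0
    have h0 : 0 < ε := h0
    have hsupp : tsupport (fun z => (cutoff ε z : ℂ) * Φ z) ⊆ {z : ℂ | ‖z‖ ^ 2 ≤ 1 - ε} := by
      refine closure_minimal (fun z hz => support_cutoff_subset h0 fun h => hz ?_)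
        (isCompact_sq_norm_le ε).isClosed
      simp [h]
    -- Smoothness of `Φ` is available inside the disk only; elsewhere the product vanishes near each
    -- point.
    have hsm : ContDiff ℝ ∞ (fun z => (cutoff ε z : ℂ) * Φ z) := by
      refine contDiff_iff_contDiffAt.2 fun z => ?_
      by_cases hz : z ∈ disk
      · exact (Complex.ofRealCLM.contDiff.comp (contDiff_cutoff ε)).contDiffAt.mul
          (hΦ.contDiffAt (Metric.isOpen_ball.mem_nhds hz))
      · have : z ∉ tsupport (fun z => (cutoff ε z : ℂ) * Φ z) := fun h =>
          hz (sq_norm_le_subset_disk h0 (hsupp h))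
        have h2 := notMem_tsupport_iff_eventuallyEq.1 this
        exact contDiffAt_const.congr_of_eventuallyEq h2
    have key := h.integral_dbar_mul hsm
      ((isCompact_sq_norm_le ε).of_isClosed_subset (isClosed_tsupport _) hsupp)
      (hsupp.trans (sq_norm_le_subset_disk h0))
    obtain ⟨M, hM0, hM⟩ := exists_bound_deriv_smoothTransition
    have i1 : IntegrableOn (fun z => (cutoff ε z : ℂ) * (Ψ z * u z)) disk :=
      iΨ.bdd_mul (c := 1) (hcc ε).aestronglyMeasurable.restrict
        (Eventually.of_forall (hcut1 ε))
    have i2 : IntegrableOn (fun z => (cutoffDensity ε z : ℂ) * ((z * Φ z) * u z)) disk := by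
      refine integrableOn_mul_of_continuousOn izΦ ?_
      exact (Complex.continuous_ofReal.comp (continuous_cutoffDensity ε)).continuousOn
    rw [← integral_sub i1 i2]
    have e1 : ∫ z in disk, ((cutoff ε z : ℂ) * (Ψ z * u z)
        - (cutoffDensity ε z : ℂ) * ((z * Φ z) * u z))
        = ∫ z in disk, dbar (fun z => (cutoff ε z : ℂ) * Φ z) z * u z := by
      refine setIntegral_congr_fun measurableSet_ball fun z hz => ?_
      have hd : DifferentiableAt ℝ Φ z :=
        (hΦ.contDiffAt (Metric.isOpen_ball.mem_nhds hz)).differentiableAt (by simp)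
      have hd2 : DifferentiableAt ℝ (fun z => (cutoff ε z : ℂ)) z :=
        ((Complex.ofRealCLM.contDiff.comp (contDiff_cutoff ε)).contDiffAt.differentiableAt
          (by simp))
      rw [dbar_mul hd2 hd, dbar_cutoff, hΨ z hz]
      ring
    rw [e1, key]
    congr 2
    ext z
    ring
  have hL := ((hdom _ iΨ).sub hlim).congr' hid
  have hlast := tendsto_nhds_unique hL (hdom _ iΦ).neg
  have hcirc : (∮ ζ in C(0, 1), Φ ζ * g ζ)
      = Complex.I * ∫ θ in (0)..(2 * Real.pi), (circleMap 0 1 θ * Φ (circleMap 0 1 θ))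
        * g (circleMap 0 1 θ) := by
    rw [circleIntegral, ← intervalIntegral.integral_const_mul]
    congr 1
    ext θ
    rw [deriv_circleMap, smul_eq_mul]
    ring
  rw [hcirc]
  have h2I : 1 / (2 * Complex.I) * (Complex.I * ∫ θ in (0)..(2 * Real.pi),
      (circleMap 0 1 θ * Φ (circleMap 0 1 θ)) * g (circleMap 0 1 θ))
      = (1 / 2) * ∫ θ in (0)..(2 * Real.pi), (circleMap 0 1 θ * Φ (circleMap 0 1 θ))
        * g (circleMap 0 1 θ) := by
    have := Complex.I_ne_zero
    field_simp
  rw [h2I]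
  linear_combination hlast

/-! ### The Cauchy kernel and its iterates -/

/-- The polar Jacobian `r` cancels the singularity. -/
theorem integrableOn_inv_norm (R : ℝ) : IntegrableOn (fun z : ℂ => ‖z‖⁻¹) (Metric.ball 0 R) := by
  rw [integrableOn_fun_norm_addHaar volume (f := fun y : ℝ => y⁻¹)]
  have : IntegrableOn (fun _ : ℝ => (1 : ℝ)) (Ioo 0 R) := by
    simp
  refine this.congr_fun (fun y hy => ?_) measurableSet_Ioo
  have : y ≠ 0 := hy.1.ne'
  simp [Complex.finrank_real_complex, this]

/-- The kernel `(z*)ᵏ / (k! z)`; up to the factor `π`, a fundamental solution of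
`(∂/∂z*)ᵏ⁺¹`. -/
noncomputable def cauchyKernel (k : ℕ) (z : ℂ) : ℂ := conj z ^ k / (k.factorial : ℂ) / z

theorem measurable_cauchyKernel (k : ℕ) : Measurable (cauchyKernel k) := by
  unfold cauchyKernel
  exact ((Complex.continuous_conj.measurable.pow_const k).div_const _).div measurable_id

theorem norm_cauchyKernel_le {k : ℕ} {R : ℝ} {z : ℂ} (hz : ‖z‖ ≤ R) :
    ‖cauchyKernel k z‖ ≤ R ^ k * ‖z‖⁻¹ := by
  have h1 : (1 : ℝ) ≤ k.factorial := by exact_mod_cast Nat.succ_le_of_lt k.factorial_pos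
  have hR : 0 ≤ R := (norm_nonneg z).trans hz
  simp only [cauchyKernel, norm_div, norm_pow, RCLike.norm_conj, Complex.norm_natCast]
  rw [div_eq_mul_inv]
  gcongr
  calc ‖z‖ ^ k / (k.factorial : ℝ) ≤ ‖z‖ ^ k := div_le_self (by positivity) h1
    _ ≤ R ^ k := by gcongr

theorem integrableOn_cauchyKernel (k : ℕ) (R : ℝ) :
    IntegrableOn (cauchyKernel k) (Metric.ball 0 R) := by
  refine ((integrableOn_inv_norm R).const_mul (R ^ k)).mono'
    (measurable_cauchyKernel k).aestronglyMeasurable ?_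
  filter_upwards [ae_restrict_mem measurableSet_ball] with z hz
  exact norm_cauchyKernel_le (mem_ball_zero_iff.1 hz).le

theorem locallyIntegrable_cauchyKernel (k : ℕ) : LocallyIntegrable (cauchyKernel k) := by
  rw [locallyIntegrable_iff]
  intro K hK
  obtain ⟨R, hR⟩ := hK.isBounded.subset_ball 0
  exact (integrableOn_cauchyKernel k R).mono_set hR

/-! ### The Cauchy–Pompeiu formula for test functions -/

/-- Integration by parts against the constant `1`. -/
theorem integral_fderiv_eq_zero {F : ℂ → ℂ} (hF : ContDiff ℝ ∞ F) (hc : HasCompactSupport F)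
    (v : ℂ) : ∫ z, fderiv ℝ F z v = 0 := by
  have h1 : Continuous fun z => fderiv ℝ F z v :=
    (hF.continuous_fderiv (by simp)).clm_apply continuous_const
  have h2 : HasCompactSupport fun z => fderiv ℝ F z v :=
    (hc.fderiv ℝ).mono fun z hz h0 => hz (by simp [h0])
  have := integral_mul_fderiv_eq_neg_fderiv_mul_of_integrable (μ := (volume : Measure ℂ))
    (f := fun _ : ℂ => (1 : ℂ)) (g := F) (v := v) (by simp)
    (by simpa using h1.integrable_of_hasCompactSupport h2)
    (by simpa using hF.continuous.integrable_of_hasCompactSupport hc)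
    (fun _ _ => differentiableAt_const _) (fun z _ => hF.differentiable (by simp) z)
  simpa using this

theorem integral_dbar_eq_zero {F : ℂ → ℂ} (hF : ContDiff ℝ ∞ F) (hc : HasCompactSupport F) :
    ∫ z, dbar F z = 0 := by
  have h1 : ∀ v, Integrable fun z => fderiv ℝ F z v := fun v =>
    ((hF.continuous_fderiv (by simp)).clm_apply continuous_const).integrable_of_hasCompactSupport
      ((hc.fderiv ℝ).mono fun z hz h0 => hz (by simp [h0]))
  unfold dbar
  rw [integral_const_mul, integral_add (h1 1) ((h1 Complex.I).const_mul _), integral_const_mul,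
    integral_fderiv_eq_zero hF hc, integral_fderiv_eq_zero hF hc]
  simp

theorem hasCompactSupport_dbar {F : ℂ → ℂ} (hc : HasCompactSupport F) :
    HasCompactSupport (dbar F) :=
  hc.of_isClosed_subset (isClosed_tsupport _)
    (closure_minimal (support_dbar_subset F) (isClosed_tsupport _))

/-- A smooth approximation of the Cauchy kernel `1 / z`. -/
noncomputable def smoothKernel (δ : ℝ) (z : ℂ) : ℂ := conj z * (((‖z‖ ^ 2 + δ ^ 2)⁻¹ : ℝ) : ℂ)

theorem contDiff_smoothKernel {δ : ℝ} (hδ : 0 < δ) : ContDiff ℝ ∞ (smoothKernel δ) := by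
  refine Complex.conjCLE.contDiff.mul (Complex.ofRealCLM.contDiff.comp ?_)
  exact ((contDiff_norm_sq ℝ).add contDiff_const).inv fun z => by positivity

/-- The result is an approximate identity of mass `π`: it equals `δ⁻² ρ(z/δ)` with `ρ(s) = (1 +
|s|²)⁻²`. -/
theorem dbar_smoothKernel {δ : ℝ} (hδ : 0 < δ) (z : ℂ) :
    dbar (smoothKernel δ) z = ((δ ^ 2 / (‖z‖ ^ 2 + δ ^ 2) ^ 2 : ℝ) : ℂ) := by
  have hpos : ‖z‖ ^ 2 + δ ^ 2 ≠ 0 := by positivity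
  have h1 : HasFDerivAt (fun z : ℂ => ‖z‖ ^ 2 + δ ^ 2) (2 • (innerSL ℝ z)) z :=
    (hasStrictFDerivAt_norm_sq z).hasFDerivAt.add_const _
  have h2 := (hasDerivAt_inv hpos).comp_hasFDerivAt z h1
  have h3 : DifferentiableAt ℝ (fun z : ℂ => (‖z‖ ^ 2 + δ ^ 2)⁻¹) z := h2.differentiableAt
  have h4 : fderiv ℝ (fun z : ℂ => (‖z‖ ^ 2 + δ ^ 2)⁻¹) z = _ := h2.fderiv
  have h5 : dbar (fun z : ℂ => conj z) z = 1 := by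
    have := dbar_conj_sub_pow 0 z 0
    simpa using this
  have h6 : DifferentiableAt ℝ (fun z : ℂ => conj z) z :=
    Complex.conjCLE.toContinuousLinearMap.differentiableAt
  have h7 : DifferentiableAt ℝ (fun z : ℂ => (((‖z‖ ^ 2 + δ ^ 2)⁻¹ : ℝ) : ℂ)) z :=
    Complex.ofRealCLM.differentiableAt.comp z h3
  unfold smoothKernel
  rw [dbar_mul h6 h7, h5, dbar_ofReal _ h3, h4]
  have h8 : ((‖z‖ : ℂ) ^ 2 + (δ : ℂ) ^ 2) ≠ 0 := by exact_mod_cast hpos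
  have h9 : conj z * z = (‖z‖ : ℂ) ^ 2 := Complex.conj_mul' z
  have h10 := Complex.re_add_im z
  simp
  field_simp
  linear_combination (-1 : ℂ) * h9 - (conj z) * h10

theorem norm_smoothKernel_le (δ : ℝ) (z : ℂ) : ‖smoothKernel δ z‖ ≤ ‖z‖⁻¹ := by
  rcases eq_or_ne z 0 with rfl | hz
  · simp [smoothKernel]
  have h : 0 < ‖z‖ := norm_pos_iff.2 hz
  have hp : 0 < ‖z‖ ^ 2 + δ ^ 2 := by positivity
  rw [smoothKernel, norm_mul, RCLike.norm_conj, Complex.norm_real, Real.norm_eq_abs,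
    abs_of_pos (by positivity), ← div_eq_mul_inv, div_le_iff₀ hp, inv_mul_eq_div, le_div_iff₀ h]
  nlinarith [sq_nonneg δ]

theorem hasDerivAt_neg_half_inv (y : ℝ) :
    HasDerivAt (fun y : ℝ => -(1 / 2) * (1 + y ^ 2)⁻¹) (y * ((1 + y ^ 2) ^ 2)⁻¹) y := by
  have hp : 1 + y ^ 2 ≠ 0 := by positivity
  have h := ((((hasDerivAt_pow 2 y).const_add 1).inv hp).const_mul (-(1 / 2)))
  refine h.congr_deriv ?_
  push_cast
  field_simp

theorem tendsto_neg_half_inv :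
    Tendsto (fun y : ℝ => -(1 / 2) * (1 + y ^ 2)⁻¹) atTop (𝓝 0) := by
  have h : Tendsto (fun y : ℝ => (1 + y ^ 2)⁻¹) atTop (𝓝 0) :=
    tendsto_inv_atTop_zero.comp
      (tendsto_atTop_add_const_left _ _ (tendsto_pow_atTop two_ne_zero))
  have h2 := h.const_mul (-(1 / 2))
  rwa [mul_zero] at h2

theorem integrable_inv_one_add_sq_norm :
    Integrable (fun s : ℂ => ((1 + ‖s‖ ^ 2) ^ 2)⁻¹) := by
  rw [integrable_fun_norm_addHaar volume (f := fun y : ℝ => ((1 + y ^ 2) ^ 2)⁻¹)]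
  simp only [Complex.finrank_real_complex, Nat.add_one_sub_one, pow_one, smul_eq_mul]
  exact integrableOn_Ioi_deriv_of_nonneg' (fun y _ => hasDerivAt_neg_half_inv y)
    (fun y hy => mul_nonneg (le_of_lt hy) (by positivity)) tendsto_neg_half_inv

theorem integral_inv_one_add_sq_norm :
    ∫ s : ℂ, ((1 + ‖s‖ ^ 2) ^ 2)⁻¹ = Real.pi := by
  rw [integral_fun_norm_addHaar volume (fun y : ℝ => ((1 + y ^ 2) ^ 2)⁻¹)]
  simp only [Complex.finrank_real_complex, Nat.add_one_sub_one, pow_one, smul_eq_mul]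
  rw [integral_Ioi_of_hasDerivAt_of_nonneg' (fun y _ => hasDerivAt_neg_half_inv y)
    (fun y hy => mul_nonneg (le_of_lt hy) (by positivity)) tendsto_neg_half_inv]
  rw [Measure.real, Complex.volume_ball]
  simp
  ring

/-- With `t⁻¹` regularized, integration by parts moves the derivative onto the kernel, where it
becomes the approximate identity. Both sides pass to the limit `δ → 0` by dominated convergence. -/
theorem integral_dbar_div_self {χ : ℂ → ℂ} (hχ : ContDiff ℝ ∞ χ) (hc : HasCompactSupport χ) :
    ∫ t, dbar χ t * t⁻¹ = -(Real.pi * χ 0) := by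
  obtain ⟨M, hM⟩ := hc.exists_bound_of_continuous hχ.continuous
  have hdc := continuous_dbar hχ
  have hparts : ∀ δ : ℝ, 0 < δ → ∫ t, dbar χ t * smoothKernel δ t
      = -∫ s : ℂ, χ (δ • s) * ((((1 + ‖s‖ ^ 2) ^ 2)⁻¹ : ℝ) : ℂ) := by
    intro δ hδ
    have hk := contDiff_smoothKernel hδ
    have h0 := integral_dbar_eq_zero (hχ.mul hk) (hc.mul_right)
    have e0 : ∀ z, dbar (fun t => χ t * smoothKernel δ t) z
        = dbar χ z * smoothKernel δ z + χ z * dbar (smoothKernel δ) z := fun z =>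
      dbar_mul (hχ.differentiable (by simp) z) (hk.differentiable (by simp) z)
    have i1 : Integrable fun t => dbar χ t * smoothKernel δ t :=
      (hdc.mul hk.continuous).integrable_of_hasCompactSupport
        (HasCompactSupport.mul_right (hasCompactSupport_dbar hc))
    have i2 : Integrable fun t => χ t * dbar (smoothKernel δ) t :=
      (hχ.continuous.mul (continuous_dbar hk)).integrable_of_hasCompactSupport hc.mul_right
    have h1 : ∫ z, (dbar χ z * smoothKernel δ z + χ z * dbar (smoothKernel δ) z) = 0 := by
      rw [← h0]
      exact integral_congr_ae (Eventually.of_forall fun z => (e0 z).symm)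
    rw [integral_add i1 i2] at h1
    rw [eq_neg_of_add_eq_zero_left h1]
    congr 1
    -- The substitution `t = δ s` removes `δ` from the kernel, leaving it only in the argument of
    -- `χ`.
    have h2 := Measure.integral_comp_smul (volume : Measure ℂ)
      (fun t => χ t * dbar (smoothKernel δ) t) δ
    rw [Complex.finrank_real_complex, abs_of_pos (by positivity), eq_comm,
      inv_smul_eq_iff₀ (by positivity)] at h2
    rw [h2, ← integral_smul]
    congr 1
    ext s
    rw [dbar_smoothKernel hδ, norm_smul, Real.norm_eq_abs, abs_of_pos hδ, Complex.real_smul]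
    have e3 : δ ^ 2 * (δ ^ 2 / ((δ * ‖s‖) ^ 2 + δ ^ 2) ^ 2) = ((1 + ‖s‖ ^ 2) ^ 2)⁻¹ := by
      have : (δ * ‖s‖) ^ 2 + δ ^ 2 = δ ^ 2 * (1 + ‖s‖ ^ 2) := by ring
      rw [this]
      field_simp
    rw [← e3]
    push_cast
    ring
  have l1 : Tendsto (fun δ : ℝ => ∫ t, dbar χ t * smoothKernel δ t) (𝓝[>] 0)
      (𝓝 (∫ t, dbar χ t * t⁻¹)) := by
    refine tendsto_integral_filter_of_dominated_convergence (fun t => ‖dbar χ t‖ * ‖t‖⁻¹)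
      ?_ ?_ ?_ ?_
    · filter_upwards [self_mem_nhdsWithin] with δ hδ
      exact (hdc.mul (contDiff_smoothKernel hδ).continuous).aestronglyMeasurable
    · refine Eventually.of_forall fun δ => Eventually.of_forall fun t => ?_
      rw [norm_mul]
      gcongr
      exact norm_smoothKernel_le δ t
    · have hcd : IsCompact (tsupport (dbar χ)) := hasCompactSupport_dbar hc
      obtain ⟨R, hR⟩ := hcd.isBounded.subset_ball 0
      have hi : IntegrableOn (fun t : ℂ => ‖dbar χ t‖ * ‖t‖⁻¹) (tsupport (dbar χ)) :=
        ((integrableOn_inv_norm R).mono_set hR).continuousOn_mul hdc.norm.continuousOn hcd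
      rwa [integrableOn_iff_integrable_of_support_subset] at hi
      intro t ht
      apply subset_closure
      intro h0
      apply ht
      simp [h0]
    · refine Eventually.of_forall fun t => ?_
      refine Tendsto.const_mul _ ?_
      -- The convention `0⁻¹ = 0` agrees with the value of the smooth kernels at `0`, so convergence
      -- holds at every point.
      rcases eq_or_ne t 0 with rfl | ht
      · simp [smoothKernel]
      have hcont : ContinuousAt (fun δ : ℝ => smoothKernel δ t) 0 := by
        unfold smoothKernel
        refine continuousAt_const.mul (Complex.continuous_ofReal.continuousAt.comp ?_)
        refine ContinuousAt.inv₀ (by fun_prop) ?_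
        have := norm_pos_iff.2 ht
        positivity
      have h0 : smoothKernel 0 t = t⁻¹ := by
        rw [smoothKernel, Complex.inv_def, Complex.normSq_eq_norm_sq]
        simp
      rw [← h0]
      exact hcont.tendsto.mono_left nhdsWithin_le_nhds
  have l2 : Tendsto (fun δ : ℝ => ∫ s : ℂ, χ (δ • s) * ((((1 + ‖s‖ ^ 2) ^ 2)⁻¹ : ℝ) : ℂ))
      (𝓝[>] 0) (𝓝 (∫ s : ℂ, χ 0 * ((((1 + ‖s‖ ^ 2) ^ 2)⁻¹ : ℝ) : ℂ))) := by
    refine tendsto_integral_filter_of_dominated_convergence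
      (fun s => M * ((1 + ‖s‖ ^ 2) ^ 2)⁻¹) ?_ ?_ (integrable_inv_one_add_sq_norm.const_mul M) ?_
    · refine Eventually.of_forall fun δ => Continuous.aestronglyMeasurable ?_
      refine (hχ.continuous.comp (by fun_prop)).mul (Complex.continuous_ofReal.comp ?_)
      exact Continuous.inv₀ (by fun_prop) fun s => by positivity
    · refine Eventually.of_forall fun δ => Eventually.of_forall fun s => ?_
      rw [norm_mul, Complex.norm_real, Real.norm_eq_abs, abs_of_nonneg (by positivity)]
      gcongr
      exact hM _
    · refine Eventually.of_forall fun s => Tendsto.mul_const _ ?_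
      have : ContinuousAt (fun δ : ℝ => χ (δ • s)) 0 :=
        (hχ.continuous.comp (by fun_prop)).continuousAt
      have := this.tendsto.mono_left (nhdsWithin_le_nhds (s := Ioi 0))
      simpa using this
  have l3 := l2.neg.congr' (f₂ := fun δ : ℝ => ∫ t, dbar χ t * smoothKernel δ t) (by
    filter_upwards [self_mem_nhdsWithin] with δ hδ
    exact (hparts δ hδ).symm)
  rw [tendsto_nhds_unique l1 l3, integral_const_mul, integral_complex_ofReal,
    integral_inv_one_add_sq_norm]
  ring

/-- The Cauchy–Pompeiu formula for test functions. -/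
theorem integral_dbar_div_sub {χ : ℂ → ℂ} (hχ : ContDiff ℝ ∞ χ) (hc : HasCompactSupport χ)
    (ζ : ℂ) : ∫ z, dbar χ z * (ζ - z)⁻¹ = Real.pi * χ ζ := by
  have h1 := integral_dbar_div_self (χ := fun t => χ (t + ζ))
    (hχ.comp (contDiff_id.add contDiff_const))
    (hc.comp_homeomorph (Homeomorph.addRight ζ))
  have h2 : ∀ t, dbar (fun t => χ (t + ζ)) t = dbar χ (t + ζ) := fun t => by
    simp only [dbar, fderiv_comp_add_right]
  simp only [h2, zero_add] at h1
  have h3 := integral_add_right_eq_self (μ := (volume : Measure ℂ))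
    (fun z => dbar χ z * (ζ - z)⁻¹) ζ
  rw [← h3]
  have h4 : ∀ t : ℂ, dbar χ (t + ζ) * (ζ - (t + ζ))⁻¹ = -(dbar χ (t + ζ) * t⁻¹) := fun t => by
    rw [sub_add_cancel_right, inv_neg, mul_neg]
  simp only [h4, integral_neg, h1, neg_neg]

/-! ### Iterated solutions of `∂Φ/∂z* = ψ` for test functions -/

/-- The potential `Φₖ` of a test function `ψ`, satisfying `∂Φ₀/∂z* = ψ`, `∂Φₖ₊₁/∂z* = Φₖ`. -/
noncomputable def potential (ψ : ℂ → ℂ) (k : ℕ) (ζ : ℂ) : ℂ :=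
  (1 / Real.pi) * ∫ z, ψ z * cauchyKernel k (ζ - z)

/-- As convolutions of a locally integrable kernel with a test function, potentials are smooth, and
derivatives may be put on the test function. -/
theorem potential_eq_convolution (ψ : ℂ → ℂ) (k : ℕ) :
    potential ψ k = fun ζ => (1 / Real.pi) *
      convolution (cauchyKernel k) ψ (ContinuousLinearMap.mul ℝ ℂ) volume ζ := by
  ext ζ
  rw [potential, convolution, ← integral_sub_left_eq_self _ _ ζ]
  simp only [ContinuousLinearMap.mul_apply', sub_sub_cancel]
  congr 2
  ext t
  ring

theorem contDiff_potential {ψ : ℂ → ℂ} (hψ : ContDiff ℝ ∞ ψ) (hc : HasCompactSupport ψ) (k : ℕ) :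
    ContDiff ℝ ∞ (potential ψ k) := by
  rw [potential_eq_convolution]
  exact contDiff_const.mul (hc.contDiff_convolution_right _ (locallyIntegrable_cauchyKernel k) hψ)

theorem dbar_potential_eq {ψ : ℂ → ℂ} (hψ : ContDiff ℝ ∞ ψ) (hc : HasCompactSupport ψ) (k : ℕ)
    (ζ : ℂ) : dbar (potential ψ k) ζ = potential (dbar ψ) k ζ := by
  have h1 := hc.hasFDerivAt_convolution_right (ContinuousLinearMap.mul ℝ ℂ)
    (locallyIntegrable_cauchyKernel k) (hψ.of_le (by simp)) ζ
  have h2 := h1.const_mul (1 / Real.pi : ℂ)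
  rw [potential_eq_convolution, dbar_eq_of_hasFDerivAt h2, potential_eq_convolution]
  have hcf : HasCompactSupport (fderiv ℝ ψ) := hc.fderiv ℝ
  have hcfc : Continuous (fderiv ℝ ψ) := hψ.continuous_fderiv (by simp)
  have h3 : ∀ v, (convolution (cauchyKernel k) (fderiv ℝ ψ)
      ((ContinuousLinearMap.mul ℝ ℂ).precompR ℂ) volume ζ) v
      = ∫ t, cauchyKernel k t * fderiv ℝ ψ (ζ - t) v := by
    intro v
    rw [convolution_precompR_apply _ (locallyIntegrable_cauchyKernel k) hcf hcfc]
    rfl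
  have hint : ∀ v, Integrable fun t => cauchyKernel k t * fderiv ℝ ψ (ζ - t) v := by
    intro v
    have hv : HasCompactSupport fun a => fderiv ℝ ψ a v :=
      hcf.mono fun z hz h0 => hz (by simp [h0])
    exact hv.convolutionExists_right (ContinuousLinearMap.mul ℝ ℂ)
      (locallyIntegrable_cauchyKernel k) (hcfc.clm_apply continuous_const) ζ
  simp only [smul_apply, smul_eq_mul, h3]
  have h4 : convolution (cauchyKernel k) (dbar ψ) (ContinuousLinearMap.mul ℝ ℂ) volume ζ
      = ∫ t, (1 / 2 : ℂ) * ((cauchyKernel k t * fderiv ℝ ψ (ζ - t) 1)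
        + Complex.I * (cauchyKernel k t * fderiv ℝ ψ (ζ - t) Complex.I)) := by
    rw [convolution]
    congr 1
    ext t
    simp only [ContinuousLinearMap.mul_apply', dbar]
    ring
  rw [h4, integral_const_mul, integral_add (hint 1) ((hint _).const_mul _), integral_const_mul]
  ring

theorem dbar_potential_zero {ψ : ℂ → ℂ} (hψ : ContDiff ℝ ∞ ψ) (hc : HasCompactSupport ψ)
    (ζ : ℂ) : dbar (potential ψ 0) ζ = ψ ζ := by
  rw [dbar_potential_eq hψ hc, potential]
  have : ∀ z, dbar ψ z * cauchyKernel 0 (ζ - z) = dbar ψ z * (ζ - z)⁻¹ := fun z => by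
    simp [cauchyKernel]
  simp only [this, integral_dbar_div_sub hψ hc]
  have : (Real.pi : ℂ) ≠ 0 := by exact_mod_cast Real.pi_ne_zero
  field_simp

theorem integrable_mul_cauchyKernel {ψ : ℂ → ℂ} (hψ : Continuous ψ) (hc : HasCompactSupport ψ)
    (k : ℕ) (ζ : ℂ) : Integrable fun z => ψ z * cauchyKernel k (ζ - z) := by
  have h : Integrable fun t => cauchyKernel k t * ψ (ζ - t) :=
    hc.convolutionExists_right (ContinuousLinearMap.mul ℝ ℂ)
      (locallyIntegrable_cauchyKernel k) hψ ζ
  have h2 := h.comp_sub_left ζ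
  simp only [sub_sub_cancel] at h2
  simpa [mul_comm] using h2

/-- The Cauchy–Pompeiu formula is applied to `ψ(z) [(z - ζ)*]ᵏ⁺¹ / (k+1)!`. This vanishes at `z =
ζ`, so the two integrals given by the product rule must agree. -/
theorem dbar_potential_succ {ψ : ℂ → ℂ} (hψ : ContDiff ℝ ∞ ψ) (hc : HasCompactSupport ψ)
    (k : ℕ) (ζ : ℂ) : dbar (potential ψ (k + 1)) ζ = potential ψ k ζ := by
  rw [dbar_potential_eq hψ hc, potential, potential]
  congr 1
  have hq := contDiff_conj_sub_pow ζ (k + 1)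
  have h1 := integral_dbar_div_sub (χ := fun z => ψ z *
    (conj (z - ζ) ^ (k + 1) / ((k + 1).factorial : ℂ))) (hψ.mul hq) hc.mul_right ζ
  have h2 : ∀ z, dbar (fun z => ψ z * (conj (z - ζ) ^ (k + 1) / ((k + 1).factorial : ℂ))) z
      * (ζ - z)⁻¹ = (-1) ^ (k + 1) * (dbar ψ z * cauchyKernel (k + 1) (ζ - z)
        - ψ z * cauchyKernel k (ζ - z)) := by
    intro z
    rw [dbar_mul (hψ.differentiable (by simp) z) (hq.differentiable (by simp) z),
      dbar_conj_sub_pow]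
    have e : ∀ m : ℕ, conj (z - ζ) ^ m = (-1) ^ m * conj (ζ - z) ^ m := fun m => by
      rw [← mul_pow, ← neg_sub ζ z, map_neg]
      ring
    rw [e, e, cauchyKernel, cauchyKernel, pow_succ (-1 : ℂ)]
    ring
  simp only [h2, integral_const_mul] at h1
  rw [integral_sub (integrable_mul_cauchyKernel (continuous_dbar hψ)
    (hasCompactSupport_dbar hc) _ _)
    (integrable_mul_cauchyKernel hψ.continuous hc _ _)] at h1
  simp only [sub_self, map_zero, ne_eq, Nat.succ_ne_zero, not_false_eq_true, zero_pow, zero_div,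
    mul_zero, mul_eq_zero, pow_eq_zero_iff, neg_eq_zero, one_ne_zero, false_or] at h1
  exact sub_eq_zero.1 h1

/-! ### Iterated weak derivatives -/

section Iterates

variable {E : Type*} [NormedAddCommGroup E]

variable [NormedSpace ℝ E] {J : E → E}

theorem IsWeakDbar.congr_ae {u u' v v' : ℂ → E} (h : IsWeakDbar J u v)
    (hu : u =ᵐ[volume.restrict disk] u') (hv : v =ᵐ[volume.restrict disk] v') :
    IsWeakDbar J u' v' := by
  refine ⟨LocallyIntegrableOn.congr hu h.1, LocallyIntegrableOn.congr hv h.2.1,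
    fun φ h1 h2 h3 => ?_⟩
  have e1 : ∫ z in disk, (1 / 2 : ℝ) • (fderiv ℝ φ z 1 • u' z + fderiv ℝ φ z Complex.I • J (u' z))
      = ∫ z in disk,
        (1 / 2 : ℝ) • (fderiv ℝ φ z 1 • u z + fderiv ℝ φ z Complex.I • J (u z)) := by
    refine integral_congr_ae ?_
    filter_upwards [hu] with z hz
    rw [hz]
  have e2 : ∫ z in disk, φ z • v' z = ∫ z in disk, φ z • v z := by
    refine integral_congr_ae ?_
    filter_upwards [hv] with z hz
    rw [hz]
  rw [e1, e2]
  exact h.2.2 φ h1 h2 h3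

theorem IsWeakDbarIter.congr_left {k : ℕ} {w w' v : ℂ → E} (h : IsWeakDbarIter J k w v)
    (hw : w =ᵐ[volume.restrict disk] w') : IsWeakDbarIter J k w' v := by
  induction k generalizing v with
  | zero => exact ⟨LocallyIntegrableOn.congr hw h.1, hw.symm.trans h.2⟩
  | succ k ih =>
    obtain ⟨u, h1, h2⟩ := h
    exact ⟨u, ih h1, h2⟩

theorem SolvesDirichlet.congr_ae {n : ℕ} {f : ℂ → E} {γ : ℕ → ℂ → E} {w w' : ℂ → E}
    (h : SolvesDirichlet J n f γ w) (hw : w =ᵐ[volume.restrict disk] w') :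
    SolvesDirichlet J n f γ w' := by
  refine ⟨h.1.congr_left hw, fun k hk => ?_⟩
  obtain ⟨v, h1, h2⟩ := h.2 k hk
  exact ⟨v, h1.congr_left hw, h2⟩

/-- The definition splits off the last derivative; induction on the order of the problem needs the
first one. -/
theorem isWeakDbarIter_succ_iff {k : ℕ} {w v : ℂ → E} :
    IsWeakDbarIter J (k + 1) w v ↔ ∃ u, IsWeakDbar J w u ∧ IsWeakDbarIter J k u v := by
  induction k generalizing v with
  | zero =>
    constructor
    · rintro ⟨u, ⟨-, h1⟩, h2⟩
      exact ⟨v, h2.congr_ae h1.symm (ae_eq_refl _), h2.2.1, ae_eq_refl _⟩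
    · rintro ⟨u, h1, -, h2⟩
      exact ⟨w, ⟨h1.1, ae_eq_refl _⟩, h1.congr_ae (ae_eq_refl _) h2⟩
  | succ k ih =>
    constructor
    · rintro ⟨u, h1, h2⟩
      obtain ⟨u', h3, h4⟩ := ih.1 h1
      exact ⟨u', h3, u, h4, h2⟩
    · rintro ⟨u', h3, u, h4, h2⟩
      exact ⟨u, ih.2 ⟨u', h3, h4⟩, h2⟩

/-- Both candidates have the same pairing with every test function. This identifies the iterates
that the equation and the boundary conditions introduce independently. -/
theorem IsWeakDbar.unique [CompleteSpace E] {w u v : ℂ → E} (hu : IsWeakDbar J w u)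
    (hv : IsWeakDbar J w v) : u =ᵐ[volume.restrict disk] v := by
  have h := Metric.isOpen_ball.ae_eq_zero_of_integral_contDiff_smul_eq_zero
    (U := disk) (μ := (volume : Measure ℂ)) (f := fun z => u z - v z) (hu.2.1.sub hv.2.1) ?_
  · rw [EventuallyEq, ae_restrict_iff' measurableSet_ball]
    filter_upwards [h] with z hz hzd
    exact sub_eq_zero.1 (hz hzd)
  · intro φ h1 h2 h3
    have i : ∀ {v : ℂ → E}, LocallyIntegrableOn v disk → IntegrableOn (fun z => φ z • v z) disk :=
      fun hv => integrable_smul_of_hasCompactSupport hv h1.continuous h2 subset_closure h3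
    rw [← setIntegral_eq_integral_of_forall_compl_eq_zero (s := disk)]
    · simp only [smul_sub]
      rw [integral_sub (i hu.2.1) (i hv.2.1)]
      have e1 := hu.2.2 φ h1 h2 h3
      have e2 := hv.2.2 φ h1 h2 h3
      rw [e1] at e2
      rw [neg_injective e2, sub_self]
    · intro z hz
      rw [image_eq_zero_of_notMem_tsupport fun h => hz (h3 h), zero_smul]

theorem solvesDirichlet_zero_iff {f w : ℂ → E} {γ : ℕ → ℂ → E} :
    SolvesDirichlet J 0 f γ w ↔ LocallyIntegrableOn w disk ∧ w =ᵐ[volume.restrict disk] f :=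
  ⟨fun h => h.1, fun h => ⟨h, fun k hk => absurd hk (Nat.not_lt_zero k)⟩⟩

/-- A problem of order `n + 1` is a problem of order one followed by a problem of order `n`. -/
theorem solvesDirichlet_succ_iff [CompleteSpace E] {n : ℕ} {f w : ℂ → E} {γ : ℕ → ℂ → E} :
    SolvesDirichlet J (n + 1) f γ w ↔ ∃ u, IsWeakDbar J w u ∧ HasBoundaryValue w (γ 0) ∧
      SolvesDirichlet J n f (fun k => γ (k + 1)) u := by
  constructor
  · rintro ⟨h1, h2⟩
    obtain ⟨u, hu1, hu2⟩ := isWeakDbarIter_succ_iff.1 h1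
    refine ⟨u, hu1, ?_, hu2, fun k hk => ?_⟩
    · obtain ⟨v, ⟨-, h3⟩, h4⟩ := h2 0 n.succ_pos
      exact h4.congr_ae h3.symm
    · obtain ⟨v, h3, h4⟩ := h2 (k + 1) (Nat.succ_lt_succ hk)
      obtain ⟨u', h5, h6⟩ := isWeakDbarIter_succ_iff.1 h3
      -- The first derivative hidden in the boundary condition is the one chosen from the equation,
      -- up to a null set.
      exact ⟨v, h6.congr_left (h5.unique hu1), h4⟩
  · rintro ⟨u, h1, h2, h3, h4⟩
    refine ⟨isWeakDbarIter_succ_iff.2 ⟨u, h1, h3⟩, fun k hk => ?_⟩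
    cases k with
    | zero => exact ⟨w, ⟨h1.1, ae_eq_refl _⟩, h2⟩
    | succ k =>
      obtain ⟨v, h5, h6⟩ := h4 k (Nat.lt_of_succ_lt_succ hk)
      exact ⟨v, isWeakDbarIter_succ_iff.2 ⟨u, h1, h5⟩, h6⟩

theorem SolvesDirichlet.integrableOn [CompleteSpace E] {n : ℕ} {f w : ℂ → E} {γ : ℕ → ℂ → E}
    (h : SolvesDirichlet J n f γ w) (hf : IntegrableOn f disk)
    (hγ : ∀ k < n, ContinuousOn (γ k) circle) : IntegrableOn w disk := by
  cases n with
  | zero => exact hf.congr (solvesDirichlet_zero_iff.1 h).2.symm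
  | succ n =>
    obtain ⟨u, h1, h2, -⟩ := solvesDirichlet_succ_iff.1 h
    exact h2.integrableOn h1.1 (hγ 0 n.succ_pos)

theorem SolvesDirichlet.exists_iterate [CompleteSpace E] {n : ℕ} {f w : ℂ → E} {γ : ℕ → ℂ → E}
    (h : SolvesDirichlet J n f γ w) {k : ℕ} (hk : k ≤ n) :
    ∃ u, SolvesDirichlet J (n - k) f (fun m => γ (k + m)) u := by
  induction k with
  | zero => exact ⟨w, by simpa using h⟩
  | succ k ih =>
    obtain ⟨u, hu⟩ := ih (by omega)
    obtain ⟨m, hm⟩ : ∃ m, n - k = m + 1 := ⟨n - k - 1, by omega⟩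
    rw [hm] at hu
    obtain ⟨u', -, -, h3⟩ := solvesDirichlet_succ_iff.1 hu
    refine ⟨u', ?_⟩
    have : n - (k + 1) = m := by omega
    rw [this]
    convert h3 using 3 with j
    omega

end Iterates

/-! ### Iterated Green formula -/

/-- A sequence of functions on the disk, each the `∂/∂z*`-derivative of the next one. -/
structure DbarChain (Φ : ℕ → ℂ → ℂ) : Prop where
  contDiffOn : ∀ k, ContDiffOn ℝ ∞ (Φ k) disk
  continuousOn : ∀ k, ContinuousOn (Φ k) (Metric.closedBall 0 1)
  dbar_succ : ∀ k, ∀ z ∈ disk, dbar (Φ (k + 1)) z = Φ k z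

theorem DbarChain.tail {Φ : ℕ → ℂ → ℂ} (h : DbarChain Φ) : DbarChain fun k => Φ (k + 1) :=
  ⟨fun _ => h.contDiffOn _, fun _ => h.continuousOn _, fun _ => h.dbar_succ _⟩

/-- Used to place a test function before its potentials, and `0` before the condition kernels. -/
theorem DbarChain.cons {Φ : ℕ → ℂ → ℂ} (h : DbarChain Φ) {ψ : ℂ → ℂ}
    (h1 : ContDiffOn ℝ ∞ ψ disk) (h2 : ContinuousOn ψ (Metric.closedBall 0 1))
    (h3 : ∀ z ∈ disk, dbar (Φ 0) z = ψ z) : DbarChain fun k => Nat.casesOn k ψ Φ := by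
  refine ⟨fun k => ?_, fun k => ?_, fun k => ?_⟩ <;> cases k
  · exact h1
  · exact h.contDiffOn _
  · exact h2
  · exact h.continuousOn _
  · exact h3
  · exact h.dbar_succ _

/-- Each use of Green's formula writes the current weight as the derivative of the next member of
the chain and moves that derivative onto the solution, leaving one boundary term and a change of
sign. -/
theorem SolvesComplex.iterated_green {n : ℕ} {f w : ℂ → ℂ} {γ : ℕ → ℂ → ℂ}
    (h : SolvesComplex n f γ w) (hf : IntegrableOn f disk)
    (hγ : ∀ k < n, ContinuousOn (γ k) circle) {Φ : ℕ → ℂ → ℂ} (hΦ : DbarChain Φ) :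
    ∫ z in disk, Φ 0 z * w z
      = ∑ m ∈ Finset.range n, (-1) ^ m / (2 * Complex.I) * (∮ ζ in C(0, 1), Φ (m + 1) ζ * γ m ζ)
        + (-1) ^ n * ∫ z in disk, Φ n z * f z := by
  induction n generalizing w γ Φ with
  | zero =>
    have h2 := (solvesDirichlet_zero_iff.1 h).2
    simp only [Finset.range_zero, Finset.sum_empty, zero_add, pow_zero, one_mul]
    refine integral_congr_ae ?_
    filter_upwards [h2] with z hz
    rw [hz]
  | succ n ih =>
    obtain ⟨u, h1, h2, h3⟩ := solvesDirichlet_succ_iff.1 h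
    have hγ' : ∀ k < n, ContinuousOn (γ (k + 1)) circle := fun k hk => hγ _ (by omega)
    have hu : IntegrableOn u disk := h3.integrableOn hf hγ'
    rw [h1.green hu h2 (hγ 0 n.succ_pos) (hΦ.contDiffOn 1) (hΦ.continuousOn 1)
      (hΦ.continuousOn 0) (hΦ.dbar_succ 0), ih h3 hγ' hΦ.tail, Finset.sum_range_succ']
    simp only [pow_succ, pow_zero, zero_add]
    have : ∑ k ∈ Finset.range n, (-1 : ℂ) ^ k * (-1) / (2 * Complex.I)
        * (∮ ζ in C(0, 1), Φ (k + 1 + 1) ζ * γ (k + 1) ζ)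
        = -∑ k ∈ Finset.range n, (-1 : ℂ) ^ k / (2 * Complex.I)
          * (∮ ζ in C(0, 1), Φ (k + 1 + 1) ζ * γ (k + 1) ζ) := by
      rw [← Finset.sum_neg_distrib]
      refine Finset.sum_congr rfl fun k _ => ?_
      ring
    rw [this]
    ring

/-! ### Integrals of Cauchy type -/

section CauchyType

variable {X : Type*} [MeasurableSpace X] {ν : Measure X} [SFinite ν] {p : X → ℂ} {g : X → ℂ}

/-- The map `p` lets one argument serve both the contour integrals and the area integrals.
Integrating in `z` first, the kernel has norm at most its integral over the ball of radius `2`,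
whatever the pole `p x`; integrability of `g` does the rest. -/
theorem integrable_prod_cauchyKernel (hp : Measurable p) (hp1 : ∀ x, ‖p x‖ ≤ 1)
    (hg : Integrable g ν) (k : ℕ) :
    Integrable (fun q : ℂ × X => cauchyKernel k (p q.2 - q.1) * g q.2)
      ((volume.restrict disk).prod ν) := by
  have hmk : Measurable fun q : ℂ × X => cauchyKernel k (p q.2 - q.1) :=
    (measurable_cauchyKernel k).comp ((hp.comp measurable_snd).sub measurable_fst)
  have hK : Integrable ((Metric.ball (0 : ℂ) 2).indicator (cauchyKernel k)) :=
    (integrableOn_cauchyKernel k 2).integrable_indicator measurableSet_ball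
  have hmem : ∀ x, ∀ z ∈ disk, p x - z ∈ Metric.ball (0 : ℂ) 2 := fun x z hz => by
    rw [mem_ball_zero_iff] at hz ⊢
    calc ‖p x - z‖ ≤ ‖p x‖ + ‖z‖ := norm_sub_le _ _
      _ < 2 := by linarith [hp1 x]
  have hsec : ∀ x, IntegrableOn (fun z => cauchyKernel k (p x - z)) disk := fun x => by
    refine (hK.comp_sub_left (p x)).integrableOn.congr_fun (fun z hz => ?_) measurableSet_ball
    exact indicator_of_mem (hmem x z hz) _
  have hle : ∀ x, ∫ z in disk, ‖cauchyKernel k (p x - z)‖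
      ≤ ∫ z in Metric.ball (0 : ℂ) 2, ‖cauchyKernel k z‖ := fun x => by
    have e1 : ∫ z in disk, ‖cauchyKernel k (p x - z)‖
        = ∫ z in disk, ‖(Metric.ball (0 : ℂ) 2).indicator (cauchyKernel k) (p x - z)‖ :=
      setIntegral_congr_fun measurableSet_ball fun z hz => by
        simp only [indicator_of_mem (hmem x z hz)]
    rw [e1]
    refine (setIntegral_le_integral (hK.comp_sub_left (p x)).norm
      (Eventually.of_forall fun _ => norm_nonneg _)).trans ?_
    rw [integral_sub_left_eq_self
      (fun z => ‖(Metric.ball (0 : ℂ) 2).indicator (cauchyKernel k) z‖) volume (p x)]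
    simp only [norm_indicator_eq_indicator_norm]
    rw [integral_indicator measurableSet_ball]
  have hmeas : AEStronglyMeasurable (fun q : ℂ × X => cauchyKernel k (p q.2 - q.1) * g q.2)
      ((volume.restrict disk).prod ν) :=
    hmk.aestronglyMeasurable.mul hg.aestronglyMeasurable.comp_snd
  rw [integrable_prod_iff' hmeas]
  refine ⟨Eventually.of_forall fun x => (hsec x).mul_const (g x), ?_⟩
  simp only [norm_mul, integral_mul_const]
  refine (hg.norm.const_mul (∫ z in Metric.ball (0 : ℂ) 2, ‖cauchyKernel k z‖)).mono' ?_ ?_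
  · have h2 : StronglyMeasurable fun x => ∫ z in disk, ‖cauchyKernel k (p x - z)‖ := by
      refine StronglyMeasurable.integral_prod_right
        (f := fun x z => ‖cauchyKernel k (p x - z)‖) ?_
      exact (hmk.comp measurable_swap).norm.stronglyMeasurable
    exact h2.aestronglyMeasurable.mul hg.norm.aestronglyMeasurable
  · refine Eventually.of_forall fun x => ?_
    rw [norm_mul, norm_norm, Real.norm_eq_abs,
      abs_of_nonneg (integral_nonneg fun _ => norm_nonneg _)]
    gcongr
    exact hle x

theorem ae_integrable_cauchyKernel (hp : Measurable p) (hp1 : ∀ x, ‖p x‖ ≤ 1)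
    (hg : Integrable g ν) (k : ℕ) :
    ∀ᵐ z ∂volume.restrict disk, Integrable (fun x => cauchyKernel k (p x - z) * g x) ν :=
  (integrable_prod_cauchyKernel hp hp1 hg k).prod_right_ae

theorem integrableOn_integral_cauchyKernel (hp : Measurable p) (hp1 : ∀ x, ‖p x‖ ≤ 1)
    (hg : Integrable g ν) (k : ℕ) :
    IntegrableOn (fun z => ∫ x, cauchyKernel k (p x - z) * g x ∂ν) disk :=
  (integrable_prod_cauchyKernel hp hp1 hg k).integral_prod_left

/-- Fubini: pairing a Cauchy-type integral with `ψ` transfers the kernel to `ψ`, whose potential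
appears. -/
theorem integral_mul_integral_cauchyKernel (hp : Measurable p) (hp1 : ∀ x, ‖p x‖ ≤ 1)
    (hg : Integrable g ν) (k : ℕ) {ψ : ℂ → ℂ} (hψ : Continuous ψ) (hc : HasCompactSupport ψ)
    (hs : Function.support ψ ⊆ disk) :
    ∫ z in disk, ψ z * ∫ x, cauchyKernel k (p x - z) * g x ∂ν
      = Real.pi * ∫ x, potential ψ k (p x) * g x ∂ν := by
  obtain ⟨M, hM⟩ := hc.exists_bound_of_continuous hψ
  have hint : Integrable (fun q : ℂ × X => ψ q.1 * (cauchyKernel k (p q.2 - q.1) * g q.2))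
      ((volume.restrict disk).prod ν) :=
    (integrable_prod_cauchyKernel hp hp1 hg k).bdd_mul (c := M)
      (hψ.measurable.comp measurable_fst).aestronglyMeasurable (Eventually.of_forall fun q => hM q.1)
  simp only [← integral_const_mul]
  rw [integral_integral_swap (f := fun z x => ψ z * (cauchyKernel k (p x - z) * g x)) hint]
  congr 1
  ext x
  have hpi : (Real.pi : ℂ) ≠ 0 := by exact_mod_cast Real.pi_ne_zero
  simp only [← mul_assoc, integral_mul_const, potential]
  rw [mul_one_div_cancel hpi, one_mul]
  congr 1
  refine setIntegral_eq_integral_of_forall_compl_eq_zero fun z hz => ?_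
  have : ψ z = 0 := by
    by_contra h
    exact hz (hs h)
  simp [this]

end CauchyType

/-! ### The Cauchy–Pompeiu-type formula -/

theorem integrable_circle_data {g : ℂ → ℂ} (hg : ContinuousOn g circle) :
    Integrable (fun θ : ℝ => deriv (circleMap 0 1) θ * g (circleMap 0 1 θ))
      (volume.restrict (Ioc 0 (2 * Real.pi))) := by
  have h := (hg.circleIntegrable zero_le_one).out
  rwa [intervalIntegrable_iff_integrableOn_Ioc_of_le (by positivity)] at h

/-- Absorbing `dζ` into the density makes the contour integral an instance of the general
Cauchy-type integral, with the angle as parameter. -/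
theorem circleIntegral_kernel_eq (K g : ℂ → ℂ) :
    (∮ ζ in C(0, 1), K ζ * g ζ) = ∫ θ in Ioc 0 (2 * Real.pi),
      K (circleMap 0 1 θ) * (deriv (circleMap 0 1) θ * g (circleMap 0 1 θ)) := by
  rw [circleIntegral, intervalIntegral.integral_of_le (by positivity)]
  congr 1
  ext θ
  rw [smul_eq_mul]
  ring

theorem norm_circleMap_le (θ : ℝ) : ‖circleMap 0 1 θ‖ ≤ 1 := by simp

/-- A measurable retraction of the plane into the closed disk. -/
theorem exists_measurable_retraction :
    ∃ p : ℂ → ℂ, Measurable p ∧ (∀ z, ‖p z‖ ≤ 1) ∧ ∀ z ∈ disk, p z = z := by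
  refine ⟨disk.indicator id, measurable_id.indicator measurableSet_ball, fun z => ?_,
    fun z hz => indicator_of_mem hz _⟩
  by_cases hz : z ∈ disk
  · rw [indicator_of_mem hz]
    exact (mem_ball_zero_iff.1 hz).le
  · rw [indicator_of_notMem hz]
    simp

theorem cauchyPompeiu_eq (n : ℕ) (f : ℂ → ℂ) (γ : ℕ → ℂ → ℂ) (z : ℂ) :
    cauchyPompeiu n f γ z = ∑ k ∈ Finset.range n, (-1) ^ k / (2 * Real.pi * Complex.I) *
        (∮ ζ in C(0, 1), cauchyKernel k (ζ - z) * γ k ζ)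
      + (-1) ^ n / Real.pi * ∫ ζ in disk, cauchyKernel (n - 1) (ζ - z) * f ζ := by
  unfold cauchyPompeiu areaIntegrand cauchyKernel
  congr 1
  · refine Finset.sum_congr rfl fun k _ => ?_
    congr 2
    ext ζ
    ring
  · congr 2
    ext ζ
    ring

theorem ae_integrableOn_areaIntegrand {f : ℂ → ℂ} (hf : IntegrableOn f disk) (n : ℕ) :
    ∀ᵐ z ∂volume.restrict disk, IntegrableOn (areaIntegrand n f z) disk := by
  obtain ⟨p, hp, hp1, hpz⟩ := exists_measurable_retraction
  filter_upwards [ae_integrable_cauchyKernel hp hp1 hf (n - 1)] with z hz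
  refine IntegrableOn.congr_fun hz (fun ζ hζ => ?_) measurableSet_ball
  simp only [hpz ζ hζ, cauchyKernel, areaIntegrand]
  ring

theorem integrableOn_cauchyPompeiu_circle {g : ℂ → ℂ} (hg : ContinuousOn g circle) (k : ℕ) :
    IntegrableOn (fun z => ∮ ζ in C(0, 1), cauchyKernel k (ζ - z) * g ζ) disk := by
  simp only [circleIntegral_kernel_eq (fun ζ => cauchyKernel k (ζ - _))]
  exact integrableOn_integral_cauchyKernel (continuous_circleMap 0 1).measurable
    norm_circleMap_le (integrable_circle_data hg) k

theorem integral_mul_cauchyPompeiu_circle {g : ℂ → ℂ} (hg : ContinuousOn g circle) (k : ℕ)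
    {ψ : ℂ → ℂ} (hψ : Continuous ψ) (hc : HasCompactSupport ψ)
    (hs : Function.support ψ ⊆ disk) :
    ∫ z in disk, ψ z * (∮ ζ in C(0, 1), cauchyKernel k (ζ - z) * g ζ)
      = Real.pi * ∮ ζ in C(0, 1), potential ψ k ζ * g ζ := by
  simp only [circleIntegral_kernel_eq]
  exact integral_mul_integral_cauchyKernel (continuous_circleMap 0 1).measurable
    norm_circleMap_le (integrable_circle_data hg) k hψ hc hs

theorem integrableOn_cauchyPompeiu_area {f : ℂ → ℂ} (hf : IntegrableOn f disk) (k : ℕ) :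
    IntegrableOn (fun z => ∫ ζ in disk, cauchyKernel k (ζ - z) * f ζ) disk := by
  obtain ⟨p, hp, hp1, hpz⟩ := exists_measurable_retraction
  refine (integrableOn_integral_cauchyKernel hp hp1 hf k).congr_fun (fun z _ => ?_)
    measurableSet_ball
  exact setIntegral_congr_fun measurableSet_ball fun ζ hζ => by simp only [hpz ζ hζ]

theorem integral_mul_cauchyPompeiu_area {f : ℂ → ℂ} (hf : IntegrableOn f disk) (k : ℕ)
    {ψ : ℂ → ℂ} (hψ : Continuous ψ) (hc : HasCompactSupport ψ)
    (hs : Function.support ψ ⊆ disk) :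
    ∫ z in disk, ψ z * (∫ ζ in disk, cauchyKernel k (ζ - z) * f ζ)
      = Real.pi * ∫ ζ in disk, potential ψ k ζ * f ζ := by
  obtain ⟨p, hp, hp1, hpz⟩ := exists_measurable_retraction
  have e1 : ∀ z, ∫ ζ in disk, cauchyKernel k (ζ - z) * f ζ
      = ∫ ζ in disk, cauchyKernel k (p ζ - z) * f ζ := fun z =>
    setIntegral_congr_fun measurableSet_ball fun ζ hζ => by simp only [hpz ζ hζ]
  have e2 : ∫ ζ in disk, potential ψ k ζ * f ζ = ∫ ζ in disk, potential ψ k (p ζ) * f ζ :=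
    setIntegral_congr_fun measurableSet_ball fun ζ hζ => by simp only [hpz ζ hζ]
  simp only [e1, e2]
  exact integral_mul_integral_cauchyKernel hp hp1 hf k hψ hc hs

section Formula

variable {n : ℕ} {f : ℂ → ℂ} {γ : ℕ → ℂ → ℂ}

theorem integrableOn_cauchyPompeiu (hf : IntegrableOn f disk)
    (hγ : ∀ k < n, ContinuousOn (γ k) circle) : IntegrableOn (cauchyPompeiu n f γ) disk := by
  rw [show cauchyPompeiu n f γ = _ from funext (cauchyPompeiu_eq n f γ)]
  refine Integrable.add (integrable_finsetSum _ fun k hk => ?_) ?_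
  · exact (integrableOn_cauchyPompeiu_circle (hγ k (Finset.mem_range.1 hk)) k).const_mul _
  · exact (integrableOn_cauchyPompeiu_area hf (n - 1)).const_mul _

/-- The Cauchy–Pompeiu-type formula paired with a test function. -/
theorem integral_mul_cauchyPompeiu (hf : IntegrableOn f disk)
    (hγ : ∀ k < n, ContinuousOn (γ k) circle) {ψ : ℂ → ℂ} (hψ : Continuous ψ)
    (hc : HasCompactSupport ψ) (hs : Function.support ψ ⊆ disk) :
    ∫ z in disk, ψ z * cauchyPompeiu n f γ z
      = ∑ k ∈ Finset.range n, (-1) ^ k / (2 * Complex.I) *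
          (∮ ζ in C(0, 1), potential ψ k ζ * γ k ζ)
        + (-1) ^ n * ∫ ζ in disk, potential ψ (n - 1) ζ * f ζ := by
  have hpi : (Real.pi : ℂ) ≠ 0 := by exact_mod_cast Real.pi_ne_zero
  obtain ⟨M, hM⟩ := hc.exists_bound_of_continuous hψ
  have hb : ∀ {F : ℂ → ℂ}, IntegrableOn F disk → IntegrableOn (fun z => ψ z * F z) disk :=
    fun hF => hF.bdd_mul (c := M) hψ.aestronglyMeasurable (Eventually.of_forall hM)
  have e : ∀ z, ψ z * cauchyPompeiu n f γ z
      = ∑ k ∈ Finset.range n, (-1) ^ k / (2 * Real.pi * Complex.I) *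
          (ψ z * ∮ ζ in C(0, 1), cauchyKernel k (ζ - z) * γ k ζ)
        + (-1) ^ n / Real.pi * (ψ z * ∫ ζ in disk, cauchyKernel (n - 1) (ζ - z) * f ζ) := by
    intro z
    rw [cauchyPompeiu_eq, mul_add, Finset.mul_sum]
    congr 1
    · exact Finset.sum_congr rfl fun k _ => by ring
    · ring
  simp only [e]
  rw [integral_add, integral_finsetSum]
  · simp only [integral_const_mul]
    rw [integral_mul_cauchyPompeiu_area hf (n - 1) hψ hc hs]
    congr 1
    · refine Finset.sum_congr rfl fun k hk => ?_
      rw [integral_mul_cauchyPompeiu_circle (hγ k (Finset.mem_range.1 hk)) k hψ hc hs]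
      have := Complex.I_ne_zero
      field_simp
    · field_simp
  · exact fun k hk => (hb (integrableOn_cauchyPompeiu_circle
      (hγ k (Finset.mem_range.1 hk)) k)).const_mul _
  · exact integrable_finsetSum _ fun k hk => (hb (integrableOn_cauchyPompeiu_circle
      (hγ k (Finset.mem_range.1 hk)) k)).const_mul _
  · exact (hb (integrableOn_cauchyPompeiu_area hf (n - 1))).const_mul _

theorem dbarChain_potential {ψ : ℂ → ℂ} (hψ : ContDiff ℝ ∞ ψ) (hc : HasCompactSupport ψ) :
    DbarChain (potential ψ) :=
  ⟨fun k => (contDiff_potential hψ hc k).contDiffOn,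
    fun k => (contDiff_potential hψ hc k).continuous.continuousOn,
    fun k z _ => dbar_potential_succ hψ hc k z⟩

/-- Solutions are given by the Cauchy–Pompeiu-type formula. -/
theorem SolvesComplex.ae_eq_cauchyPompeiu {w : ℂ → ℂ} (hn : 0 < n) (h : SolvesComplex n f γ w)
    (hf : IntegrableOn f disk) (hγ : ∀ k < n, ContinuousOn (γ k) circle) :
    w =ᵐ[volume.restrict disk] cauchyPompeiu n f γ := by
  have iw := SolvesDirichlet.integrableOn h hf hγ
  have iC := integrableOn_cauchyPompeiu hf hγ
  have h0 := Metric.isOpen_ball.ae_eq_zero_of_integral_contDiff_smul_eq_zero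
    (U := disk) (μ := (volume : Measure ℂ)) (f := fun z => w z - cauchyPompeiu n f γ z)
    (iw.sub iC).locallyIntegrableOn ?_
  · rw [EventuallyEq, ae_restrict_iff' measurableSet_ball]
    filter_upwards [h0] with z hz hzd
    exact sub_eq_zero.1 (hz hzd)
  · intro φ h1 h2 h3
    rw [← setIntegral_eq_integral_of_forall_compl_eq_zero (s := disk)]
    swap
    · intro z hz
      rw [image_eq_zero_of_notMem_tsupport fun h => hz (h3 h), zero_smul]
    have hψ : ContDiff ℝ ∞ fun z => (φ z : ℂ) := Complex.ofRealCLM.contDiff.comp h1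
    have hss : Function.support (fun z => (φ z : ℂ)) ⊆ Function.support φ := fun z hz => by
      simpa using hz
    have hc : HasCompactSupport fun z => (φ z : ℂ) := h2.mono hss
    have hs : Function.support (fun z => (φ z : ℂ)) ⊆ disk :=
      hss.trans (subset_closure.trans h3)
    obtain ⟨M, hM⟩ := hc.exists_bound_of_continuous hψ.continuous
    have hb : ∀ {F : ℂ → ℂ}, IntegrableOn F disk →
        IntegrableOn (fun z => (φ z : ℂ) * F z) disk :=
      fun hF => hF.bdd_mul (c := M) hψ.continuous.aestronglyMeasurable (Eventually.of_forall hM)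
    simp only [Complex.real_smul, mul_sub]
    rw [integral_sub (hb iw) (hb iC), integral_mul_cauchyPompeiu hf hγ hψ.continuous hc hs]
    have hchain := (dbarChain_potential hψ hc).cons hψ.contDiffOn hψ.continuous.continuousOn
      (fun z _ => dbar_potential_zero hψ hc z)
    have key := h.iterated_green hf hγ hchain
    -- Prepending `φ` shifts the indices by one: the `n`-th member of the chain is the potential of
    -- index `n - 1`, and the substitution makes this definitional.
    obtain ⟨m, rfl⟩ : ∃ m, n = m + 1 := ⟨n - 1, by omega⟩
    exact sub_eq_zero.2 key

/-- The formula of order one solves the equation in the disk. -/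
theorem isWeakDbar_cauchyPompeiu_one (hf : IntegrableOn f disk) (hγ : ContinuousOn (γ 0) circle) :
    IsWeakDbar (fun c => Complex.I * c) (cauchyPompeiu 1 f γ) f := by
  have hγ' : ∀ k < 1, ContinuousOn (γ k) circle := fun k hk => by
    rwa [Nat.lt_one_iff.1 hk]
  refine ⟨(integrableOn_cauchyPompeiu hf hγ').locallyIntegrableOn, hf.locallyIntegrableOn,
    fun φ h1 h2 h3 => ?_⟩
  have hψ : ContDiff ℝ ∞ fun z => (φ z : ℂ) := Complex.ofRealCLM.contDiff.comp h1
  have hss : Function.support (fun z => (φ z : ℂ)) ⊆ Function.support φ := fun z hz => by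
    simpa using hz
  have hts : tsupport (fun z => (φ z : ℂ)) ⊆ disk := (closure_mono hss).trans h3
  have hc : HasCompactSupport fun z => (φ z : ℂ) := h2.mono hss
  have key := integral_mul_cauchyPompeiu hf hγ' (continuous_dbar hψ) (hasCompactSupport_dbar hc)
    ((support_dbar_subset _).trans hts)
  -- The potential of the derivative returns the test function itself, which vanishes on the circle;
  -- only the area term survives.
  have e1 : ∀ ζ, potential (dbar fun z => (φ z : ℂ)) 0 ζ = φ ζ := fun ζ => by
    rw [← dbar_potential_eq hψ hc, dbar_potential_zero hψ hc]
  have e2 : (∮ ζ in C(0, 1), (φ ζ : ℂ) * γ 0 ζ) = 0 := by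
    rw [circleIntegral.integral_congr (g := fun _ => 0) zero_le_one]
    · simp [circleIntegral]
    · intro ζ hζ
      have : ζ ∉ disk := by
        rw [mem_sphere_zero_iff_norm] at hζ
        simp [hζ]
      simp only
      rw [image_eq_zero_of_notMem_tsupport fun h => this (h3 h)]
      simp
  simp only [e1, Finset.range_one, Finset.sum_singleton, e2, mul_zero, zero_add, pow_one,
    neg_mul, one_mul] at key
  simp only [Complex.real_smul]
  rw [← key]
  refine integral_congr_ae (Eventually.of_forall fun z => ?_)
  simp only [dbar_ofReal φ (h1.differentiable (by simp) z)]
  push_cast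
  ring

/-! ### The integral conditions -/

/-- The functions whose integrals against the data enter the integral conditions. -/
noncomputable def conditionKernel (z : ℂ) (m : ℕ) (ζ : ℂ) : ℂ :=
  conj (ζ - z) ^ m / (m.factorial : ℂ) * (1 - conj z * ζ)⁻¹

theorem one_sub_conj_mul_ne_zero {z ζ : ℂ} (hz : ‖z‖ < 1) (hζ : ‖ζ‖ ≤ 1) :
    1 - conj z * ζ ≠ 0 := by
  intro h
  have h1 : ‖conj z * ζ‖ = 1 := by rw [← sub_eq_zero.1 h, norm_one]
  rw [norm_mul, RCLike.norm_conj] at h1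
  nlinarith [norm_nonneg z, norm_nonneg ζ]

theorem differentiableAt_inv_one_sub {z ζ : ℂ} (hz : ‖z‖ < 1) (hζ : ‖ζ‖ ≤ 1) :
    DifferentiableAt ℂ (fun ζ => (1 - conj z * ζ)⁻¹) ζ :=
  DifferentiableAt.inv (by fun_prop) (one_sub_conj_mul_ne_zero hz hζ)

theorem contDiffAt_inv_one_sub {z ζ : ℂ} (hz : ‖z‖ < 1) (hζ : ‖ζ‖ ≤ 1) :
    ContDiffAt ℝ ∞ (fun ζ => (1 - conj z * ζ)⁻¹) ζ :=
  ContDiffAt.inv (by fun_prop) (one_sub_conj_mul_ne_zero hz hζ)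

/-- The factor `(1 - z*ζ)⁻¹` is holomorphic in `ζ` near the closed disk, so `∂/∂ζ*` only sees the
powers of the conjugate. -/
theorem dbarChain_conditionKernel {z : ℂ} (hz : ‖z‖ < 1) : DbarChain (conditionKernel z) := by
  have hs : ∀ m, ∀ ζ : ℂ, ‖ζ‖ ≤ 1 → ContDiffAt ℝ ∞ (conditionKernel z m) ζ := fun m ζ hζ =>
    (contDiff_conj_sub_pow z m).contDiffAt.mul (contDiffAt_inv_one_sub hz hζ)
  refine ⟨fun m ζ hζ => (hs m ζ (mem_ball_zero_iff.1 hζ).le).contDiffWithinAt,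
    fun m ζ hζ => (hs m ζ (mem_closedBall_zero_iff.1 hζ)).continuousAt.continuousWithinAt,
    fun m ζ hζ => ?_⟩
  have hd := differentiableAt_inv_one_sub hz (mem_ball_zero_iff.1 hζ).le
  unfold conditionKernel
  rw [dbar_mul ((contDiff_conj_sub_pow z (m + 1)).differentiable (by simp) ζ)
    (hd.restrictScalars ℝ), dbar_conj_sub_pow, dbar_eq_zero hd, mul_zero, add_zero]

theorem dbar_conditionKernel_zero {z ζ : ℂ} (hz : ‖z‖ < 1) (hζ : ‖ζ‖ ≤ 1) :
    dbar (conditionKernel z 0) ζ = 0 := by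
  have : conditionKernel z 0 = fun ζ => (1 - conj z * ζ)⁻¹ := by
    ext ζ; simp [conditionKernel]
  rw [this]
  exact dbar_eq_zero (differentiableAt_inv_one_sub hz hζ)

/-- The expression of the integral conditions, up to a factor. -/
noncomputable def conditionSum (n : ℕ) (f : ℂ → ℂ) (γ : ℕ → ℂ → ℂ) (z : ℂ) : ℂ :=
  ∑ m ∈ Finset.range n, (-1) ^ m / (2 * Complex.I) *
      (∮ ζ in C(0, 1), conditionKernel z m ζ * γ m ζ)
    + (-1) ^ n * ∫ ζ in disk, conditionKernel z (n - 1) ζ * f ζ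

/-- Reindexing by `ℓ = k + m` shows that the condition of index `k` is the condition of index `0`
for the shifted problem of order `n - k`. -/
theorem integralConditions_iff (n : ℕ) (f : ℂ → ℂ) (γ : ℕ → ℂ → ℂ) :
    IntegralConditions n f γ ↔ ∀ z ∈ disk, ∀ k < n,
      conj z / Real.pi * conditionSum (n - k) f (fun m => γ (k + m)) z = 0 := by
  have hpi : (Real.pi : ℂ) ≠ 0 := by exact_mod_cast Real.pi_ne_zero
  have hI := Complex.I_ne_zero
  unfold IntegralConditions
  refine forall₂_congr fun z _ => forall₂_congr fun k _ => ?_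
  refine Eq.congr ?_ rfl
  rw [Finset.sum_Ico_eq_sum_range, conditionSum, mul_add, Finset.mul_sum]
  congr 1
  · refine Finset.sum_congr rfl fun m _ => ?_
    rw [Nat.add_sub_cancel_left]
    have : (∮ ζ in C(0, 1), (-1 : ℂ) ^ m * (γ (k + m) ζ / (1 - conj z * ζ)) *
          (conj (ζ - z) ^ m / (m.factorial : ℂ)))
        = (-1) ^ m * ∮ ζ in C(0, 1), conditionKernel z m ζ * γ (k + m) ζ := by
      rw [← smul_eq_mul, ← circleIntegral.integral_smul]
      congr 1
      ext ζ
      simp only [conditionKernel, smul_eq_mul]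
      ring
    rw [this]
    field_simp
  · rw [show n - k - 1 = n - 1 - k by omega]
    have : ∫ ζ in disk, f ζ / (1 - conj z * ζ) *
          (conj (ζ - z) ^ (n - 1 - k) / ((n - 1 - k).factorial : ℂ))
        = ∫ ζ in disk, conditionKernel z (n - 1 - k) ζ * f ζ := by
      congr 1
      ext ζ
      simp only [conditionKernel]
      ring
    rw [this]
    ring

/-- The data of solvable problems satisfy the integral conditions. -/
theorem SolvesComplex.integralConditions {w : ℂ → ℂ} (h : SolvesComplex n f γ w)
    (hf : IntegrableOn f disk) (hγ : ∀ k < n, ContinuousOn (γ k) circle) :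
    IntegralConditions n f γ := by
  rw [integralConditions_iff]
  intro z hz k hk
  rw [mem_ball_zero_iff] at hz
  obtain ⟨u, hu⟩ := SolvesDirichlet.exists_iterate h hk.le
  -- With `0` at the head of the chain, the left side of the iterated Green formula vanishes.
  have hchain := (dbarChain_conditionKernel hz).cons (ψ := fun _ => 0) contDiffOn_const
    continuousOn_const fun ζ hζ => dbar_conditionKernel_zero hz (mem_ball_zero_iff.1 hζ).le
  have key := SolvesComplex.iterated_green hu hf (fun m hm => hγ _ (by omega)) hchain
  obtain ⟨m, hm⟩ : ∃ m, n - k = m + 1 := ⟨n - k - 1, by omega⟩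
  rw [hm] at key ⊢
  have h0 : conditionSum (m + 1) f (fun m => γ (k + m)) z = 0 :=
    key.symm.trans (by simp)
  rw [h0, mul_zero]

end Formula

/-! ### The Poisson kernel -/

/-- The Poisson formula for the constant function `1`. -/
theorem integral_poissonKernel {R : ℝ} {w : ℂ} (hw : ‖w‖ < R) :
    ∫ θ in (0)..(2 * Real.pi), (R ^ 2 - ‖w‖ ^ 2) / ‖circleMap 0 R θ - w‖ ^ 2 = 2 * Real.pi := by
  have hR : 0 ≤ R := (norm_nonneg w).trans hw.le
  have h := DiffContOnCl.circleAverage_poissonKernel_smul' (f := fun _ => (1 : ℂ)) (c := 0)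
    (w := w) (R := R) diffContOnCl_const (mem_ball_zero_iff.2 hw)
  simp only [sub_zero, Complex.real_smul, mul_one, Real.circleAverage_def, norm_circleMap_zero,
    sq_abs] at h
  rw [intervalIntegral.integral_ofReal] at h
  have h2 : (2 * Real.pi)⁻¹ * ∫ θ in (0)..(2 * Real.pi),
      (R ^ 2 - ‖w‖ ^ 2) / ‖circleMap 0 R θ - w‖ ^ 2 = 1 := by exact_mod_cast h
  have hpi := Real.pi_pos
  field_simp at h2
  linarith

/-- The modulus of the kernel obtained by reflecting the Cauchy kernel in the unit circle. -/
noncomputable def reflectedKernel (z ζ : ℂ) : ℝ := (1 - ‖z‖ ^ 2) / (‖ζ - z‖ * ‖1 - conj z * ζ‖)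

/-- With `e` the unit vector of angle `θ`, both squares equal `r² + s² - 2rs Re(u e*)`, so the radii
may be exchanged. -/
theorem norm_sub_circleMap_swap (r s θ : ℝ) {u : ℂ} (hu : ‖u‖ = 1) :
    ‖s * u - circleMap 0 r θ‖ = ‖circleMap 0 s θ - r * u‖ := by
  have he : ‖circleMap 0 1 θ‖ = 1 := by simp
  have e1 : ∀ t : ℝ, circleMap 0 t θ = t * circleMap 0 1 θ := fun t => by simp [circleMap]
  rw [e1 r, e1 s]
  generalize circleMap 0 1 θ = e at he
  rw [← sq_eq_sq₀ (norm_nonneg _) (norm_nonneg _), Complex.sq_norm, Complex.sq_norm]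
  have h1 : u.re * u.re + u.im * u.im = 1 := by
    rw [← Complex.normSq_apply, ← Complex.sq_norm, hu, one_pow]
  have h2 : e.re * e.re + e.im * e.im = 1 := by
    rw [← Complex.normSq_apply, ← Complex.sq_norm, he, one_pow]
  simp only [Complex.normSq_apply, Complex.sub_re, Complex.sub_im, Complex.mul_re, Complex.mul_im,
    Complex.ofReal_re, Complex.ofReal_im]
  linear_combination (s ^ 2 - r ^ 2) * h1 - (s ^ 2 - r ^ 2) * h2

/-- For `|ζ| < r` this is the Poisson kernel of the circle of radius `r`; for `|ζ| > r` exchanging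
the radii reduces to the same case. -/
theorem integral_inv_sq_norm_sub_circleMap {r : ℝ} {ζ : ℂ} (hr : 0 < r) (hne : r ≠ ‖ζ‖) :
    ∫ θ in (0)..(2 * Real.pi), |r ^ 2 - ‖ζ‖ ^ 2| / ‖ζ - circleMap 0 r θ‖ ^ 2 = 2 * Real.pi := by
  rcases lt_or_gt_of_ne hne with h | h
  · have hs : 0 < ‖ζ‖ := hr.trans h
    have hu : ‖ζ / ‖ζ‖‖ = 1 := by simp [hs.ne']
    have hw : ‖(r : ℂ) * (ζ / ‖ζ‖)‖ = r := by
      rw [norm_mul, hu, mul_one, Complex.norm_real, Real.norm_eq_abs, abs_of_pos hr]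
    have key := integral_poissonKernel (R := ‖ζ‖) (w := (r : ℂ) * (ζ / ‖ζ‖)) (by rw [hw]; exact h)
    refine Eq.trans ?_ key
    congr 1
    ext θ
    rw [hw, ← norm_sub_circleMap_swap r ‖ζ‖ θ hu, mul_div_cancel₀, abs_of_neg, neg_sub]
    · nlinarith
    · exact_mod_cast hs.ne'
  · refine Eq.trans ?_ (integral_poissonKernel h)
    congr 1
    ext θ
    rw [norm_sub_rev, abs_of_pos]
    nlinarith [norm_nonneg ζ]

theorem norm_one_sub_conj_circleMap_mul (r θ : ℝ) (ζ : ℂ) :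
    ‖1 - conj (circleMap 0 r θ) * ζ‖ = ‖circleMap 0 1 θ - r * ζ‖ := by
  have he : ‖circleMap 0 1 θ‖ = 1 := by simp
  have e1 : circleMap 0 r θ = r * circleMap 0 1 θ := by simp [circleMap]
  rw [e1]
  generalize circleMap 0 1 θ = e at he
  have h2 : conj e * e = 1 := by rw [Complex.conj_mul', he]; simp
  have h1 : 1 - conj (r * e) * ζ = conj e * (e - r * ζ) := by
    rw [map_mul, Complex.conj_ofReal]
    linear_combination -h2
  rw [h1, norm_mul, RCLike.norm_conj, he, one_mul]

/-- The product of the two inverse distances is bounded by the inequality between geometric and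
arithmetic means. The weights `a` and `b` are those that turn both squares into Poisson kernels of
mass `2π`. -/
theorem lintegral_reflectedKernel_circle {r : ℝ} {ζ : ℂ} (hr : 0 < r) (hr1 : r < 1)
    (hζ : ‖ζ‖ < 1) (hne : r ≠ ‖ζ‖) :
    ∫⁻ θ in Ioo (-Real.pi) Real.pi, ENNReal.ofReal (reflectedKernel (circleMap 0 r θ) ζ)
      ≤ ENNReal.ofReal (2 * Real.pi * ((1 - r ^ 2) /
        (√|r ^ 2 - ‖ζ‖ ^ 2| * √(1 - r ^ 2 * ‖ζ‖ ^ 2)))) := by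
  have hrs : ‖(r : ℂ) * ζ‖ = r * ‖ζ‖ := by
    rw [norm_mul, Complex.norm_real, Real.norm_eq_abs, abs_of_pos hr]
  have hs := norm_nonneg ζ
  have hrs1 : r * ‖ζ‖ < 1 := by nlinarith
  have ha : 0 < |r ^ 2 - ‖ζ‖ ^ 2| := by
    rw [abs_pos, sub_ne_zero]
    intro h
    exact hne ((sq_eq_sq₀ hr.le hs).1 h)
  have hb : 0 < 1 - r ^ 2 * ‖ζ‖ ^ 2 := by nlinarith [mul_nonneg hr.le hs]
  set a := |r ^ 2 - ‖ζ‖ ^ 2| with ha_def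
  set b := 1 - r ^ 2 * ‖ζ‖ ^ 2 with hb_def
  have hd : ∀ θ, ‖ζ - circleMap 0 r θ‖ ≠ 0 := fun θ h => by
    rw [norm_eq_zero, sub_eq_zero] at h
    apply hne
    rw [h, norm_circleMap_zero, abs_of_pos hr]
  have hD : ∀ θ, ‖circleMap 0 1 θ - r * ζ‖ ≠ 0 := fun θ h => by
    rw [norm_eq_zero, sub_eq_zero] at h
    have := congrArg norm h
    rw [hrs, norm_circleMap_zero, abs_one] at this
    linarith
  let h : ℝ → ℝ := fun θ => (1 - r ^ 2) / (2 * (√a * √b)) *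
    (a / ‖ζ - circleMap 0 r θ‖ ^ 2 + b / ‖circleMap 0 1 θ - r * ζ‖ ^ 2)
  have hc1 : Continuous fun θ => a / ‖ζ - circleMap 0 r θ‖ ^ 2 :=
    Continuous.div continuous_const (by fun_prop) fun θ => pow_ne_zero 2 (hd θ)
  have hc2 : Continuous fun θ => b / ‖circleMap 0 1 θ - r * ζ‖ ^ 2 :=
    Continuous.div continuous_const (by fun_prop) fun θ => pow_ne_zero 2 (hD θ)
  have hc : Continuous h := continuous_const.mul (hc1.add hc2)
  have hr2 : 0 ≤ 1 - r ^ 2 := by nlinarith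
  have hle : ∀ θ, reflectedKernel (circleMap 0 r θ) ζ ≤ h θ := by
    intro θ
    have e1 : reflectedKernel (circleMap 0 r θ) ζ
        = (1 - r ^ 2) * (‖ζ - circleMap 0 r θ‖⁻¹ * ‖circleMap 0 1 θ - r * ζ‖⁻¹) := by
      rw [reflectedKernel, norm_one_sub_conj_circleMap_mul, norm_circleMap_zero, sq_abs,
        div_eq_mul_inv, mul_inv]
    have e2 : h θ = (1 - r ^ 2) * ((a * (‖ζ - circleMap 0 r θ‖⁻¹) ^ 2
        + b * (‖circleMap 0 1 θ - r * ζ‖⁻¹) ^ 2) / (2 * (√a * √b))) := by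
      simp only [h, inv_pow, div_eq_mul_inv]
      ring
    rw [e1, e2]
    refine mul_le_mul_of_nonneg_left ?_ hr2
    rw [le_div_iff₀ (by positivity)]
    have q1 := Real.sq_sqrt ha.le
    have q2 := Real.sq_sqrt hb.le
    nlinarith [sq_nonneg (√a * ‖ζ - circleMap 0 r θ‖⁻¹ - √b * ‖circleMap 0 1 θ - r * ζ‖⁻¹)]
  have h0 : ∀ θ, 0 ≤ h θ := fun θ => by
    simp only [h]
    positivity
  have hper : Function.Periodic h (2 * Real.pi) := fun θ => by
    simp only [h, periodic_circleMap 0 r θ, periodic_circleMap 0 1 θ]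
  have hint : ∫ θ in Ioo (-Real.pi) Real.pi, h θ
      = 2 * Real.pi * ((1 - r ^ 2) / (√a * √b)) := by
    rw [← integral_Ioc_eq_integral_Ioo, ← intervalIntegral.integral_of_le
      (by linarith [Real.pi_pos])]
    have e := hper.intervalIntegral_add_eq (-Real.pi) 0
    rw [zero_add, show -Real.pi + 2 * Real.pi = Real.pi by ring] at e
    rw [e]
    simp only [h]
    rw [intervalIntegral.integral_const_mul, intervalIntegral.integral_add
      (hc1.intervalIntegrable _ _) (hc2.intervalIntegrable _ _),
      integral_inv_sq_norm_sub_circleMap hr hne]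
    have e3 := integral_poissonKernel (R := 1) (w := (r : ℂ) * ζ) (by rw [hrs]; exact hrs1)
    rw [hrs, mul_pow, one_pow] at e3
    rw [e3]
    field_simp
    ring
  calc ∫⁻ θ in Ioo (-Real.pi) Real.pi, ENNReal.ofReal (reflectedKernel (circleMap 0 r θ) ζ)
      ≤ ∫⁻ θ in Ioo (-Real.pi) Real.pi, ENNReal.ofReal (h θ) :=
        lintegral_mono fun θ => ENNReal.ofReal_le_ofReal (hle θ)
    _ = ENNReal.ofReal (∫ θ in Ioo (-Real.pi) Real.pi, h θ) := by
        rw [ofReal_integral_eq_lintegral_ofReal]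
        · exact hc.integrableOn_Icc.mono_set Ioo_subset_Icc_self
        · exact Eventually.of_forall h0
    _ = _ := by rw [hint]

theorem lintegral_inv_sqrt_abs_le {ε : ℝ} (hε : 0 < ε) :
    ∫⁻ x in Metric.ball (0 : ℝ) ε, ENNReal.ofReal (√|x|)⁻¹ ≤ ENNReal.ofReal (4 * √ε) := by
  have h1 : IntegrableOn (fun y : ℝ => (√y)⁻¹) (Ioo 0 ε) := by
    have := intervalIntegral.intervalIntegrable_rpow' (a := 0) (b := ε)
      (show (-1 : ℝ) < -(1 / 2) by norm_num)
    rw [intervalIntegrable_iff_integrableOn_Ioo_of_le hε.le] at this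
    refine this.congr_fun (fun y hy => ?_) measurableSet_Ioo
    simp only [Real.rpow_neg hy.1.le, Real.sqrt_eq_rpow]
  have h2 : ∫ y in Ioo 0 ε, (√y)⁻¹ = 2 * √ε := by
    have := integral_rpow (a := 0) (b := ε) (r := -(1 / 2)) (Or.inl (by norm_num))
    rw [intervalIntegral.integral_of_le hε.le, integral_Ioc_eq_integral_Ioo] at this
    rw [setIntegral_congr_fun (g := fun y => y ^ (-(1 / 2) : ℝ)) measurableSet_Ioo, this,
      Real.zero_rpow (by norm_num), Real.sqrt_eq_rpow]
    · norm_num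
      ring
    · intro y hy
      simp only [Real.rpow_neg hy.1.le, Real.sqrt_eq_rpow]
  have h3 : IntegrableOn (fun x : ℝ => (√|x|)⁻¹) (Metric.ball 0 ε) := by
    have := integrableOn_fun_norm_addHaar (E := ℝ) volume (f := fun y : ℝ => (√y)⁻¹) (r := ε)
    simp only [Module.finrank_self, tsub_self, pow_zero, one_smul, Real.norm_eq_abs] at this
    exact this.2 h1
  rw [← ofReal_integral_eq_lintegral_ofReal h3
    (Eventually.of_forall fun x => by positivity)]
  apply ENNReal.ofReal_le_ofReal
  -- The radial integration formula concerns the whole space, so the restriction to the ball is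
  -- encoded in the profile.
  have h4 := integral_fun_norm_addHaar (E := ℝ) volume
    (fun y : ℝ => (Iio ε).indicator (fun y => (√y)⁻¹) y)
  have h5 : ∀ x : ℝ, (Iio ε).indicator (fun y => (√y)⁻¹) ‖x‖
      = (Metric.ball (0 : ℝ) ε).indicator (fun x => (√|x|)⁻¹) x := fun x => by
    simp only [indicator, mem_Iio, mem_ball_zero_iff, Real.norm_eq_abs]
  simp only [h5, Module.finrank_self, tsub_self, pow_zero, one_smul] at h4
  rw [integral_indicator measurableSet_ball, setIntegral_indicator measurableSet_Iio,
    Ioi_inter_Iio, h2, Measure.real, Real.volume_ball] at h4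
  rw [h4]
  norm_num
  linarith

/-- Points within `ε` of `s` contribute at most `4√ε` by translation; elsewhere the integrand is at
most `1/√ε` on an interval of length `ε`. -/
theorem lintegral_inv_sqrt_abs_sub_le {ε : ℝ} (hε : 0 < ε) (s : ℝ) :
    ∫⁻ x in Ioo (1 - ε) 1, ENNReal.ofReal (√|x - s|)⁻¹ ≤ ENNReal.ofReal (5 * √ε) := by
  have hle : ∀ x : ℝ, ENNReal.ofReal (√|x - s|)⁻¹
      ≤ (Metric.ball (0 : ℝ) ε).indicator (fun x => ENNReal.ofReal (√|x|)⁻¹) (x - s)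
        + ENNReal.ofReal (√ε)⁻¹ := by
    intro x
    by_cases hx : x - s ∈ Metric.ball (0 : ℝ) ε
    · rw [indicator_of_mem hx]
      exact le_self_add
    · rw [indicator_of_notMem hx, zero_add]
      apply ENNReal.ofReal_le_ofReal
      rw [mem_ball_zero_iff, Real.norm_eq_abs, not_lt] at hx
      have := Real.sqrt_pos.2 hε
      gcongr
  calc ∫⁻ x in Ioo (1 - ε) 1, ENNReal.ofReal (√|x - s|)⁻¹
      ≤ ∫⁻ x in Ioo (1 - ε) 1, ((Metric.ball (0 : ℝ) ε).indicator
        (fun x => ENNReal.ofReal (√|x|)⁻¹) (x - s) + ENNReal.ofReal (√ε)⁻¹) :=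
        lintegral_mono hle
    _ = (∫⁻ x in Ioo (1 - ε) 1, (Metric.ball (0 : ℝ) ε).indicator
        (fun x => ENNReal.ofReal (√|x|)⁻¹) (x - s)) + ENNReal.ofReal (√ε)⁻¹ * ENNReal.ofReal ε := by
        rw [lintegral_add_right _ measurable_const, lintegral_const,
          Measure.restrict_apply_univ, Real.volume_Ioo, sub_sub_cancel]
    _ ≤ ENNReal.ofReal (4 * √ε) + ENNReal.ofReal (√ε) := by
        gcongr
        · refine (setLIntegral_le_lintegral _ _).trans ?_
          rw [lintegral_sub_right_eq_self, lintegral_indicator measurableSet_ball]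
          exact lintegral_inv_sqrt_abs_le hε
        · rw [← ENNReal.ofReal_mul (by positivity)]
          apply ENNReal.ofReal_le_ofReal
          have h1 := Real.sqrt_pos.2 hε
          rw [inv_mul_le_iff₀ h1, Real.mul_self_sqrt hε.le]
    _ = ENNReal.ofReal (5 * √ε) := by
        rw [← ENNReal.ofReal_add (by positivity) (by positivity)]
        congr 1
        ring

/-- The mean of the reflected kernel over annuli is bounded, uniformly in the pole. -/
theorem lintegral_reflectedKernel_annulus_le {ε : ℝ} (hε : 0 < ε) (hε1 : ε ≤ 1 / 2) {ζ : ℂ}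
    (hζ : ‖ζ‖ < 1) :
    ∫⁻ z in annulus ε, ENNReal.ofReal (reflectedKernel z ζ)
      ≤ ENNReal.ofReal (20 * Real.pi * ε) := by
  set F : ℂ → ENNReal := (annulus ε).indicator fun z => ENNReal.ofReal (reflectedKernel z ζ)
    with hF
  rw [← lintegral_indicator (measurableSet_annulus ε), ← Complex.lintegral_comp_polarCoord_symm]
  have htarget : (volume : Measure (ℝ × ℝ)).restrict polarCoord.target
      = (volume.restrict (Ioi 0)).prod (volume.restrict (Ioo (-Real.pi) Real.pi)) := by
    rw [Measure.prod_restrict]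
    rfl
  rw [htarget]
  refine (lintegral_prod_le _).trans ?_
  have hsymm : ∀ r θ : ℝ, Complex.polarCoord.symm (r, θ) = circleMap 0 r θ := fun r θ => by
    rw [Complex.polarCoord_symm_apply, circleMap, Complex.exp_mul_I]
    push_cast
    ring
  simp only [hsymm]
  have hne : ∀ᵐ r ∂(volume : Measure ℝ).restrict (Ioi 0), r ≠ ‖ζ‖ :=
    ae_restrict_of_ae (by simp [ae_iff])
  have hbound : ∀ᵐ r ∂(volume : Measure ℝ).restrict (Ioi 0),
      ∫⁻ θ in Ioo (-Real.pi) Real.pi, ENNReal.ofReal r • F (circleMap 0 r θ)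
      ≤ (Ioo (1 - ε) 1).indicator (fun r => ENNReal.ofReal (4 * Real.pi * √ε)
        * ENNReal.ofReal (√|r - ‖ζ‖|)⁻¹) r := by
    filter_upwards [hne, ae_restrict_mem measurableSet_Ioi] with r hr hr0
    have hr0 : 0 < r := hr0
    by_cases hmem : r ∈ Ioo (1 - ε) 1
    · rw [indicator_of_mem hmem]
      have hr1 : r < 1 := hmem.2
      have hrε : 1 - ε < r := hmem.1
      calc ∫⁻ θ in Ioo (-Real.pi) Real.pi, ENNReal.ofReal r • F (circleMap 0 r θ)
          ≤ ∫⁻ θ in Ioo (-Real.pi) Real.pi,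
              ENNReal.ofReal (reflectedKernel (circleMap 0 r θ) ζ) := by
            refine lintegral_mono fun θ => ?_
            rw [smul_eq_mul]
            calc ENNReal.ofReal r * F (circleMap 0 r θ) ≤ 1 * F (circleMap 0 r θ) := by
                  gcongr
                  exact ENNReal.ofReal_le_one.2 hr1.le
              _ ≤ _ := by
                  rw [one_mul]
                  exact indicator_le_self _ _ _
        _ ≤ _ := lintegral_reflectedKernel_circle hr0 hr1 hζ hr
        _ ≤ ENNReal.ofReal (4 * Real.pi * √ε * (√|r - ‖ζ‖|)⁻¹) := by
            apply ENNReal.ofReal_le_ofReal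
            have hs := norm_nonneg ζ
            have hx : 0 < |r - ‖ζ‖| := abs_pos.2 (sub_ne_zero.2 hr)
            -- Here `r + |ζ| ≥ 1/2` because `ε ≤ 1/2`. With `1 - r²|ζ|² ≥ 1 - r²` and `1 - r² ≤ 2ε`,
            -- only the integrable singularity `|r - |ζ||^(-1/2)` is left, with a factor `√ε`.
            have ha : |r - ‖ζ‖| / 2 ≤ |r ^ 2 - ‖ζ‖ ^ 2| := by
              rw [show r ^ 2 - ‖ζ‖ ^ 2 = (r - ‖ζ‖) * (r + ‖ζ‖) by ring, abs_mul,
                abs_of_nonneg (show 0 ≤ r + ‖ζ‖ by positivity)]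
              nlinarith
            have hc0 : 0 < 1 - r ^ 2 := by nlinarith
            have hb : 1 - r ^ 2 ≤ 1 - r ^ 2 * ‖ζ‖ ^ 2 := by
              linarith [mul_le_of_le_one_right (sq_nonneg r) (pow_le_one₀ hs hζ.le (n := 2))]
            have hc : 1 - r ^ 2 ≤ 2 * ε := by nlinarith
            have k1 : (1 - r ^ 2) / (√|r ^ 2 - ‖ζ‖ ^ 2| * √(1 - r ^ 2 * ‖ζ‖ ^ 2))
                ≤ (1 - r ^ 2) / (√(|r - ‖ζ‖| / 2) * √(1 - r ^ 2)) := by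
              have : 0 < √(|r - ‖ζ‖| / 2) := Real.sqrt_pos.2 (by positivity)
              have : 0 < √(1 - r ^ 2) := Real.sqrt_pos.2 hc0
              gcongr
            have k2 : (1 - r ^ 2) / (√(|r - ‖ζ‖| / 2) * √(1 - r ^ 2))
                = √(1 - r ^ 2) / √(|r - ‖ζ‖| / 2) := by
              have : 0 < √(|r - ‖ζ‖| / 2) := Real.sqrt_pos.2 (by positivity)
              have h2 : 0 < √(1 - r ^ 2) := Real.sqrt_pos.2 hc0
              rw [div_eq_div_iff (by positivity) (by positivity)]
              linear_combination (-√(|r - ‖ζ‖| / 2)) * Real.mul_self_sqrt hc0.le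
            have k3 : √(1 - r ^ 2) / √(|r - ‖ζ‖| / 2) ≤ 2 * √ε * (√|r - ‖ζ‖|)⁻¹ := by
              rw [← Real.sqrt_div hc0.le, ← Real.sqrt_inv,
                show (2 : ℝ) = √4 by rw [show (4 : ℝ) = 2 ^ 2 by norm_num]; simp,
                ← Real.sqrt_mul (by norm_num), ← Real.sqrt_mul (by positivity)]
              apply Real.sqrt_le_sqrt
              rw [div_le_iff₀ (by positivity)]
              have h4 : √(4 : ℝ) = 2 := by
                rw [show (4 : ℝ) = 2 ^ 2 by norm_num]; simp
              rw [h4]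
              field_simp
              linarith
            calc 2 * Real.pi * ((1 - r ^ 2) / (√|r ^ 2 - ‖ζ‖ ^ 2| * √(1 - r ^ 2 * ‖ζ‖ ^ 2)))
                ≤ 2 * Real.pi * (2 * √ε * (√|r - ‖ζ‖|)⁻¹) := by
                  have := Real.pi_pos
                  gcongr
                  exact k1.trans (k2.le.trans k3)
              _ = _ := by ring
        _ = _ := ENNReal.ofReal_mul (by positivity)
    · rw [indicator_of_notMem hmem]
      have : ∀ θ, F (circleMap 0 r θ) = 0 := fun θ => by
        refine indicator_of_notMem (fun h => hmem ?_) _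
        have h1 := h.1
        have h2 := h.2
        rw [norm_circleMap_zero, abs_of_pos hr0] at h1 h2
        exact ⟨h1, h2⟩
      simp [this]
  refine (lintegral_mono_ae hbound).trans ?_
  refine (setLIntegral_le_lintegral _ _).trans ?_
  rw [lintegral_indicator measurableSet_Ioo, lintegral_const_mul' _ _ ENNReal.ofReal_ne_top]
  refine (mul_le_mul_right (lintegral_inv_sqrt_abs_sub_le hε ‖ζ‖) _).trans ?_
  rw [← ENNReal.ofReal_mul (by positivity)]
  apply ENNReal.ofReal_le_ofReal
  have := Real.mul_self_sqrt hε.le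
  have hpi := Real.pi_pos
  nlinarith

/-! ### Boundary values of the formula of order one -/

theorem measurable_reflectedKernel :
    Measurable fun q : ℂ × ℂ => ENNReal.ofReal (reflectedKernel q.1 q.2) := by
  refine ENNReal.measurable_ofReal.comp ?_
  refine Measurable.div (by fun_prop) (Measurable.mul (by fun_prop) ?_)
  exact Continuous.measurable (continuous_const.sub
    ((Complex.continuous_conj.comp continuous_fst).mul continuous_snd)).norm

/-- Away from the pole, the mean of the reflected kernel over thin annuli is small. -/
theorem lintegral_reflectedKernel_annulus_le' {ε : ℝ} (hε : 0 < ε) {ζ : ℂ} (hζ : ‖ζ‖ < 1)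
    (hε1 : ε < (1 - ‖ζ‖) / 2) :
    ∫⁻ z in annulus ε, ENNReal.ofReal (reflectedKernel z ζ)
      ≤ ENNReal.ofReal (2 * ε / ((1 - ‖ζ‖) / 2) ^ 2 * (2 * Real.pi * ε)) := by
  have hs := norm_nonneg ζ
  have ha : 0 < (1 - ‖ζ‖) / 2 := by linarith
  calc ∫⁻ z in annulus ε, ENNReal.ofReal (reflectedKernel z ζ)
      ≤ ∫⁻ _ in annulus ε, ENNReal.ofReal (2 * ε / ((1 - ‖ζ‖) / 2) ^ 2) := by
        refine setLIntegral_mono' (measurableSet_annulus ε) fun z hz => ?_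
        apply ENNReal.ofReal_le_ofReal
        have h1 := hz.1
        have h2 := hz.2
        have h0 := norm_nonneg z
        have h3 : (1 - ‖ζ‖) / 2 ≤ ‖ζ - z‖ := by
          have := norm_sub_norm_le z ζ
          rw [norm_sub_rev] at this
          linarith
        have h4 : (1 - ‖ζ‖) / 2 ≤ ‖1 - conj z * ζ‖ := by
          have := norm_sub_norm_le (1 : ℂ) (conj z * ζ)
          rw [norm_one, norm_mul, RCLike.norm_conj] at this
          nlinarith
        have h5 : 0 ≤ 1 - ‖z‖ ^ 2 := by nlinarith
        have h6 : 1 - ‖z‖ ^ 2 ≤ 2 * ε := by nlinarith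
        unfold reflectedKernel
        rw [sq ((1 - ‖ζ‖) / 2)]
        gcongr
    _ ≤ _ := by
        rw [lintegral_const, Measure.restrict_apply_univ, ENNReal.ofReal_mul (by positivity)]
        gcongr
        exact volume_annulus_le hε (by linarith)

/-- The potential of an integrable density with respect to the reflected kernel vanishes on the
circle in the mean. -/
theorem hasBoundaryValue_reflected {f : ℂ → ℂ} (hf : IntegrableOn f disk) :
    HasBoundaryValue (fun z => ∫ ζ in disk,
      f ζ * ((1 - ‖z‖ ^ 2 : ℝ) / ((ζ - z) * (1 - conj z * ζ)))) (fun _ => (0 : ℂ)) := by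
  set N : ℝ → ℂ → ENNReal := fun ε ζ =>
    ENNReal.ofReal ε⁻¹ * ∫⁻ z in annulus ε, ENNReal.ofReal (reflectedKernel z ζ) with hN
  have hNmeas : ∀ ε, Measurable (N ε) := fun ε =>
    (Measurable.lintegral_prod_left' measurable_reflectedKernel).const_mul _
  -- Dominated convergence in the pole: the annular means are at most `20π` uniformly, and each
  -- tends to `0` once the annulus has moved away from `ζ`.
  have hlim : Tendsto (fun ε : ℝ => ∫⁻ ζ in disk, ‖f ζ‖ₑ * N ε ζ) (𝓝[>] 0)
      (𝓝 (∫⁻ _ in disk, 0)) := by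
    refine tendsto_lintegral_filter_of_dominated_convergence'
      (fun ζ => ‖f ζ‖ₑ * ENNReal.ofReal (20 * Real.pi)) ?_ ?_ ?_ ?_
    · exact Eventually.of_forall fun ε =>
        hf.aestronglyMeasurable.enorm.mul (hNmeas ε).aemeasurable
    · filter_upwards [self_mem_nhdsWithin, nhdsWithin_le_nhds
        (Iio_mem_nhds (show (0 : ℝ) < 1 / 2 by norm_num))] with ε h0 h1
      have h0 : 0 < ε := h0
      have h1 : ε < 1 / 2 := h1
      filter_upwards [ae_restrict_mem measurableSet_ball] with ζ hζ
      gcongr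
      calc N ε ζ ≤ ENNReal.ofReal ε⁻¹ * ENNReal.ofReal (20 * Real.pi * ε) := by
            simp only [hN]
            gcongr
            exact lintegral_reflectedKernel_annulus_le h0 h1.le (mem_ball_zero_iff.1 hζ)
        _ = _ := by
            rw [← ENNReal.ofReal_mul (by positivity)]
            congr 1
            field_simp
    · rw [lintegral_mul_const' _ _ ENNReal.ofReal_ne_top]
      exact ENNReal.mul_ne_top hf.2.ne ENNReal.ofReal_ne_top
    · filter_upwards [ae_restrict_mem measurableSet_ball] with ζ hζ
      rw [mem_ball_zero_iff] at hζ
      have ha : 0 < (1 - ‖ζ‖) / 2 := by linarith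
      have hNlim : Tendsto (fun ε => N ε ζ) (𝓝[>] 0) (𝓝 0) := by
        have hup : Tendsto (fun ε : ℝ => ENNReal.ofReal (4 * Real.pi / ((1 - ‖ζ‖) / 2) ^ 2 * ε))
            (𝓝[>] 0) (𝓝 0) := by
          have : ContinuousAt (fun ε : ℝ =>
              ENNReal.ofReal (4 * Real.pi / ((1 - ‖ζ‖) / 2) ^ 2 * ε)) 0 :=
            (ENNReal.continuous_ofReal.comp (by fun_prop)).continuousAt
          have := this.tendsto.mono_left (nhdsWithin_le_nhds (s := Ioi 0))
          simpa using this
        refine tendsto_of_tendsto_of_tendsto_of_le_of_le' tendsto_const_nhds hup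
          (Eventually.of_forall fun _ => zero_le) ?_
        filter_upwards [self_mem_nhdsWithin, nhdsWithin_le_nhds (Iio_mem_nhds ha)] with ε h0 h1
        have h0 : 0 < ε := h0
        calc N ε ζ ≤ ENNReal.ofReal ε⁻¹ *
              ENNReal.ofReal (2 * ε / ((1 - ‖ζ‖) / 2) ^ 2 * (2 * Real.pi * ε)) := by
              simp only [hN]
              gcongr
              exact lintegral_reflectedKernel_annulus_le' h0 hζ h1
          _ = _ := by
              rw [← ENNReal.ofReal_mul (by positivity)]
              congr 1
              field_simp
              ring
      have := ENNReal.Tendsto.const_mul (a := ‖f ζ‖ₑ) hNlim (Or.inr enorm_ne_top)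
      rwa [mul_zero] at this
  rw [lintegral_zero] at hlim
  refine tendsto_of_tendsto_of_tendsto_of_le_of_le' tendsto_const_nhds hlim
    (Eventually.of_forall fun _ => zero_le) (Eventually.of_forall fun ε => ?_)
  change ENNReal.ofReal ε⁻¹ * ∫⁻ z in annulus ε, _ ≤ _
  have hpt : ∀ z ∈ annulus ε, ‖(∫ ζ in disk,
      f ζ * ((1 - ‖z‖ ^ 2 : ℝ) / ((ζ - z) * (1 - conj z * ζ)))) - 0‖ₑ
      ≤ ∫⁻ ζ in disk, ‖f ζ‖ₑ * ENNReal.ofReal (reflectedKernel z ζ) := by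
    intro z hz
    rw [sub_zero]
    refine (enorm_integral_le_lintegral_enorm _).trans (le_of_eq ?_)
    congr 1
    ext ζ
    rw [enorm_mul, ← ofReal_norm (_ / _), reflectedKernel, norm_div, norm_mul, Complex.norm_real,
      Real.norm_eq_abs, abs_of_nonneg]
    have h2 := hz.2
    nlinarith [norm_nonneg z]
  calc ENNReal.ofReal ε⁻¹ * ∫⁻ z in annulus ε, _
      ≤ ENNReal.ofReal ε⁻¹ * ∫⁻ z in annulus ε, ∫⁻ ζ in disk,
          ‖f ζ‖ₑ * ENNReal.ofReal (reflectedKernel z ζ) :=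
        mul_le_mul_right (setLIntegral_mono' (measurableSet_annulus ε) hpt) _
    _ = ENNReal.ofReal ε⁻¹ * ∫⁻ ζ in disk, ∫⁻ z in annulus ε,
          ‖f ζ‖ₑ * ENNReal.ofReal (reflectedKernel z ζ) := by
        rw [lintegral_lintegral_swap]
        exact (hf.aestronglyMeasurable.enorm.comp_snd).mul measurable_reflectedKernel.aemeasurable
    _ = ∫⁻ ζ in disk, ‖f ζ‖ₑ * N ε ζ := by
        rw [← lintegral_const_mul' _ _ ENNReal.ofReal_ne_top]
        congr 1
        ext ζ
        rw [lintegral_const_mul' _ _ enorm_ne_top]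
        simp only [hN]
        ring

/-- Poisson integrals of continuous functions converge uniformly to their boundary values. -/
theorem exists_norm_poisson_sub_le {g : ℂ → ℂ} (hg : ContinuousOn g circle) {δ : ℝ} (hδ : 0 < δ) :
    ∃ r < (1 : ℝ), 0 ≤ r ∧ ∀ z : ℂ, r < ‖z‖ → ‖z‖ < 1 →
      ‖(2 * Real.pi : ℂ)⁻¹ * (∫ θ in (0)..(2 * Real.pi),
        (((1 - ‖z‖ ^ 2) / ‖circleMap 0 1 θ - z‖ ^ 2 : ℝ) : ℂ) * g (circleMap 0 1 θ))
        - g (z / (‖z‖ : ℂ))‖ ≤ δ := by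
  obtain ⟨M, hM⟩ := (isCompact_sphere (0 : ℂ) 1).exists_bound_of_continuousOn hg
  have hM0 : 0 ≤ M := (norm_nonneg _).trans (hM 1 (by simp))
  have huc := (isCompact_sphere (0 : ℂ) 1).uniformContinuousOn_of_continuous hg
  rw [Metric.uniformContinuousOn_iff] at huc
  obtain ⟨η, hη, hη'⟩ := huc (δ / 2) (by positivity)
  -- The first bound keeps `|ζ - z| ≥ η/2` when `ζ` is at least `η` away from the projection of `z`.
  -- There `1 - |z|² ≤ 2(1 - |z|)` bounds the kernel times `2M` by `16M(1 - |z|)/η²`, which the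
  -- second bound makes at most `δ/2`.
  set κ := min (η / 2) (δ * η ^ 2 / (32 * (M + 1))) with hκ
  have hκ0 : 0 < κ := by positivity
  refine ⟨max (1 - κ) 0, by simp [hκ0], le_max_right _ _, fun z hz1 hz2 => ?_⟩
  rw [max_lt_iff] at hz1
  have hz0 : ‖z‖ ≠ 0 := hz1.2.ne'
  have hκ1 : 1 - ‖z‖ < η / 2 := by linarith [min_le_left (η / 2) (δ * η ^ 2 / (32 * (M + 1)))]
  have hκ2 : 1 - ‖z‖ < δ * η ^ 2 / (32 * (M + 1)) := by
    linarith [min_le_right (η / 2) (δ * η ^ 2 / (32 * (M + 1)))]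
  rw [lt_div_iff₀ (by positivity)] at hκ2
  set a := z / (‖z‖ : ℂ) with ha
  have hac : a ∈ circle := by simp [ha, hz0]
  have haz : ‖a - z‖ = 1 - ‖z‖ := by
    have h1 : z = (‖z‖ : ℂ) * a := by
      rw [ha, mul_div_cancel₀]; exact_mod_cast hz0
    have h2 : a - z = ((1 - ‖z‖ : ℝ) : ℂ) * a := by
      push_cast; linear_combination -h1
    have h3 : ‖a‖ = 1 := by simpa using hac
    rw [h2, norm_mul, h3, mul_one, Complex.norm_real, Real.norm_eq_abs,
      abs_of_nonneg (by linarith)]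
  have hpc : Continuous fun θ : ℝ => (1 - ‖z‖ ^ 2) / ‖circleMap 0 1 θ - z‖ ^ 2 := by
    refine Continuous.div continuous_const (by fun_prop) fun θ => pow_ne_zero 2 fun h => ?_
    rw [norm_eq_zero, sub_eq_zero] at h
    rw [← h] at hz2
    simp at hz2
  have hgc : Continuous fun θ : ℝ => g (circleMap 0 1 θ) :=
    hg.comp_continuous (continuous_circleMap 0 1) fun θ => by simp
  have hmass := integral_poissonKernel hz2
  rw [one_pow] at hmass
  have hpi := Real.pi_pos
  have hz3 : 0 ≤ 1 - ‖z‖ ^ 2 := by nlinarith [norm_nonneg z]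
  have hdiff : (2 * Real.pi : ℂ)⁻¹ * (∫ θ in (0)..(2 * Real.pi),
        (((1 - ‖z‖ ^ 2) / ‖circleMap 0 1 θ - z‖ ^ 2 : ℝ) : ℂ) * g (circleMap 0 1 θ)) - g a
      = (2 * Real.pi : ℂ)⁻¹ * (∫ θ in (0)..(2 * Real.pi),
        (((1 - ‖z‖ ^ 2) / ‖circleMap 0 1 θ - z‖ ^ 2 : ℝ) : ℂ) * (g (circleMap 0 1 θ) - g a)) := by
    have j1 : IntervalIntegrable (fun θ => (((1 - ‖z‖ ^ 2) / ‖circleMap 0 1 θ - z‖ ^ 2 : ℝ) : ℂ)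
        * g (circleMap 0 1 θ)) volume 0 (2 * Real.pi) :=
      ((Complex.continuous_ofReal.comp hpc).mul hgc).intervalIntegrable _ _
    have j2 : IntervalIntegrable (fun θ => (((1 - ‖z‖ ^ 2) / ‖circleMap 0 1 θ - z‖ ^ 2 : ℝ) : ℂ)
        * g a) volume 0 (2 * Real.pi) :=
      ((Complex.continuous_ofReal.comp hpc).mul continuous_const).intervalIntegrable _ _
    simp only [mul_sub]
    rw [intervalIntegral.integral_sub j1 j2, intervalIntegral.integral_mul_const, intervalIntegral.integral_ofReal, hmass]
    have : (Real.pi : ℂ) ≠ 0 := by exact_mod_cast hpi.ne'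
    push_cast
    field_simp
  rw [hdiff, norm_mul]
  have hpt : ∀ θ : ℝ,
      ‖(((1 - ‖z‖ ^ 2) / ‖circleMap 0 1 θ - z‖ ^ 2 : ℝ) : ℂ) * (g (circleMap 0 1 θ) - g a)‖
      ≤ (1 - ‖z‖ ^ 2) / ‖circleMap 0 1 θ - z‖ ^ 2 * (δ / 2) + δ / 2 := by
    intro θ
    set ζ := circleMap 0 1 θ
    have hζ : ζ ∈ circle := by simp [ζ]
    have hq : 0 ≤ (1 - ‖z‖ ^ 2) / ‖ζ - z‖ ^ 2 := by positivity
    rw [norm_mul, Complex.norm_real, Real.norm_eq_abs, abs_of_nonneg hq]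
    rcases lt_or_ge (dist ζ a) η with h | h
    · have := (hη' ζ hζ a hac h).le
      rw [dist_eq_norm] at this
      have := mul_le_mul_of_nonneg_left this hq
      linarith
    · have h1 : η / 2 ≤ ‖ζ - z‖ := by
        rw [dist_eq_norm] at h
        have : ‖ζ - a‖ ≤ ‖ζ - z‖ + ‖a - z‖ := by
          rw [norm_sub_rev a z]
          exact norm_sub_le_norm_sub_add_norm_sub _ _ _
        linarith
      have h2 : ‖g ζ - g a‖ ≤ 2 * M := by
        have := norm_sub_le (g ζ) (g a)
        linarith [hM ζ hζ, hM a hac]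
      have h3 : (1 - ‖z‖ ^ 2) / ‖ζ - z‖ ^ 2 ≤ (1 - ‖z‖ ^ 2) / (η / 2) ^ 2 := by gcongr
      have h4 : (1 - ‖z‖ ^ 2) / (η / 2) ^ 2 * (2 * M) ≤ δ / 2 := by
        rw [div_mul_eq_mul_div, div_le_iff₀ (by positivity)]
        have h5 : 1 - ‖z‖ ^ 2 ≤ 2 * (1 - ‖z‖) := by nlinarith [norm_nonneg z]
        nlinarith
      calc (1 - ‖z‖ ^ 2) / ‖ζ - z‖ ^ 2 * ‖g ζ - g a‖
          ≤ (1 - ‖z‖ ^ 2) / (η / 2) ^ 2 * (2 * M) := by gcongr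
        _ ≤ δ / 2 := h4
        _ ≤ _ := le_add_of_nonneg_left (by positivity)
  have hint : IntervalIntegrable (fun θ : ℝ =>
      (1 - ‖z‖ ^ 2) / ‖circleMap 0 1 θ - z‖ ^ 2 * (δ / 2)) volume 0 (2 * Real.pi) :=
    (hpc.mul continuous_const).intervalIntegrable _ _
  have hconst : IntervalIntegrable (fun _ : ℝ => δ / 2) volume 0 (2 * Real.pi) :=
    continuous_const.intervalIntegrable _ _
  have hle := intervalIntegral.norm_integral_le_of_norm_le (by positivity)
    (ae_of_all _ fun θ _ => hpt θ)
    (hint.add hconst)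
  rw [intervalIntegral.integral_add hint hconst, intervalIntegral.integral_mul_const, hmass,
    intervalIntegral.integral_const] at hle
  have hnorm : ‖(2 * Real.pi : ℂ)⁻¹‖ = (2 * Real.pi)⁻¹ := by
    rw [norm_inv, norm_mul, Complex.norm_real, Real.norm_eq_abs, abs_of_pos hpi]
    simp
  rw [hnorm, inv_mul_le_iff₀ (by positivity)]
  refine hle.trans (le_of_eq ?_)
  simp only [sub_zero, smul_eq_mul]
  ring

section OrderOne

variable {f : ℂ → ℂ} {γ : ℕ → ℂ → ℂ}

/-- The numerator is `1 - z*ζ + z*(ζ - z) = 1 - |z|²`: adding the kernel of the condition creates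
the factor that vanishes on the circle. -/
theorem inv_sub_add_conj_mul_inv {z ζ : ℂ} (h1 : ζ ≠ z) (h2 : 1 - conj z * ζ ≠ 0) :
    (ζ - z)⁻¹ + conj z * (1 - conj z * ζ)⁻¹
      = ((1 - ‖z‖ ^ 2 : ℝ) : ℂ) / ((ζ - z) * (1 - conj z * ζ)) := by
  have h3 : ζ - z ≠ 0 := sub_ne_zero.2 h1
  have h4 : conj z * z = (‖z‖ : ℂ) ^ 2 := Complex.conj_mul' z
  rw [eq_div_iff (mul_ne_zero h3 h2)]
  push_cast
  linear_combination (1 - conj z * ζ) * inv_mul_cancel₀ h3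
    + conj z * (ζ - z) * inv_mul_cancel₀ h2 - h4

/-- Under the integral condition, the formula of order one is the difference of a Poisson integral
and an integral against the reflected kernel. -/
theorem ae_cauchyPompeiu_one_eq (hf : IntegrableOn f disk) (hγ : ContinuousOn (γ 0) circle)
    (hI : ∀ z ∈ disk, conj z / Real.pi * conditionSum 1 f γ z = 0) :
    cauchyPompeiu 1 f γ =ᵐ[volume.restrict disk] fun z =>
      (2 * Real.pi : ℂ)⁻¹ * (∫ θ in (0)..(2 * Real.pi),
        (((1 - ‖z‖ ^ 2) / ‖circleMap 0 1 θ - z‖ ^ 2 : ℝ) : ℂ) * γ 0 (circleMap 0 1 θ))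
      - (Real.pi : ℂ)⁻¹ * ∫ ζ in disk,
        f ζ * ((1 - ‖z‖ ^ 2 : ℝ) / ((ζ - z) * (1 - conj z * ζ))) := by
  filter_upwards [ae_integrableOn_areaIntegrand hf 1, ae_restrict_mem measurableSet_ball]
    with z hz hzd
  have hz1 := mem_ball_zero_iff.1 hzd
  have hpi : (Real.pi : ℂ) ≠ 0 := by exact_mod_cast Real.pi_ne_zero
  have hIne := Complex.I_ne_zero
  have hcond := hI z hzd
  have hchain := (dbarChain_conditionKernel hz1).continuousOn 0
  have hk0 : ∀ ζ, conditionKernel z 0 ζ = (1 - conj z * ζ)⁻¹ := fun ζ => by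
    simp [conditionKernel]
  have hc0 : ∀ ζ, cauchyKernel 0 (ζ - z) = (ζ - z)⁻¹ := fun ζ => by simp [cauchyKernel]
  have hne : ∀ ζ ∈ circle, ζ - z ≠ 0 := fun ζ hζ h => by
    rw [sub_eq_zero] at h
    rw [mem_sphere_zero_iff_norm, h] at hζ
    linarith
  -- the area part
  have i1 : IntegrableOn (fun ζ => (ζ - z)⁻¹ * f ζ) disk := by
    refine hz.congr (Eventually.of_forall fun ζ => ?_)
    simp [areaIntegrand]
    ring
  have i2 : IntegrableOn (fun ζ => conj z * ((1 - conj z * ζ)⁻¹ * f ζ)) disk := by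
    refine Integrable.const_mul ?_ _
    have := integrableOn_mul_of_continuousOn hf hchain
    simp only [hk0] at this
    exact this
  have harea : ∫ ζ in disk, f ζ * ((1 - ‖z‖ ^ 2 : ℝ) / ((ζ - z) * (1 - conj z * ζ)))
      = (∫ ζ in disk, (ζ - z)⁻¹ * f ζ) + conj z * ∫ ζ in disk, (1 - conj z * ζ)⁻¹ * f ζ := by
    rw [← integral_const_mul, ← integral_add i1 i2]
    refine integral_congr_ae ?_
    have hnz : ∀ᵐ ζ ∂volume.restrict disk, ζ ≠ z := ae_restrict_of_ae (by simp [ae_iff])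
    filter_upwards [hnz, ae_restrict_mem measurableSet_ball] with ζ h1 h2
    rw [← inv_sub_add_conj_mul_inv h1
      (one_sub_conj_mul_ne_zero hz1 (mem_ball_zero_iff.1 h2).le)]
    ring
  -- the boundary part
  have hci1 : CircleIntegrable (fun ζ => (ζ - z)⁻¹ * γ 0 ζ) 0 1 := by
    refine ContinuousOn.circleIntegrable zero_le_one (ContinuousOn.mul ?_ hγ)
    exact ContinuousOn.inv₀ (by fun_prop) hne
  have hci2 : CircleIntegrable (fun ζ => conj z * ((1 - conj z * ζ)⁻¹ * γ 0 ζ)) 0 1 := by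
    refine ContinuousOn.circleIntegrable zero_le_one
      (continuousOn_const.mul (ContinuousOn.mul ?_ hγ))
    refine ContinuousOn.inv₀ (by fun_prop) fun ζ hζ => ?_
    exact one_sub_conj_mul_ne_zero hz1 (mem_sphere_zero_iff_norm.1 hζ).le
  have hbdry : (∮ ζ in C(0, 1), (ζ - z)⁻¹ * γ 0 ζ)
      + conj z * (∮ ζ in C(0, 1), (1 - conj z * ζ)⁻¹ * γ 0 ζ)
      = Complex.I * ∫ θ in (0)..(2 * Real.pi),
        (((1 - ‖z‖ ^ 2) / ‖circleMap 0 1 θ - z‖ ^ 2 : ℝ) : ℂ) * γ 0 (circleMap 0 1 θ) := by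
    rw [← smul_eq_mul (conj z), ← circleIntegral.integral_smul]
    simp only [smul_eq_mul]
    rw [← circleIntegral.integral_add hci1 hci2, circleIntegral,
      ← intervalIntegral.integral_const_mul]
    congr 1
    ext θ
    rw [deriv_circleMap, smul_eq_mul]
    have hζ : circleMap 0 1 θ ∈ circle := by simp
    generalize circleMap 0 1 θ = ζ at hζ
    have h1 := hne ζ hζ
    have hn : ‖ζ‖ = 1 := mem_sphere_zero_iff_norm.1 hζ
    have h2 := one_sub_conj_mul_ne_zero (z := z) hz1 hn.le
    have h3 := inv_sub_add_conj_mul_inv (sub_ne_zero.1 h1) h2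
    have h4 : conj ζ * ζ = 1 := by rw [Complex.conj_mul', hn]; simp
    -- On the circle `1 = ζ*ζ`, so the second factor is `ζ(ζ - z)*`. The extra `ζ` cancels the one
    -- in `dζ`, leaving the Poisson kernel.
    have h5 : (ζ - z) * (1 - conj z * ζ) = ζ * (‖ζ - z‖ : ℂ) ^ 2 := by
      rw [← Complex.conj_mul', map_sub]
      linear_combination -(ζ - z) * h4
    have h6 : ζ ≠ 0 := by
      intro h
      rw [h, norm_zero] at hn
      norm_num at hn
    have h7 : (‖ζ - z‖ : ℂ) ≠ 0 := by
      exact_mod_cast norm_ne_zero_iff.2 h1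
    rw [h5] at h3
    have h8 : ζ * ((ζ - z)⁻¹ + conj z * (1 - conj z * ζ)⁻¹)
        = (((1 - ‖z‖ ^ 2) / ‖ζ - z‖ ^ 2 : ℝ) : ℂ) := by
      rw [h3]
      push_cast
      field_simp
    rw [← h8]
    ring
  rw [cauchyPompeiu_eq, harea]
  rw [conditionSum] at hcond
  simp only [Finset.range_one, Finset.sum_singleton, pow_zero, pow_one, hk0, tsub_self] at hcond
  simp only [Finset.range_one, Finset.sum_singleton, pow_zero, pow_one, hc0, tsub_self]
  have hp : ∫ θ in (0)..(2 * Real.pi),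
        (((1 - ‖z‖ ^ 2) / ‖circleMap 0 1 θ - z‖ ^ 2 : ℝ) : ℂ) * γ 0 (circleMap 0 1 θ)
      = ((∮ ζ in C(0, 1), (ζ - z)⁻¹ * γ 0 ζ)
        + conj z * (∮ ζ in C(0, 1), (1 - conj z * ζ)⁻¹ * γ 0 ζ)) / Complex.I := by
    rw [hbdry]
    field_simp
  rw [hp]
  generalize (∮ ζ in C(0, 1), (ζ - z)⁻¹ * γ 0 ζ) = A1 at *
  generalize (∮ ζ in C(0, 1), (1 - conj z * ζ)⁻¹ * γ 0 ζ) = A2 at *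
  generalize (∫ ζ in disk, (ζ - z)⁻¹ * f ζ) = A3 at *
  generalize (∫ ζ in disk, (1 - conj z * ζ)⁻¹ * f ζ) = A4 at *
  field_simp at hcond ⊢
  linear_combination -hcond

/-- The Poisson part converges uniformly and the reflected part vanishes in the mean, which is
exactly the form of error that `HasBoundaryValue.of_le` admits. -/
theorem hasBoundaryValue_cauchyPompeiu_one (hf : IntegrableOn f disk)
    (hγ : ContinuousOn (γ 0) circle)
    (hI : ∀ z ∈ disk, conj z / Real.pi * conditionSum 1 f γ z = 0) :
    HasBoundaryValue (cauchyPompeiu 1 f γ) (γ 0) := by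
  refine HasBoundaryValue.congr_ae ?_ (ae_cauchyPompeiu_one_eq hf hγ hI).symm
  refine (hasBoundaryValue_reflected hf).of_le 1 fun δ hδ => ?_
  obtain ⟨r, hr1, hr0, hr⟩ := exists_norm_poisson_sub_le hγ (δ := δ) hδ
  refine ⟨r, hr1, fun z hz1 hz2 => ?_⟩
  have h1 := hr z hz1 hz2
  set P := (2 * Real.pi : ℂ)⁻¹ * (∫ θ in (0)..(2 * Real.pi),
        (((1 - ‖z‖ ^ 2) / ‖circleMap 0 1 θ - z‖ ^ 2 : ℝ) : ℂ) * γ 0 (circleMap 0 1 θ))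
  set B := ∫ ζ in disk, f ζ * ((1 - ‖z‖ ^ 2 : ℝ) / ((ζ - z) * (1 - conj z * ζ)))
  have hpi : ‖(Real.pi : ℂ)⁻¹‖ ≤ 1 := by
    rw [norm_inv, Complex.norm_real, Real.norm_eq_abs, abs_of_pos Real.pi_pos]
    exact inv_le_one_of_one_le₀ (by linarith [Real.pi_gt_three])
  have key : ‖P - (Real.pi : ℂ)⁻¹ * B - γ 0 (z / (‖z‖ : ℂ))‖ ≤ ‖B - 0‖ + δ := by
    calc ‖P - (Real.pi : ℂ)⁻¹ * B - γ 0 (z / (‖z‖ : ℂ))‖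
        = ‖(P - γ 0 (z / (‖z‖ : ℂ))) - (Real.pi : ℂ)⁻¹ * B‖ := by ring_nf
      _ ≤ ‖P - γ 0 (z / (‖z‖ : ℂ))‖ + ‖(Real.pi : ℂ)⁻¹ * B‖ := norm_sub_le _ _
      _ ≤ δ + 1 * ‖B‖ := by
          rw [norm_mul]
          gcongr
      _ = _ := by rw [sub_zero]; ring
  have := ENNReal.ofReal_le_ofReal key
  rw [ofReal_norm, ENNReal.ofReal_add (by positivity) (by positivity), ofReal_norm] at this
  simpa using this

theorem solvesComplex_cauchyPompeiu_one (hf : IntegrableOn f disk)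
    (hγ : ContinuousOn (γ 0) circle)
    (hI : ∀ z ∈ disk, conj z / Real.pi * conditionSum 1 f γ z = 0) :
    IsWeakDbar (fun c => Complex.I * c) (cauchyPompeiu 1 f γ) f ∧
      HasBoundaryValue (cauchyPompeiu 1 f γ) (γ 0) :=
  ⟨isWeakDbar_cauchyPompeiu_one hf hγ, hasBoundaryValue_cauchyPompeiu_one hf hγ hI⟩

end OrderOne

/-! ### The complex problem -/

/-- By induction, the conditions of positive index yield the first derivative `u`; the condition of
index `0` then allows one more integration. -/
theorem exists_solvesComplex {n : ℕ} {f : ℂ → ℂ} {γ : ℕ → ℂ → ℂ} (hf : IntegrableOn f disk)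
    (hγ : ∀ k < n, ContinuousOn (γ k) circle) (hI : IntegralConditions n f γ) :
    ∃ w, SolvesComplex n f γ w := by
  rw [integralConditions_iff] at hI
  induction n generalizing γ with
  | zero => exact ⟨f, solvesDirichlet_zero_iff.2 ⟨hf.locallyIntegrableOn, ae_eq_refl _⟩⟩
  | succ n ih =>
    have hγ' : ∀ k < n, ContinuousOn (γ (k + 1)) circle := fun k hk => hγ _ (by omega)
    obtain ⟨u, hu⟩ := ih (γ := fun k => γ (k + 1)) hγ' fun z hz k hk => by
      have := hI z hz (k + 1) (by omega)
      rw [Nat.add_sub_add_right] at this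
      rw [← this]
      congr 3
      ext m
      rw [show k + m + 1 = k + 1 + m by omega]
    have hui : IntegrableOn u disk := SolvesDirichlet.integrableOn hu hf hγ'
    have h1 := solvesComplex_cauchyPompeiu_one (γ := γ) hui (hγ 0 n.succ_pos) fun z hz => by
      have h0 := hI z hz 0 n.succ_pos
      have hz1 := mem_ball_zero_iff.1 hz
      -- This replaces `∫ u / (1 - z*ζ)` by the higher boundary terms and the term in `f`, so the
      -- order-one condition for `u, γ 0` is the condition of index `0` for the given data.
      have key := SolvesComplex.iterated_green hu hf hγ' (dbarChain_conditionKernel hz1)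
      rw [← h0]
      congr 1
      simp only [conditionSum, zero_add, Nat.sub_zero, Nat.add_sub_cancel, Finset.range_one,
        Finset.sum_singleton, tsub_self]
      rw [key, Finset.sum_range_succ']
      have : ∑ k ∈ Finset.range n, (-1 : ℂ) ^ (k + 1) / (2 * Complex.I)
          * (∮ ζ in C(0, 1), conditionKernel z (k + 1) ζ * γ (k + 1) ζ)
          = -∑ k ∈ Finset.range n, (-1 : ℂ) ^ k / (2 * Complex.I)
            * (∮ ζ in C(0, 1), conditionKernel z (k + 1) ζ * γ (k + 1) ζ) := by
        rw [← Finset.sum_neg_distrib]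
        refine Finset.sum_congr rfl fun k _ => ?_
        ring
      rw [this]
      ring
    exact ⟨cauchyPompeiu 1 u γ, solvesDirichlet_succ_iff.2 ⟨u, h1.1, h1.2, hu⟩⟩

/-- The polyanalytic Dirichlet problem in the disk. -/
theorem solvesComplex_iff {n : ℕ} (hn : 0 < n) {f : ℂ → ℂ} {γ : ℕ → ℂ → ℂ}
    (hf : IntegrableOn f disk) (hγ : ∀ k < n, ContinuousOn (γ k) circle) (w : ℂ → ℂ) :
    SolvesComplex n f γ w ↔
      IntegralConditions n f γ ∧ w =ᵐ[volume.restrict disk] cauchyPompeiu n f γ := by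
  constructor
  · intro h
    exact ⟨h.integralConditions hf hγ, h.ae_eq_cauchyPompeiu hn hf hγ⟩
  · rintro ⟨hI, hw⟩
    -- The formula of order `n` is not differentiated directly: some solution exists, and the
    -- representation identifies it with the formula.
    obtain ⟨u, hu⟩ := exists_solvesComplex hf hγ hI
    exact SolvesDirichlet.congr_ae hu ((hu.ae_eq_cauchyPompeiu hn hf hγ).trans hw.symm)

/-! ### Bicomplex-valued functions and their idempotent components -/

theorem norm_plus_le (b : Bicomplex) : ‖b.plus‖ ≤ 2 * ‖b‖ := by
  rw [Bicomplex.norm_def]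
  have h : ‖b.plus‖ / 2 ≤ √((‖b.plus‖ ^ 2 + ‖b.minus‖ ^ 2) / 2) := by
    apply Real.le_sqrt_of_sq_le
    nlinarith [sq_nonneg ‖b.plus‖, sq_nonneg ‖b.minus‖]
  linarith

theorem norm_minus_le (b : Bicomplex) : ‖b.minus‖ ≤ 2 * ‖b‖ := by
  rw [Bicomplex.norm_def]
  have h : ‖b.minus‖ / 2 ≤ √((‖b.plus‖ ^ 2 + ‖b.minus‖ ^ 2) / 2) := by
    apply Real.le_sqrt_of_sq_le
    nlinarith [sq_nonneg ‖b.plus‖, sq_nonneg ‖b.minus‖]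
  linarith

theorem norm_le_plus_add_minus (b : Bicomplex) : ‖b‖ ≤ ‖b.plus‖ + ‖b.minus‖ := by
  rw [Bicomplex.norm_def, Real.sqrt_le_left (by positivity)]
  nlinarith [norm_nonneg b.plus, norm_nonneg b.minus, sq_nonneg (‖b.plus‖ + ‖b.minus‖)]

/-- The map `w ↦ (w⁺)*` as a real-linear map. -/
noncomputable def plusConjCLM : Bicomplex →L[ℝ] ℂ :=
  LinearMap.mkContinuous
    { toFun := fun b => conj b.plus
      map_add' := fun x y => by simp [Bicomplex.plus]; ring
      map_smul' := fun r x => by simp [Bicomplex.plus]; ring }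
    2 fun b => by simpa using norm_plus_le b

/-- The map `w ↦ w⁻` as a real-linear map. -/
noncomputable def minusCLM : Bicomplex →L[ℝ] ℂ :=
  LinearMap.mkContinuous
    { toFun := fun b => b.minus
      map_add' := fun x y => by simp [Bicomplex.minus]; ring
      map_smul' := fun r x => by simp [Bicomplex.minus]; ring }
    2 fun b => norm_minus_le b

/-- The bicomplex number with `(w⁺)* = a` and `w⁻ = b`. -/
noncomputable def ofParts (a b : ℂ) : Bicomplex :=
  conj a • Bicomplex.pPlus + b • Bicomplex.pMinus

theorem plus_ofParts (a b : ℂ) : (ofParts a b).plus = conj a :=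
  ((Bicomplex.eq_idempotent_iff (ofParts a b) (conj a) b).1 rfl).1.symm

theorem minus_ofParts (a b : ℂ) : (ofParts a b).minus = b :=
  ((Bicomplex.eq_idempotent_iff (ofParts a b) (conj a) b).1 rfl).2.symm

@[simp] theorem plusConjCLM_apply (b : Bicomplex) : plusConjCLM b = conj b.plus := rfl

@[simp] theorem minusCLM_apply (b : Bicomplex) : minusCLM b = b.minus := rfl

theorem plusConj_ofParts (u v : ℂ → ℂ) : plusConj (fun z => ofParts (u z) (v z)) = u := by
  ext z
  simp [plusConj, plus_ofParts]

theorem minusPart_ofParts (u v : ℂ → ℂ) : minusPart (fun z => ofParts (u z) (v z)) = v := by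
  ext z
  simp [minusPart, minus_ofParts]

theorem bicomplex_ext {x y : Bicomplex} (h1 : conj x.plus = conj y.plus)
    (h2 : x.minus = y.minus) : x = y := by
  rw [(Bicomplex.eq_idempotent_iff x x.plus x.minus).2 ⟨rfl, rfl⟩,
    (Bicomplex.eq_idempotent_iff y y.plus y.minus).2 ⟨rfl, rfl⟩, h2,
    (starRingEnd ℂ).injective h1]

theorem ofParts_eq_self (b : Bicomplex) : ofParts (conj b.plus) b.minus = b :=
  bicomplex_ext (by simp [plus_ofParts]) (by simp [minus_ofParts])

/-- On the plus component `j` acts as `-i`, which conjugation turns into `i`; this is why the first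
complex problem has conjugated data. -/
theorem plusConj_j_mul (b : Bicomplex) :
    conj (Bicomplex.j * b).plus = Complex.I * conj b.plus := by
  rw [Bicomplex.mul_def]
  simp only [Bicomplex.plus, Bicomplex.j, zero_mul, one_mul, zero_sub, zero_add, map_sub, map_neg,
    map_mul, Complex.conj_I]
  linear_combination -conj b.im * Complex.I_mul_I

theorem minus_j_mul (b : Bicomplex) : (Bicomplex.j * b).minus = Complex.I * b.minus := by
  rw [Bicomplex.mul_def]
  simp only [Bicomplex.minus, Bicomplex.j, zero_mul, one_mul, zero_sub, zero_add]
  linear_combination -b.im * Complex.I_mul_I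

/-- Multiplication by `j` as a real-linear map. -/
noncomputable def jCLM : Bicomplex →L[ℝ] Bicomplex :=
  LinearMap.toContinuousLinearMap
    { toFun := fun b => Bicomplex.j * b
      map_add' := fun x y => mul_add _ x y
      map_smul' := fun r x => mul_smul_comm r _ x }

@[simp] theorem jCLM_apply (b : Bicomplex) : jCLM b = Bicomplex.j * b := rfl

/-- Complex numbers `(a, b)` as bicomplex numbers, real-linearly. -/
noncomputable def ofPartsCLM : ℂ × ℂ →L[ℝ] Bicomplex :=
  LinearMap.toContinuousLinearMap
    { toFun := fun q => ofParts q.1 q.2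
      map_add' := fun x y => bicomplex_ext
        (by rw [← plusConjCLM_apply, ← plusConjCLM_apply, map_add]; simp [plus_ofParts])
        (by rw [← minusCLM_apply, ← minusCLM_apply, map_add]; simp [minus_ofParts])
      map_smul' := fun r x => bicomplex_ext
        (by rw [← plusConjCLM_apply, ← plusConjCLM_apply, map_smul]; simp [plus_ofParts])
        (by rw [← minusCLM_apply, ← minusCLM_apply, map_smul]; simp [minus_ofParts]) }

@[simp] theorem ofPartsCLM_apply (q : ℂ × ℂ) : ofPartsCLM q = ofParts q.1 q.2 := rfl

theorem locallyIntegrableOn_comp_clm {E F : Type*} [NormedAddCommGroup E] [NormedSpace ℝ E]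
    [NormedAddCommGroup F] [NormedSpace ℝ F] (L : E →L[ℝ] F) {u : ℂ → E}
    (h : LocallyIntegrableOn u disk) : LocallyIntegrableOn (fun z => L (u z)) disk := by
  rw [locallyIntegrableOn_iff Metric.isOpen_ball.isLocallyClosed] at h ⊢
  exact fun K hK hKc => L.integrable_comp (h K hK hKc)

theorem locallyIntegrableOn_iff_parts {u : ℂ → Bicomplex} :
    LocallyIntegrableOn u disk ↔
      LocallyIntegrableOn (plusConj u) disk ∧ LocallyIntegrableOn (minusPart u) disk := by
  refine ⟨fun h => ⟨locallyIntegrableOn_comp_clm plusConjCLM h,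
    locallyIntegrableOn_comp_clm minusCLM h⟩, fun ⟨h1, h2⟩ => ?_⟩
  have h3 : LocallyIntegrableOn (fun z => (plusConj u z, minusPart u z)) disk := by
    rw [locallyIntegrableOn_iff Metric.isOpen_ball.isLocallyClosed] at h1 h2 ⊢
    exact fun K hK hKc => (h1 K hK hKc).prodMk (h2 K hK hKc)
  have h4 := locallyIntegrableOn_comp_clm ofPartsCLM h3
  simpa only [ofPartsCLM_apply, plusConj, minusPart, ofParts_eq_self] using h4

theorem ae_eq_iff_parts {u v : ℂ → Bicomplex} {μ : Measure ℂ} :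
    u =ᵐ[μ] v ↔ plusConj u =ᵐ[μ] plusConj v ∧ minusPart u =ᵐ[μ] minusPart v := by
  constructor
  · intro h
    constructor
    · filter_upwards [h] with z hz
      simp only [plusConj, hz]
    · filter_upwards [h] with z hz
      simp only [minusPart, hz]
  · rintro ⟨h1, h2⟩
    filter_upwards [h1, h2] with z hz1 hz2
    exact bicomplex_ext hz1 hz2

/-- The two component maps are real-linear and jointly injective. Since test functions are real,
both maps pass through the weak identity, conjugation included. -/
theorem isWeakDbar_iff_parts {u v : ℂ → Bicomplex} :
    IsWeakDbar (fun b => Bicomplex.j * b) u v ↔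
      IsWeakDbar (fun c => Complex.I * c) (plusConj u) (plusConj v) ∧
        IsWeakDbar (fun c => Complex.I * c) (minusPart u) (minusPart v) := by
  unfold IsWeakDbar
  rw [locallyIntegrableOn_iff_parts, locallyIntegrableOn_iff_parts]
  -- Both sides contain local integrability, so it may be assumed; it is what lets the component
  -- maps commute with the integrals.
  by_cases hu : LocallyIntegrableOn (plusConj u) disk ∧ LocallyIntegrableOn (minusPart u) disk
  swap
  · exact iff_of_false (fun h => hu h.1) fun h => hu ⟨h.1.1, h.2.1⟩
  by_cases hv : LocallyIntegrableOn (plusConj v) disk ∧ LocallyIntegrableOn (minusPart v) disk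
  swap
  · exact iff_of_false (fun h => hv h.2.1) fun h => hv ⟨h.1.2.1, h.2.2.1⟩
  have hu' := locallyIntegrableOn_iff_parts.2 hu
  have hv' := locallyIntegrableOn_iff_parts.2 hv
  have hju : LocallyIntegrableOn (fun z => Bicomplex.j * u z) disk :=
    locallyIntegrableOn_comp_clm jCLM hu'
  have key : ∀ φ : ℂ → ℝ, ContDiff ℝ ∞ φ → HasCompactSupport φ → tsupport φ ⊆ disk →
      (∫ z in disk, (1 / 2 : ℝ) • (fderiv ℝ φ z 1 • u z
          + fderiv ℝ φ z Complex.I • (Bicomplex.j * u z)) = -∫ z in disk, φ z • v z ↔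
        (∫ z in disk, (1 / 2 : ℝ) • (fderiv ℝ φ z 1 • plusConj u z
          + fderiv ℝ φ z Complex.I • (Complex.I * plusConj u z))
            = -∫ z in disk, φ z • plusConj v z) ∧
        (∫ z in disk, (1 / 2 : ℝ) • (fderiv ℝ φ z 1 • minusPart u z
          + fderiv ℝ φ z Complex.I • (Complex.I * minusPart u z))
            = -∫ z in disk, φ z • minusPart v z)) := by
    intro φ h1 h2 h3
    have hcont : ∀ c : ℂ, Continuous fun z => fderiv ℝ φ z c := fun c =>
      (h1.continuous_fderiv (by simp)).clm_apply continuous_const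
    have hsupp : ∀ c : ℂ, Function.support (fun z => fderiv ℝ φ z c) ⊆ tsupport φ := by
      intro c z hz
      by_contra h
      apply hz
      simp [fderiv_of_notMem_tsupport (𝕜 := ℝ) h]
    have i1 : IntegrableOn (fun z => (1 / 2 : ℝ) • (fderiv ℝ φ z 1 • u z
        + fderiv ℝ φ z Complex.I • (Bicomplex.j * u z))) disk :=
      Integrable.smul (1 / 2 : ℝ)
        ((integrable_smul_of_hasCompactSupport hu' (hcont 1) h2 (hsupp 1) h3).add
          (integrable_smul_of_hasCompactSupport hju (hcont Complex.I) h2 (hsupp Complex.I) h3))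
    have i2 : IntegrableOn (fun z => φ z • v z) disk :=
      integrable_smul_of_hasCompactSupport hv' h1.continuous h2 subset_closure h3
    have a1 := plusConjCLM.integral_comp_comm i1
    have a2 := minusCLM.integral_comp_comm i1
    have b1 := plusConjCLM.integral_comp_comm i2
    have b2 := minusCLM.integral_comp_comm i2
    simp only [map_smul, map_add, plusConjCLM_apply, minusCLM_apply, plusConj_j_mul,
      minus_j_mul] at a1 a2 b1 b2
    simp only [plusConj, minusPart]
    rw [a1, a2, b1, b2]
    constructor
    · intro h
      rw [h]
      exact ⟨map_neg plusConjCLM _, map_neg minusCLM _⟩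
    · rintro ⟨e1, e2⟩
      exact bicomplex_ext (e1.trans (map_neg plusConjCLM _).symm)
        (e2.trans (map_neg minusCLM _).symm)
  constructor
  · rintro ⟨-, -, h⟩
    exact ⟨⟨hu.1, hv.1, fun φ h1 h2 h3 => ((key φ h1 h2 h3).1 (h φ h1 h2 h3)).1⟩,
      ⟨hu.2, hv.2, fun φ h1 h2 h3 => ((key φ h1 h2 h3).1 (h φ h1 h2 h3)).2⟩⟩
  · rintro ⟨⟨-, -, h⟩, ⟨-, -, h'⟩⟩
    exact ⟨hu, hv, fun φ h1 h2 h3 =>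
      (key φ h1 h2 h3).2 ⟨h φ h1 h2 h3, h' φ h1 h2 h3⟩⟩

theorem isWeakDbarIter_iff_parts {k : ℕ} {w v : ℂ → Bicomplex} :
    IsWeakDbarIter (fun b => Bicomplex.j * b) k w v ↔
      IsWeakDbarIter (fun c => Complex.I * c) k (plusConj w) (plusConj v) ∧
        IsWeakDbarIter (fun c => Complex.I * c) k (minusPart w) (minusPart v) := by
  induction k generalizing v with
  | zero =>
    simp only [IsWeakDbarIter]
    rw [locallyIntegrableOn_iff_parts, ae_eq_iff_parts]
    tauto
  | succ k ih =>
    constructor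
    · rintro ⟨u, h1, h2⟩
      obtain ⟨h3, h4⟩ := ih.1 h1
      obtain ⟨h5, h6⟩ := isWeakDbar_iff_parts.1 h2
      exact ⟨⟨_, h3, h5⟩, ⟨_, h4, h6⟩⟩
    · rintro ⟨⟨u₁, h3, h5⟩, ⟨u₂, h4, h6⟩⟩
      refine ⟨fun z => ofParts (u₁ z) (u₂ z), ih.2 ?_, isWeakDbar_iff_parts.2 ?_⟩ <;>
        rw [plusConj_ofParts, minusPart_ofParts]
      · exact ⟨h3, h4⟩
      · exact ⟨h5, h6⟩

theorem HasBoundaryValue.comp_clm {E F : Type*} [NormedAddCommGroup E] [NormedSpace ℝ E]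
    [NormedAddCommGroup F] [NormedSpace ℝ F] {u g : ℂ → E} (h : HasBoundaryValue u g)
    (L : E →L[ℝ] F) : HasBoundaryValue (fun z => L (u z)) (fun z => L (g z)) := by
  refine h.of_le ‖L‖₊ fun δ _ => ⟨0, zero_lt_one, fun z _ _ => ?_⟩
  rw [← map_sub]
  exact (L.le_opENorm _).trans le_self_add

/-- The norm is at most the sum of the component norms. Additivity of the lower Lebesgue integral
requires one summand to be measurable, which the hypotheses on `u` and `g` supply. -/
theorem hasBoundaryValue_iff_parts {u g : ℂ → Bicomplex} (hu : LocallyIntegrableOn u disk)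
    (hg : ContinuousOn g circle) :
    HasBoundaryValue u g ↔ HasBoundaryValue (plusConj u) (plusConj g) ∧
      HasBoundaryValue (minusPart u) (minusPart g) := by
  refine ⟨fun h => ⟨h.comp_clm plusConjCLM, h.comp_clm minusCLM⟩, fun ⟨h1, h2⟩ => ?_⟩
  have hsum := h1.add h2
  rw [add_zero] at hsum
  refine tendsto_of_tendsto_of_tendsto_of_le_of_le tendsto_const_nhds hsum
    (fun _ => zero_le) fun ε => ?_
  have hgc : ContinuousOn (plusConj g) circle := plusConjCLM.continuous.comp_continuousOn hg
  have hmeas : AEStronglyMeasurable (fun z => plusConj u z - plusConj g (z / (‖z‖ : ℂ)))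
      (volume.restrict disk) :=
    (locallyIntegrableOn_iff_parts.1 hu).1.aestronglyMeasurable.sub
      (aestronglyMeasurable_comp_div_norm hgc)
  change ENNReal.ofReal ε⁻¹ * ∫⁻ z in annulus ε, _
    ≤ ENNReal.ofReal ε⁻¹ * (∫⁻ z in annulus ε, _) + ENNReal.ofReal ε⁻¹ * ∫⁻ z in annulus ε, _
  rw [← mul_add, ← lintegral_add_left' (hmeas.mono_measure
    (Measure.restrict_mono (annulus_subset_disk ε) le_rfl)).enorm]
  refine mul_le_mul_right (lintegral_mono fun z => ?_) _
  have e1 : plusConj u z - plusConj g (z / (‖z‖ : ℂ))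
      = conj (u z - g (z / (‖z‖ : ℂ))).plus := (map_sub plusConjCLM _ _).symm
  have e2 : minusPart u z - minusPart g (z / (‖z‖ : ℂ))
      = (u z - g (z / (‖z‖ : ℂ))).minus := (map_sub minusCLM _ _).symm
  have h := ENNReal.ofReal_le_ofReal (norm_le_plus_add_minus (u z - g (z / (‖z‖ : ℂ))))
  rw [ENNReal.ofReal_add (norm_nonneg _) (norm_nonneg _), ofReal_norm, ofReal_norm,
    ofReal_norm] at h
  rw [e1, e2, ← ofReal_norm (conj _), RCLike.norm_conj, ofReal_norm]
  exact h

theorem IsWeakDbarIter.locallyIntegrableOn_right {E : Type*} [NormedAddCommGroup E]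
    [NormedSpace ℝ E] {J : E → E} {k : ℕ} {w v : ℂ → E} (h : IsWeakDbarIter J k w v) :
    LocallyIntegrableOn v disk := by
  cases k with
  | zero => exact LocallyIntegrableOn.congr h.2 h.1
  | succ k =>
    obtain ⟨u, -, h2⟩ := h
    exact h2.2.1

/-- The bicomplex problem is equivalent to a pair of complex problems. -/
theorem solvesBicomplex_iff_parts {n : ℕ} {f : ℂ → Bicomplex} {γ : ℕ → ℂ → Bicomplex}
    (hγ : ∀ k < n, ContinuousOn (γ k) circle) {w : ℂ → Bicomplex} :
    SolvesBicomplex n f γ w ↔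
      SolvesComplex n (plusConj f) (fun k => plusConj (γ k)) (plusConj w) ∧
        SolvesComplex n (minusPart f) (fun k => minusPart (γ k)) (minusPart w) := by
  constructor
  · rintro ⟨h1, h2⟩
    have h3 := isWeakDbarIter_iff_parts.1 h1
    refine ⟨⟨h3.1, fun k hk => ?_⟩, ⟨h3.2, fun k hk => ?_⟩⟩ <;> obtain ⟨v, h4, h5⟩ := h2 k hk
    · exact ⟨_, (isWeakDbarIter_iff_parts.1 h4).1, h5.comp_clm plusConjCLM⟩
    · exact ⟨_, (isWeakDbarIter_iff_parts.1 h4).2, h5.comp_clm minusCLM⟩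
  · rintro ⟨⟨h1, h2⟩, ⟨h3, h4⟩⟩
    refine ⟨isWeakDbarIter_iff_parts.2 ⟨h1, h3⟩, fun k hk => ?_⟩
    obtain ⟨v₁, h5, h6⟩ := h2 k hk
    obtain ⟨v₂, h7, h8⟩ := h4 k hk
    have h9 : IsWeakDbarIter (fun b => Bicomplex.j * b) k w fun z => ofParts (v₁ z) (v₂ z) := by
      rw [isWeakDbarIter_iff_parts, plusConj_ofParts, minusPart_ofParts]
      exact ⟨h5, h7⟩
    refine ⟨_, h9, (hasBoundaryValue_iff_parts h9.locallyIntegrableOn_right (hγ k hk)).2 ?_⟩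
    rw [plusConj_ofParts, minusPart_ofParts]
    exact ⟨h6, h8⟩

theorem ae_eq_bicomplexCauchyPompeiu_iff {n : ℕ} {f : ℂ → Bicomplex} {γ : ℕ → ℂ → Bicomplex}
    {w : ℂ → Bicomplex} {μ : Measure ℂ} :
    w =ᵐ[μ] bicomplexCauchyPompeiu n f γ ↔
      plusConj w =ᵐ[μ] cauchyPompeiu n (plusConj f) (fun k => plusConj (γ k)) ∧
        minusPart w =ᵐ[μ] cauchyPompeiu n (minusPart f) (fun k => minusPart (γ k)) := by
  have h : bicomplexCauchyPompeiu n f γ = fun z =>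
      ofParts (cauchyPompeiu n (plusConj f) (fun k => plusConj (γ k)) z)
        (cauchyPompeiu n (minusPart f) (fun k => minusPart (γ k)) z) := rfl
  rw [h, ae_eq_iff_parts, plusConj_ofParts, minusPart_ofParts]

end PolyDirichlet


/-! ### The bicomplex Dirichlet problem -/

theorem mainTheorem4 (n : ℕ) (hn : 0 < n)
    (f : ℂ → Bicomplex) (hf : IntegrableOn f disk)
    (γ : ℕ → ℂ → Bicomplex) (hγ : ∀ k < n, ContinuousOn (γ k) circle) :
    -- for a given function `w`, the three statements are equivalent
    (∀ w : ℂ → Bicomplex, List.TFAE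
      [ SolvesBicomplex n f γ w,
        SolvesComplex n (plusConj f) (fun k => plusConj (γ k)) (plusConj w) ∧
          SolvesComplex n (minusPart f) (fun k => minusPart (γ k)) (minusPart w),
        (IntegralConditions n (plusConj f) (fun k => plusConj (γ k)) ∧
          IntegralConditions n (minusPart f) (fun k => minusPart (γ k))) ∧
          w =ᵐ[volume.restrict disk] bicomplexCauchyPompeiu n f γ ]) ∧
    -- solvability is equivalent to the integral conditions alone
    List.TFAE
      [ ∃ w : ℂ → Bicomplex, SolvesBicomplex n f γ w,
        (∃ w₁ : ℂ → ℂ, SolvesComplex n (plusConj f) (fun k => plusConj (γ k)) w₁) ∧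
          (∃ w₂ : ℂ → ℂ, SolvesComplex n (minusPart f) (fun k => minusPart (γ k)) w₂),
        IntegralConditions n (plusConj f) (fun k => plusConj (γ k)) ∧
          IntegralConditions n (minusPart f) (fun k => minusPart (γ k)) ] ∧
    -- the solution, when it exists, is given by the formula, whose area integrals converge
    (∀ w : ℂ → Bicomplex, SolvesBicomplex n f γ w →
      w =ᵐ[volume.restrict disk] bicomplexCauchyPompeiu n f γ) ∧
    (∀ᵐ z ∂(volume.restrict disk),
      IntegrableOn (areaIntegrand n (plusConj f) z) disk ∧
        IntegrableOn (areaIntegrand n (minusPart f) z) disk) := by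
  have hf₁ : IntegrableOn (plusConj f) disk := plusConjCLM.integrable_comp hf
  have hf₂ : IntegrableOn (minusPart f) disk := minusCLM.integrable_comp hf
  have hγ₁ : ∀ k < n, ContinuousOn (plusConj (γ k)) circle := fun k hk =>
    plusConjCLM.continuous.comp_continuousOn (hγ k hk)
  have hγ₂ : ∀ k < n, ContinuousOn (minusPart (γ k)) circle := fun k hk =>
    minusCLM.continuous.comp_continuousOn (hγ k hk)
  have h12 : ∀ w, SolvesBicomplex n f γ w ↔
      SolvesComplex n (plusConj f) (fun k => plusConj (γ k)) (plusConj w) ∧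
        SolvesComplex n (minusPart f) (fun k => minusPart (γ k)) (minusPart w) := fun w =>
    solvesBicomplex_iff_parts hγ
  have h23 : ∀ w, (SolvesComplex n (plusConj f) (fun k => plusConj (γ k)) (plusConj w) ∧
        SolvesComplex n (minusPart f) (fun k => minusPart (γ k)) (minusPart w)) ↔
      (IntegralConditions n (plusConj f) (fun k => plusConj (γ k)) ∧
          IntegralConditions n (minusPart f) (fun k => minusPart (γ k))) ∧
          w =ᵐ[volume.restrict disk] bicomplexCauchyPompeiu n f γ := fun w => by
    rw [solvesComplex_iff hn hf₁ hγ₁, solvesComplex_iff hn hf₂ hγ₂,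
      ae_eq_bicomplexCauchyPompeiu_iff]
    tauto
  refine ⟨fun w => ?_, ?_, fun w hw => ((h23 w).1 ((h12 w).1 hw)).2, ?_⟩
  · tfae_have 1 ↔ 2 := h12 w
    tfae_have 2 ↔ 3 := h23 w
    tfae_finish
  · tfae_have 1 → 2 := fun ⟨w, hw⟩ => ⟨⟨_, ((h12 w).1 hw).1⟩, ⟨_, ((h12 w).1 hw).2⟩⟩
    tfae_have 2 → 3 := fun ⟨⟨_, h1⟩, ⟨_, h2⟩⟩ =>
      ⟨h1.integralConditions hf₁ hγ₁, h2.integralConditions hf₂ hγ₂⟩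
    -- The formula itself is the witness, through the equivalences for a fixed function.
    tfae_have 3 → 1 := fun h =>
      ⟨bicomplexCauchyPompeiu n f γ, (h12 _).2 ((h23 _).2 ⟨h, ae_eq_refl _⟩)⟩
    tfae_finish
  · filter_upwards [ae_integrableOn_areaIntegrand hf₁ n, ae_integrableOn_areaIntegrand hf₂ n]
      with z h1 h2
    exact ⟨h1, h2⟩
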